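/- Write points of $\mathbb R^3$ as $x=(x_1,x_2,x_3)$, let $r=\sqrt{x_1^2+x_2^2}$, $\mathbf e_r=(\frac{x_1}{r},\frac{x_2}{r},0)$, $\mathbf e_\theta=(-\frac{x_2}{r},\frac{x_1}{r},0)$, $\mathbf e_3=(0,0,1)$, and let $v^r,v^\theta,v^3$ be the components of a vector field $\mathbf v$ in this frame; $\partial_r$ and $\partial_3$ are the derivatives in the directions $\mathbf e_r$ and $\mathbf e_3$. A scalar function is axisymmetric if it depends on $(r,x_3)$ only, and a vector field is axisymmetric if its three components $v^r,v^\theta,v^3$ are. $\|\cdot\|_q$ is the norm of $L^q(\mathbb R^3)$. Let $T>0$. A smooth axisymmetric solution $(\rho,\mathbf u)$, with pressure $\Pi$, of the inhomogeneous incompressible Navier-Stokes system on $[0,T]$ consists of $C^\infty$ functions $\rho>0$, $\mathbf u$, $\Pi$ on $[0,T]\times\mathbb R^3$, axisymmetric at each time, such that on $[0,T]\times\mathbb R^3$ $$\partial_t\rho+\operatorname{div}(\rho\mathbf u)=0,\qquad \partial_t(\rho\mathbf u)+\operatorname{div}(\rho\mathbf u\otimes\mathbf u)-\Delta\mathbf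 u+\nabla\Pi=0,\qquad \operatorname{div}\mathbf u=0,$$ and such that $a=\frac1\rho-1$ and all its spatial derivatives are bounded on $[0,T]\times\mathbb R^3$, while $\mathbf u,\partial_t\mathbf u,\nabla\Pi\in C([0,T];H^k(\mathbb R^3))$ for every $k\ge 0$. (Time derivatives at $t=0$ and $t=T$ are one-sided.) Let $\boldsymbol\omega=\operatorname{curl}\mathbf u$, $\Phi=\omega^r/r$ and $\Gamma=\omega^\theta/r$. **Lemma.** There are absolute constants $C,C_0>0$ such that for every $T>0$ and every smooth axisymmetric solution on $[0,T]$ with $a|_{r=0}=0$ on $[0,T]$, the following holds for all $t\in[0,T]$: all the norms below are finite, the function $\|\Phi\|_2^2+\|\Gamma\|_2^2$ of time is differentiable at $t$ (one-sidedly at the end points), and at time $t$ $$\frac12\frac{d}{dt}\left(\|\Phi\|_2^2+\|\Gamma\|_2^2\right)+\|\nabla\Phi\|_2^2+\|\nabla\Gamma\|_2^2$$ $$\le C\left\|\frac ar\right\|_\infty\left(\|\nabla\Pi\|_2+\|\nabla\omega^\theta\|_2+\|\Gamma\|_2+\|\partial_r\omega^3-\partial_3\omega^r\|_2\right)\left(\|\nabla\Gamma\|_2+\|\nabla\Phi\|_2\right)+C_0\|u^\theta\|_3\|\nabla\Gamma\|_2\|\nabla\Phi\|_2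 .$$ -/

import Mathlib

open MeasureTheory Filter Topology Set
open scoped ContDiff Gradient Laplacian

noncomputable section

namespace AxiNS

/-- Three-dimensional Euclidean space; the coordinates `x₁, x₂, x₃` are `x 0, x 1, x 2`. -/
abbrev E3 := EuclideanSpace ℝ (Fin 3)

/-! ### Differential operators in Cartesian coordinates -/

/-- The partial derivative `∂f/∂xᵢ`. -/
def pd (i : Fin 3) (f : E3 → ℝ) (x : E3) : ℝ :=
  fderiv ℝ f x (EuclideanSpace.single i 1)

/-- The divergence of a vector field. -/
def div (v : E3 → E3) (x : E3) : ℝ :=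
  ∑ i, pd i (fun y => v y i) x

/-- The curl of a vector field. -/
def curl (v : E3 → E3) (x : E3) : E3 :=
  !₂[pd 1 (fun y => v y 2) x - pd 2 (fun y => v y 1) x,
     pd 2 (fun y => v y 0) x - pd 0 (fun y => v y 2) x,
     pd 0 (fun y => v y 1) x - pd 1 (fun y => v y 0) x]

/-! ### Cylindrical coordinates

The quantities below are meant off the axis `r = 0`, which is a null set of `ℝ³`. -/

/-- The distance to the axis, `r = √(x₁² + x₂²)`. -/
def rad (x : E3) : ℝ := √(x 0 ^ 2 + x 1 ^ 2)

/-- The radial unit vector `e_r = (x₁/r, x₂/r, 0)`. -/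
def eR (x : E3) : E3 := !₂[x 0 / rad x, x 1 / rad x, 0]

/-- The angular unit vector `e_θ = (-x₂/r, x₁/r, 0)`. -/
def eTheta (x : E3) : E3 := !₂[-(x 1) / rad x, x 0 / rad x, 0]

/-- The component `v^r` of a vector field. -/
def compR (v : E3 → E3) (x : E3) : ℝ := inner ℝ (v x) (eR x)

/-- The component `v^θ` of a vector field. -/
def compTheta (v : E3 → E3) (x : E3) : ℝ := inner ℝ (v x) (eTheta x)

/-- The component `v³` of a vector field. -/
def comp3 (v : E3 → E3) (x : E3) : ℝ := v x 2

/-- The radial derivative `∂_r f`. -/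
def dR (f : E3 → ℝ) (x : E3) : ℝ := fderiv ℝ f x (eR x)

/-- The vertical derivative `∂₃ f`. -/
def d3 (f : E3 → ℝ) (x : E3) : ℝ := pd 2 f x

/-- A scalar function is axisymmetric if it depends on `(r, x₃)` only. -/
def AxisymmetricScalar (f : E3 → ℝ) : Prop :=
  ∀ x y : E3, rad x = rad y → x 2 = y 2 → f x = f y

/-- A vector field is axisymmetric if its components in the frame `(e_r, e_θ, e₃)` depend on
`(r, x₃)` only. -/
def AxisymmetricVector (v : E3 → E3) : Prop :=
  AxisymmetricScalar (compR v) ∧ AxisymmetricScalar (compTheta v) ∧ AxisymmetricScalar (comp3 v)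

/-! ### Time-dependent functions on `[0, T]` -/

/-- The time derivative on `[0, T]`, one-sided at the end points. -/
def dt {F : Type*} [NormedAddCommGroup F] [NormedSpace ℝ F]
    (T : ℝ) (f : ℝ → E3 → F) (t : ℝ) (x : E3) : F :=
  derivWithin (fun s => f s x) (Icc 0 T) t

/-- `f` is `C^∞` jointly in `(t, x) ∈ [0, T] × ℝ³`. -/
def SmoothOn {F : Type*} [NormedAddCommGroup F] [NormedSpace ℝ F]
    (T : ℝ) (f : ℝ → E3 → F) : Prop :=
  ContDiffOn ℝ ∞ (fun p : ℝ × E3 => f p.1 p.2) (Icc 0 T ×ˢ univ)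

/-- `f ∈ C([0, T]; H^k(ℝ³))` for every `k`, for a function `f` that is smooth in `x`: all the
spatial derivatives of `f` are square integrable and depend continuously on `t` in `L²`. -/
def ContinuousHInf {F : Type*} [NormedAddCommGroup F] [NormedSpace ℝ F]
    (T : ℝ) (f : ℝ → E3 → F) : Prop :=
  ∀ k : ℕ, ∀ t ∈ Icc 0 T,
    MemLp (iteratedFDeriv ℝ k (f t)) 2 volume ∧
    Tendsto (fun s => eLpNorm (iteratedFDeriv ℝ k (f s) - iteratedFDeriv ℝ k (f t)) 2 volume)
      (𝓝[Icc 0 T] t) (𝓝 0)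

/-- `f` and all its spatial derivatives are bounded on `[0, T] × ℝ³`. -/
def BoundedDerivs {F : Type*} [NormedAddCommGroup F] [NormedSpace ℝ F]
    (T : ℝ) (f : ℝ → E3 → F) : Prop :=
  ∀ k : ℕ, ∃ B : ℝ, ∀ t ∈ Icc 0 T, ∀ x, ‖iteratedFDeriv ℝ k (f t) x‖ ≤ B

/-! ### The inhomogeneous Navier-Stokes system -/

/-- The function `a = 1/ρ - 1`. -/
def aOf (ρ : ℝ → E3 → ℝ) (t : ℝ) (x : E3) : ℝ := 1 / ρ t x - 1

/-- `(ρ, u, P)` satisfies, on `[0, T] × ℝ³`,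
`∂ₜρ + div (ρu) = 0`, `∂ₜ(ρu) + div (ρu ⊗ u) - Δu + ∇P = 0`, `div u = 0`. -/
structure SolvesINS (T : ℝ) (ρ : ℝ → E3 → ℝ) (u : ℝ → E3 → E3) (P : ℝ → E3 → ℝ) : Prop where
  mass : ∀ t ∈ Icc 0 T, ∀ x,
    dt T ρ t x + div (fun y => ρ t y • u t y) x = 0
  momentum : ∀ t ∈ Icc 0 T, ∀ x, ∀ i,
    dt T (fun s y => ρ s y * u s y i) t x
      + ∑ j, pd j (fun y => ρ t y * u t y i * u t y j) x
      - Δ (fun y => u t y i) x + pd i (P t) x = 0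
  incompressible : ∀ t ∈ Icc 0 T, ∀ x, div (u t) x = 0

/-- `(ρ, u)`, with pressure `P`, is a smooth axisymmetric solution without vacuum on `[0, T]`:
all three are smooth and axisymmetric, solve the system, and lie in the usual class of smooth
solutions of finite energy, namely `a = 1/ρ - 1` has bounded derivatives,
`u ∈ C¹([0, T]; H^k)` and `∇P ∈ C([0, T]; H^k)` for every `k`. -/
structure SmoothAxisymmetricSolution (T : ℝ) (ρ : ℝ → E3 → ℝ) (u : ℝ → E3 → E3)
    (P : ℝ → E3 → ℝ) : Prop where
  solves : SolvesINS T ρ u P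
  pos : ∀ t ∈ Icc 0 T, ∀ x, 0 < ρ t x
  smooth_rho : SmoothOn T ρ
  smooth_u : SmoothOn T u
  smooth_P : SmoothOn T P
  axi_rho : ∀ t ∈ Icc 0 T, AxisymmetricScalar (ρ t)
  axi_u : ∀ t ∈ Icc 0 T, AxisymmetricVector (u t)
  axi_P : ∀ t ∈ Icc 0 T, AxisymmetricScalar (P t)
  bounded_a : BoundedDerivs T (aOf ρ)
  sobolev_u : ContinuousHInf T u
  sobolev_dt_u : ContinuousHInf T (dt T u)
  sobolev_grad_P : ContinuousHInf T (fun t => ∇ (P t))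

/-! ### Vorticity quantities of a velocity field -/

/-- `ω^r`, where `ω = curl u`. -/
def omegaR (v : E3 → E3) : E3 → ℝ := compR (curl v)

/-- `ω^θ`, where `ω = curl u`. -/
def omegaTheta (v : E3 → E3) : E3 → ℝ := compTheta (curl v)

/-- `ω³`, where `ω = curl u`. -/
def omega3 (v : E3 → E3) : E3 → ℝ := comp3 (curl v)

/-- `Φ = ω^r / r`. -/
def PhiOf (v : E3 → E3) (x : E3) : ℝ := omegaR v x / rad x

/-- `Γ = ω^θ / r`. -/
def GammaOf (v : E3 → E3) (x : E3) : ℝ := omegaTheta v x / rad x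

/-- `∂_r ω³ - ∂₃ ω^r`. -/
def crossVort (v : E3 → E3) (x : E3) : ℝ := dR (omega3 v) x - d3 (omegaR v) x

/-- The norm of `L²(ℝ³)`. -/
def norm2 {F : Type*} [NormedAddCommGroup F] (f : E3 → F) : ℝ := lpNorm f 2 volume

end AxiNS

end

/-!
The velocity is `r b e_r + r c e_θ + u₃ e₃` with `b = u^r/r` and `c = u^θ/r` smooth across the
axis (`CylField`). Both quotients are averages of derivatives of `u` along the segments orthogonal
to the axis (`avg`), and so is `r⁻¹ ∂_r f` for a smooth axisymmetric `f` (`kap`). In these terms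
`Φ = -∂₃ c` and `Γ = ∂₃ b - r⁻¹ ∂_r u₃` are smooth functions with square integrable derivatives of
all orders, up to the null set `r = 0`, on which the quotients by `r` of the statement have the
value `0`. The averages are contractions of `L²`, so that differentiability of `u` in time with
values in `H^k` gives the differentiability of `‖Φ‖₂² + ‖Γ‖₂²` (`hasL2Deriv_vorticity`).

The inequality is the sum of two energy estimates. With `D₅ = Δ + (2/r) ∂_r` (`lap5`), which is
dissipative because `∫ f r⁻¹ ∂_r f ≤ 0`, the equations are
`∂ₜ c + u·∇c + 2 b c = (1 + a) D₅ c` and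
`∂ₜ Γ + u·∇Γ = D₅ Γ + 2 c ∂₃ c + ∂₃ (a (D₅ b - r⁻¹ ∂_r P)) - r⁻¹ ∂_r (a (Δu₃ - ∂₃ P))`.

* `CylField.energy_swirl`: the first equation is tested with `-∂₃² c`. Integration by parts turns
  the nonlinear terms into `∫ c r² (∂₃ b · r⁻¹ ∂_r ∂₃ c - r⁻¹ ∂_r b · ∂₃² c)`, of size at most
  `‖u^θ‖₃ ‖∇b‖₆ ‖∇Φ‖₂`. Since `div u = 0` gives `D₅ b = ∂₃ Γ`, and `D₅` controls all second
  derivatives in `L²`, the Sobolev inequality yields `‖∇b‖₆ ≤ C ‖∇Γ‖₂` (`integral_stretching_le`).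
* `CylField.energy_gam`: the second equation is tested with `Γ`. The swirl term `2 ∫ c Γ ∂₃ c` is
  `2 ∫ u^θ (Γ/√r) (∂₃ c/√r)`, bounded by the Hardy–Sobolev inequality
  `‖f/√r‖₃ ≤ C ‖∇f‖₂` (`integral_mul_mul_le_hardy`).

In the terms with the density, derivatives are moved off `a`. As `a` is smooth, axisymmetric and
zero on the axis, it is `O(r²)` there and the integration by parts of `r⁻¹ ∂_r` has no boundary
term (`AxisCoeff.integral_mul_kap_mul`); then `|a| ≤ ‖a/r‖_∞ r` leaves a factor `r`, which
combines with `D₅ c`, `D₅ b`, `r⁻¹ ∂_r P` and `r⁻¹ ∂_r Γ` to give the vorticity norms of the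
statement, `‖∇P‖₂` and `‖∇Γ‖₂`.
-/

noncomputable section

namespace AxiNS

section

/-! ### Partial derivatives of smooth functions -/

variable {f g h : E3 → ℝ}

/-- The `i`-th standard basis vector of `ℝ³`. -/
abbrev ee (i : Fin 3) : E3 := EuclideanSpace.single i 1

lemma contDiff_coord (i : Fin 3) : ContDiff ℝ ∞ (fun x : E3 => x i) :=
  (EuclideanSpace.proj i : E3 →L[ℝ] ℝ).contDiff

lemma smooth_differentiable (hf : ContDiff ℝ ∞ f) : Differentiable ℝ f :=
  hf.differentiable (by simp)

lemma contDiff_pd (i : Fin 3) (hf : ContDiff ℝ ∞ f) : ContDiff ℝ ∞ (pd i f) := by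
  unfold pd
  exact (hf.fderiv_right (m := ∞) (by simp)).clm_apply contDiff_const

lemma pd_add (i : Fin 3) (hf : Differentiable ℝ f) (hg : Differentiable ℝ g) (x : E3) :
    pd i (fun y => f y + g y) x = pd i f x + pd i g x := by
  simp [pd, fderiv_fun_add (hf x) (hg x)]

lemma pd_sub (i : Fin 3) (hf : Differentiable ℝ f) (hg : Differentiable ℝ g) (x : E3) :
    pd i (fun y => f y - g y) x = pd i f x - pd i g x := by
  simp [pd, fderiv_fun_sub (hf x) (hg x)]

lemma pd_neg (i : Fin 3) (f : E3 → ℝ) (x : E3) :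
    pd i (fun y => - f y) x = - pd i f x := by
  simp [pd, fderiv_fun_neg]

lemma pd_mul (i : Fin 3) (hf : Differentiable ℝ f) (hg : Differentiable ℝ g) (x : E3) :
    pd i (fun y => f y * g y) x = pd i f x * g x + f x * pd i g x := by
  simp [pd, fderiv_fun_mul (hf x) (hg x)]; ring

lemma pd_const (i : Fin 3) (c : ℝ) (x : E3) : pd i (fun _ => c) x = 0 := by
  simp [pd]

lemma pd_const_mul (i : Fin 3) (c : ℝ) (hf : Differentiable ℝ f) (x : E3) :
    pd i (fun y => c * f y) x = c * pd i f x := by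
  simp [pd, fderiv_const_mul (hf x)]

lemma pd_coord (i j : Fin 3) (x : E3) :
    pd i (fun y : E3 => y j) x = if i = j then 1 else 0 := by
  have : (fun y : E3 => y j) = (EuclideanSpace.proj j : E3 →L[ℝ] ℝ) := rfl
  rw [pd, this, ContinuousLinearMap.fderiv]
  simp [eq_comm]

lemma pd_comm (i j : Fin 3) (hf : ContDiff ℝ ∞ f) (x : E3) :
    pd i (pd j f) x = pd j (pd i f) x := by
  have hd : DifferentiableAt ℝ (fderiv ℝ f) x :=
    ((hf.fderiv_right (m := ∞) (by simp)).differentiable (by simp)) x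
  have hs : IsSymmSndFDerivAt ℝ f x :=
    hf.contDiffAt.isSymmSndFDerivAt (by simp; exact WithTop.coe_le_coe.2 le_top)
  have key : ∀ k l : Fin 3, pd k (pd l f) x = fderiv ℝ (fderiv ℝ f) x (ee k) (ee l) := by
    intro k l
    have := fderiv_clm_apply hd (differentiableAt_const (x := x) (𝕜 := ℝ) (ee l))
    show fderiv ℝ (fun y => fderiv ℝ f y (ee l)) x (ee k) = _
    rw [this]; simp
  rw [key, key]; exact hs _ _

lemma fderiv_eq_sum_pd (f : E3 → ℝ) (x v : E3) :
    fderiv ℝ f x v = ∑ i, v i * pd i f x := by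
  have hv : v = ∑ i, v i • ee i := by
    ext j; simp [Pi.single_apply]
  conv_lhs => rw [hv]
  simp [pd]

lemma gradient_apply (f : E3 → ℝ) (x : E3) (i : Fin 3) : (∇ f x) i = pd i f x := by
  have : inner ℝ (∇ f x) (ee i) = pd i f x := by
    simp [gradient, pd]
  rw [← this, EuclideanSpace.inner_single_right]
  simp

lemma norm_gradient_sq (f : E3 → ℝ) (x : E3) :
    ‖∇ f x‖ ^ 2 = pd 0 f x ^ 2 + pd 1 f x ^ 2 + pd 2 f x ^ 2 := by
  rw [EuclideanSpace.norm_sq_eq, Fin.sum_univ_three]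
  simp [gradient_apply]

lemma laplacian_eq_sum_pd (hf : ContDiff ℝ ∞ f) (x : E3) :
    Δ f x = pd 0 (pd 0 f) x + pd 1 (pd 1 f) x + pd 2 (pd 2 f) x := by
  rw [congrFun (InnerProductSpace.laplacian_eq_iteratedFDeriv_orthonormalBasis f
    (EuclideanSpace.basisFun (Fin 3) ℝ)) x, ← Fin.sum_univ_three (fun i => pd i (pd i f) x)]
  refine Finset.sum_congr rfl fun i _ => ?_
  have hd : DifferentiableAt ℝ (fderiv ℝ f) x :=
    ((hf.fderiv_right (m := ∞) (by simp)).differentiable (by simp)) x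
  have := fderiv_clm_apply hd (differentiableAt_const (x := x) (𝕜 := ℝ) (ee i))
  rw [iteratedFDeriv_two_apply]
  simp only [EuclideanSpace.basisFun_apply]
  change _ = fderiv ℝ (fun y => fderiv ℝ f y (ee i)) x (ee i)
  rw [this]; simp

/-! ### The axis is negligible -/

lemma rad_sq (x : E3) : rad x ^ 2 = x 0 ^ 2 + x 1 ^ 2 :=
  Real.sq_sqrt (by positivity)

lemma rad_nonneg (x : E3) : 0 ≤ rad x := Real.sqrt_nonneg _

lemma continuous_rad : Continuous rad := by
  unfold rad; fun_prop

lemma isOpen_offAxis : IsOpen {x : E3 | rad x ≠ 0} :=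
  isOpen_ne_fun continuous_rad continuous_const

lemma ae_rad_ne_zero : ∀ᵐ x : E3, rad x ≠ 0 := by
  have h0 : ∀ᵐ x : E3, x ∉ (LinearMap.ker
      (EuclideanSpace.proj 0 : E3 →L[ℝ] ℝ).toLinearMap : Set E3) := by
    have := Measure.addHaar_submodule (volume : Measure E3) (LinearMap.ker
      (EuclideanSpace.proj 0 : E3 →L[ℝ] ℝ).toLinearMap) (by
        intro h
        have : (ee 0 : E3) ∈ LinearMap.ker
          (EuclideanSpace.proj 0 : E3 →L[ℝ] ℝ).toLinearMap := by
          rw [h]; trivial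
        simp at this)
    exact measure_eq_zero_iff_ae_notMem.1 this
  filter_upwards [h0] with x hx hr
  apply hx
  have : x 0 ^ 2 + x 1 ^ 2 = 0 := by rw [← rad_sq, hr]; simp
  have : x 0 = 0 := by nlinarith [sq_nonneg (x 0), sq_nonneg (x 1)]
  simpa using this

lemma dense_offAxis : Dense {x : E3 | rad x ≠ 0} :=
  Measure.dense_of_ae ae_rad_ne_zero

/-- Continuous functions that agree off the axis agree everywhere. -/
lemma eq_of_eq_offAxis (hf : Continuous f) (hg : Continuous g)
    (hfg : ∀ x, rad x ≠ 0 → f x = g x) : f = g :=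
  Continuous.ext_on dense_offAxis hf hg hfg

lemma eq_of_rad_sq_mul (hf : Continuous f) (hg : Continuous g)
    (hfg : ∀ x : E3, (x 0 ^ 2 + x 1 ^ 2) * f x = (x 0 ^ 2 + x 1 ^ 2) * g x) (x : E3) :
    f x = g x := by
  refine congrFun (eq_of_eq_offAxis hf hg fun y hy => ?_) x
  refine mul_left_cancel₀ ?_ (hfg y)
  rw [← rad_sq]; positivity

/-! ### Functions all of whose derivatives are square integrable -/

/-- `f` is smooth and all its iterated partial derivatives belong to `L²(ℝ³)`; the entries of the
list `l` are the directions of differentiation. -/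
def SobInf (f : E3 → ℝ) : Prop :=
  ContDiff ℝ ∞ f ∧ ∀ l : List (Fin 3), MemLp (l.foldr pd f) 2 volume

namespace SobInf

lemma diff (hf : SobInf f) : Differentiable ℝ f := smooth_differentiable hf.1

lemma cont (hf : SobInf f) : Continuous f := hf.1.continuous

lemma memLp (hf : SobInf f) : MemLp f 2 volume := hf.2 []

lemma pd (hf : SobInf f) (i : Fin 3) : SobInf (pd i f) :=
  ⟨contDiff_pd i hf.1, fun l => by simpa using hf.2 (l ++ [i])⟩

end SobInf

lemma contDiff_foldr_pd (hf : ContDiff ℝ ∞ f) (l : List (Fin 3)) :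
    ContDiff ℝ ∞ (l.foldr pd f) := by
  induction l with
  | nil => exact hf
  | cons i l ih => exact contDiff_pd i ih

lemma foldr_pd_add (hf : ContDiff ℝ ∞ f) (hg : ContDiff ℝ ∞ g) (l : List (Fin 3)) :
    l.foldr pd (fun x => f x + g x) = fun x => l.foldr pd f x + l.foldr pd g x := by
  induction l with
  | nil => rfl
  | cons i l ih =>
    simp only [List.foldr_cons, ih]
    funext x
    exact pd_add i (smooth_differentiable (contDiff_foldr_pd hf l))
      (smooth_differentiable (contDiff_foldr_pd hg l)) x

lemma foldr_pd_const_mul (hf : ContDiff ℝ ∞ f) (c : ℝ) (l : List (Fin 3)) :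
    l.foldr pd (fun x => c * f x) = fun x => c * l.foldr pd f x := by
  induction l with
  | nil => rfl
  | cons i l ih =>
    simp only [List.foldr_cons, ih]
    funext x
    exact pd_const_mul i c (smooth_differentiable (contDiff_foldr_pd hf l)) x

lemma SobInf.add (hf : SobInf f) (hg : SobInf g) : SobInf (fun x => f x + g x) :=
  ⟨hf.1.add hg.1, fun l => by
    rw [foldr_pd_add hf.1 hg.1]; exact (hf.2 l).add (hg.2 l)⟩

lemma SobInf.const_mul (hf : SobInf f) (c : ℝ) : SobInf (fun x => c * f x) :=
  ⟨contDiff_const.mul hf.1, fun l => by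
    rw [foldr_pd_const_mul hf.1]; exact (hf.2 l).const_mul c⟩

lemma SobInf.neg (hf : SobInf f) : SobInf (fun x => - f x) := by
  simpa using hf.const_mul (-1)

lemma SobInf.sub (hf : SobInf f) (hg : SobInf g) : SobInf (fun x => f x - g x) := by
  simpa [sub_eq_add_neg] using hf.add hg.neg

/-- A smooth vector field with square integrable `iteratedFDeriv`s has components in `SobInf`. -/
lemma sobInf_of_iteratedFDeriv {F : Type*} [NormedAddCommGroup F] [NormedSpace ℝ F]
    {v : E3 → F} (hv : ContDiff ℝ ∞ v) (h2 : ∀ k : ℕ, MemLp (iteratedFDeriv ℝ k v) 2 volume)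
    (L : F →L[ℝ] ℝ) : SobInf (fun x => L (v x)) := by
  have scal : ∀ f : E3 → ℝ, ContDiff ℝ ∞ f → (∀ k : ℕ, MemLp (iteratedFDeriv ℝ k f) 2 volume) →
      SobInf f := by
    intro f hf hk
    have step : ∀ l : List (Fin 3), ∀ k : ℕ,
        MemLp (iteratedFDeriv ℝ k (l.foldr AxiNS.pd f)) 2 volume := by
      intro l
      induction l with
      | nil => exact hk
      | cons i l ih =>
        intro k
        have hs := contDiff_foldr_pd hf l
        set g := l.foldr AxiNS.pd f with hg
        have hs1 : ContDiff ℝ ∞ (fderiv ℝ g) := hs.fderiv_right (by simp)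
        refine (ih (k + 1)).of_le_mul (c := ‖ContinuousLinearMap.apply ℝ ℝ (ee i)‖)
          ((contDiff_pd i hs).continuous_iteratedFDeriv (m := k)
            (WithTop.coe_le_coe.2 le_top)).aestronglyMeasurable
          (Eventually.of_forall fun x => ?_)
        have := (ContinuousLinearMap.apply ℝ ℝ (ee i)).norm_iteratedFDeriv_comp_left
          (hs1.contDiffAt (x := x)) (N := ∞) (n := k) (WithTop.coe_le_coe.2 le_top)
        rw [norm_iteratedFDeriv_fderiv] at this
        exact this
    refine ⟨hf, fun l => ?_⟩
    have := step l 0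
    refine (memLp_congr_norm this.1 (contDiff_foldr_pd hf l).continuous.aestronglyMeasurable
      (Eventually.of_forall fun x => ?_)).1 this
    simp
  refine scal _ (L.contDiff.comp hv) fun k => ?_
  refine (h2 k).of_le_mul (c := ‖L‖)
    ((L.contDiff.comp hv).continuous_iteratedFDeriv (m := k)
      (WithTop.coe_le_coe.2 le_top)).aestronglyMeasurable (Eventually.of_forall fun x => ?_)
  exact L.norm_iteratedFDeriv_comp_left (hv.contDiffAt (x := x)) (N := ∞) (n := k)
    (WithTop.coe_le_coe.2 le_top)

end

section

/-! ### Averaging along the segments orthogonal to the axis -/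

variable {f g h : E3 → ℝ}

/-- The dilation `(x₁, x₂, x₃) ↦ (s x₁, s x₂, x₃)` towards the axis. -/
def dil (s : ℝ) : E3 →L[ℝ] E3 :=
  s • ContinuousLinearMap.id ℝ E3 +
    (1 - s) • (EuclideanSpace.proj 2 : E3 →L[ℝ] ℝ).smulRight (ee 2)

@[simp] lemma dil_apply_zero (s : ℝ) (x : E3) : dil s x 0 = s * x 0 := by simp [dil]
@[simp] lemma dil_apply_one (s : ℝ) (x : E3) : dil s x 1 = s * x 1 := by simp [dil]
@[simp] lemma dil_apply_two (s : ℝ) (x : E3) : dil s x 2 = x 2 := by simp [dil]; ring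

lemma dil_one (x : E3) : dil 1 x = x := by simp [dil]

lemma dil_single_zero (s : ℝ) : dil s (ee 0) = s • ee 0 := by
  ext i; fin_cases i <;> simp
lemma dil_single_one (s : ℝ) : dil s (ee 1) = s • ee 1 := by
  ext i; fin_cases i <;> simp
lemma dil_single_two (s : ℝ) : dil s (ee 2) = ee 2 := by
  ext i; fin_cases i <;> simp

lemma continuous_dil : Continuous dil := by
  unfold dil; fun_prop

lemma continuous_dil_apply : Continuous fun p : ℝ × E3 => dil p.1 p.2 :=
  (continuous_dil.comp continuous_fst).clm_apply continuous_snd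

lemma det_dil (s : ℝ) : LinearMap.det (dil s : E3 →ₗ[ℝ] E3) = s ^ 2 := by
  rw [← LinearMap.det_toMatrix (EuclideanSpace.basisFun (Fin 3) ℝ).toBasis, Matrix.det_fin_three]
  simp [LinearMap.toMatrix_apply, EuclideanSpace.basisFun_apply]
  ring

/-- The weighted mean `∫₀¹ f(s x₁, s x₂, x₃) sᵐ ds`. For `m = 1` and an axisymmetric `f`
it is `r⁻² ∫₀ʳ f τ dτ`, the operator which inverts `r⁻¹ ∂_r (r² ·)`. -/
def avg (m : ℕ) (f : E3 → ℝ) (x : E3) : ℝ := ∫ s in (0 : ℝ)..1, s ^ m * f (dil s x)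

lemma continuous_avg_integrand (m : ℕ) (hf : Continuous f) :
    Continuous fun p : ℝ × E3 => p.1 ^ m * f (dil p.1 p.2) :=
  (continuous_fst.pow m).mul (hf.comp continuous_dil_apply)

lemma continuous_avg_integrand_left (m : ℕ) (hf : Continuous f) (x : E3) :
    Continuous fun s : ℝ => s ^ m * f (dil s x) :=
  (continuous_avg_integrand m hf).comp (Continuous.prodMk continuous_id continuous_const)

lemma intervalIntegrable_avg (m : ℕ) (hf : Continuous f) (x : E3) :
    IntervalIntegrable (fun s => s ^ m * f (dil s x)) volume 0 1 :=
  (continuous_avg_integrand_left m hf x).intervalIntegrable _ _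

lemma avg_const_mul (m : ℕ) (c : ℝ) (f : E3 → ℝ) (x : E3) :
    avg m (fun y => c * f y) x = c * avg m f x := by
  unfold avg
  rw [← intervalIntegral.integral_const_mul]
  congr 1; funext s; ring

lemma avg_sub (m : ℕ) (hf : Continuous f) (hg : Continuous g) (x : E3) :
    avg m (fun y => f y - g y) x = avg m f x - avg m g x := by
  unfold avg
  rw [← intervalIntegral.integral_sub (intervalIntegrable_avg m hf x)
    (intervalIntegrable_avg m hg x)]
  congr 1; funext s; ring

lemma abs_avg_le (m : ℕ) {B : ℝ} (hB : ∀ x, |f x| ≤ B) (x : E3) : |avg m f x| ≤ B := by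
  have := intervalIntegral.norm_integral_le_of_norm_le_const (a := (0 : ℝ)) (b := 1) (C := B)
    (f := fun s => s ^ m * f (dil s x)) (fun s hs => by
      rw [uIoc_of_le zero_le_one] at hs
      rw [norm_mul, norm_pow, Real.norm_eq_abs, Real.norm_eq_abs, abs_of_pos hs.1]
      have h1 : s ^ m ≤ 1 := pow_le_one₀ hs.1.le hs.2
      have h2 := hB (dil s x)
      have h3 : 0 ≤ s ^ m := pow_nonneg hs.1.le m
      nlinarith [abs_nonneg (f (dil s x))])
  simpa [avg] using this

lemma hasFDerivAt_avg (m : ℕ) (hf : ContDiff ℝ ∞ f) (x : E3) :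
    HasFDerivAt (avg m f)
      (∫ s in (0 : ℝ)..1, s ^ m • (fderiv ℝ f (dil s x)).comp (dil s)) x := by
  have hf' : Continuous (fderiv ℝ f) := hf.continuous_fderiv (by simp)
  have hF' : Continuous fun p : ℝ × E3 =>
      p.1 ^ m • (fderiv ℝ f (dil p.1 p.2)).comp (dil p.1) :=
    (continuous_fst.pow m).smul
      ((hf'.comp continuous_dil_apply).clm_comp (continuous_dil.comp continuous_fst))
  obtain ⟨B, hB⟩ := ((isCompact_Icc (a := (0 : ℝ)) (b := 1)).prod
    (isCompact_closedBall x 1)).exists_bound_of_continuousOn hF'.continuousOn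
  refine (intervalIntegral.hasFDerivAt_integral_of_dominated_of_fderiv_le
    (F := fun y s => s ^ m * f (dil s y))
    (F' := fun y s => s ^ m • (fderiv ℝ f (dil s y)).comp (dil s)) (bound := fun _ => B)
    (Metric.closedBall_mem_nhds x one_pos) ?_ (intervalIntegrable_avg m hf.continuous x) ?_ ?_
    (by simp) ?_)
  · exact Eventually.of_forall fun y =>
      (continuous_avg_integrand_left m hf.continuous y).aestronglyMeasurable
  · exact (hF'.comp (Continuous.prodMk continuous_id continuous_const)).aestronglyMeasurable
  · refine Eventually.of_forall fun s hs y hy => hB (s, y) ⟨?_, hy⟩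
    rw [uIoc_of_le zero_le_one] at hs
    exact ⟨hs.1.le, hs.2⟩
  · refine Eventually.of_forall fun s _ y _ => ?_
    have h1 := ((smooth_differentiable hf) (dil s y)).hasFDerivAt.comp y (dil s).hasFDerivAt
    exact h1.const_mul (s ^ m)

/-- The exponent of the weight after differentiating `avg` in direction `i`. -/
def avgExp (i : Fin 3) (m : ℕ) : ℕ := if i = 2 then m else m + 1

lemma pd_avg (i : Fin 3) (m : ℕ) (hf : ContDiff ℝ ∞ f) (x : E3) :
    pd i (avg m f) x = avg (avgExp i m) (pd i f) x := by
  have hf' : Continuous (fderiv ℝ f) := hf.continuous_fderiv (by simp)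
  rw [pd, (hasFDerivAt_avg m hf x).fderiv]
  have hF' : Continuous fun s : ℝ => s ^ m • (fderiv ℝ f (dil s x)).comp (dil s) :=
    (continuous_id.pow m).smul ((hf'.comp (continuous_dil_apply.comp
      (Continuous.prodMk continuous_id continuous_const))).clm_comp continuous_dil)
  rw [ContinuousLinearMap.intervalIntegral_apply (hF'.intervalIntegrable _ _)]
  unfold avg
  congr 1; funext s
  fin_cases i
  · simp [pd, dil_single_zero, avgExp]; ring
  · simp [pd, dil_single_one, avgExp]; ring
  · simp [pd, dil_single_two, avgExp]

lemma pd_zero_avg (m : ℕ) (hf : ContDiff ℝ ∞ f) (x : E3) :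
    pd 0 (avg m f) x = avg (m + 1) (pd 0 f) x := pd_avg 0 m hf x

lemma pd_one_avg (m : ℕ) (hf : ContDiff ℝ ∞ f) (x : E3) :
    pd 1 (avg m f) x = avg (m + 1) (pd 1 f) x := pd_avg 1 m hf x

lemma pd_two_avg (m : ℕ) (hf : ContDiff ℝ ∞ f) (x : E3) :
    pd 2 (avg m f) x = avg m (pd 2 f) x := pd_avg 2 m hf x

lemma contDiff_avg (m : ℕ) (hf : ContDiff ℝ ∞ f) : ContDiff ℝ ∞ (avg m f) := by
  refine contDiff_infty.2 fun n => ?_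
  induction n generalizing m f with
  | zero =>
    exact contDiff_zero.2 (continuous_iff_continuousAt.2 fun x =>
      (hasFDerivAt_avg m hf x).continuousAt)
  | succ n ih =>
    have hd : Differentiable ℝ (avg m f) := fun x => (hasFDerivAt_avg m hf x).differentiableAt
    push_cast
    refine contDiff_succ_iff_fderiv.2 ⟨hd, by simp, ?_⟩
    have : fderiv ℝ (avg m f) = fun x =>
        ∑ i, avg (avgExp i m) (pd i f) x • (EuclideanSpace.proj i : E3 →L[ℝ] ℝ) := by
      funext x
      ext v
      rw [fderiv_eq_sum_pd]
      simp [pd_avg _ _ hf, mul_comm]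
    rw [this]
    exact ContDiff.sum fun i _ => (ih _ (contDiff_pd i hf)).smul contDiff_const

/-! ### Square integrability of averages -/

/-- The Cauchy–Schwarz inequality against the constant function `1`. -/
lemma sq_lintegral_le {S : Type*} [MeasurableSpace S] (ν : Measure S) {G : S → ENNReal}
    (hG : AEMeasurable G ν) : (∫⁻ s, G s ∂ν) ^ 2 ≤ ν univ * ∫⁻ s, G s ^ 2 ∂ν := by
  have := ENNReal.lintegral_mul_le_Lp_mul_Lq ν Real.HolderConjugate.two_two hG
    (aemeasurable_const (b := (1 : ENNReal)))
  simp only [Pi.mul_apply, mul_one, ENNReal.one_rpow, lintegral_const, one_mul] at this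
  calc (∫⁻ s, G s ∂ν) ^ 2 ≤ ((∫⁻ s, G s ^ (2 : ℝ) ∂ν) ^ (1 / 2 : ℝ) * ν univ ^ (1 / 2 : ℝ)) ^ 2 :=
        pow_le_pow_left' this 2
    _ = ν univ * ∫⁻ s, G s ^ 2 ∂ν := by
        rw [mul_pow, ← ENNReal.rpow_natCast, ← ENNReal.rpow_mul, ← ENNReal.rpow_natCast,
          ← ENNReal.rpow_mul, mul_comm]
        norm_num

/-- A mean of functions is bounded in `L²` by the mean square of their `L²` norms. -/
lemma lintegral_sq_integral_le {S X : Type*} [MeasurableSpace S] [MeasurableSpace X]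
    (ν : Measure S) (μ : Measure X) [SFinite ν] [SFinite μ] {G : S → X → ℝ}
    (hG : AEMeasurable (Function.uncurry G) (ν.prod μ))
    (hG1 : ∀ x, AEMeasurable (fun s => G s x) ν) :
    ∫⁻ x, ‖∫ s, G s x ∂ν‖ₑ ^ 2 ∂μ ≤ ν univ * ∫⁻ s, ∫⁻ x, ‖G s x‖ₑ ^ 2 ∂μ ∂ν := by
  have h2 : AEMeasurable (fun p : S × X => ‖G p.1 p.2‖ₑ ^ 2) (ν.prod μ) :=
    (hG.enorm).pow_const 2
  calc ∫⁻ x, ‖∫ s, G s x ∂ν‖ₑ ^ 2 ∂μ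
      ≤ ∫⁻ x, ν univ * ∫⁻ s, ‖G s x‖ₑ ^ 2 ∂ν ∂μ := by
        refine lintegral_mono fun x => ?_
        refine (pow_le_pow_left' (enorm_integral_le_lintegral_enorm _) 2).trans ?_
        exact sq_lintegral_le ν (hG1 x).enorm
    _ = ν univ * ∫⁻ x, ∫⁻ s, ‖G s x‖ₑ ^ 2 ∂ν ∂μ := by
        refine lintegral_const_mul'' _ ?_
        exact h2.prod_swap.lintegral_prod_right'
    _ = ν univ * ∫⁻ s, ∫⁻ x, ‖G s x‖ₑ ^ 2 ∂μ ∂ν := by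
        rw [lintegral_lintegral_swap]; exact h2.prod_swap

lemma lintegral_comp_dil {s : ℝ} (hs : 0 < s) {G : E3 → ENNReal} (hG : Measurable G) :
    ∫⁻ x, G (dil s x) = ENNReal.ofReal ((s ^ 2)⁻¹) * ∫⁻ x, G x := by
  have hdet : LinearMap.det (dil s : E3 →ₗ[ℝ] E3) ≠ 0 := by rw [det_dil]; positivity
  have := Measure.map_linearMap_addHaar_eq_smul_addHaar (volume : Measure E3) hdet
  rw [det_dil, abs_of_pos (by positivity)] at this
  calc ∫⁻ x, G (dil s x) = ∫⁻ x, G x ∂(Measure.map (dil s : E3 →ₗ[ℝ] E3) volume) :=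
        (lintegral_map hG (dil s).continuous.measurable).symm
    _ = _ := by rw [this, lintegral_smul_measure, smul_eq_mul]

lemma eLpNorm_two_sq {X F : Type*} [MeasurableSpace X] [NormedAddCommGroup F] (μ : Measure X)
    (f : X → F) : eLpNorm f 2 μ ^ 2 = ∫⁻ x, ‖f x‖ₑ ^ 2 ∂μ := by
  have := eLpNorm_nnreal_pow_eq_lintegral (f := f) (μ := μ) (p := 2) (by norm_num)
  have h2 : ∀ a : ENNReal, a ^ (((2 : NNReal) : ℝ)) = a ^ 2 := fun a => by
    rw [← ENNReal.rpow_natCast]; norm_num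
  simp only [h2] at this
  exact this

/-- The averages are contractions of `L²(ℝ³)`: the dilation by `s` costs a factor `s⁻¹`, which is
absorbed by the weight `sᵐ`, `m ≥ 1`. -/
lemma eLpNorm_avg_le {m : ℕ} (hm : 1 ≤ m) (hf : Continuous f) :
    eLpNorm (avg m f) 2 volume ≤ eLpNorm f 2 volume := by
  rw [← ENNReal.pow_le_pow_left_iff two_ne_zero, eLpNorm_two_sq, eLpNorm_two_sq]
  have h := lintegral_sq_integral_le (volume.restrict (Ioc (0 : ℝ) 1)) (volume : Measure E3)
    (G := fun s x => s ^ m * f (dil s x)) (continuous_avg_integrand m hf).measurable.aemeasurable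
    (fun x => (continuous_avg_integrand_left m hf x).measurable.aemeasurable)
  simp only [Measure.restrict_apply_univ, Real.volume_Ioc, sub_zero, ENNReal.ofReal_one,
    one_mul] at h
  have e : ∀ x, avg m f x = ∫ s in Ioc (0 : ℝ) 1, s ^ m * f (dil s x) := fun x =>
    intervalIntegral.integral_of_le zero_le_one
  simp only [e]
  refine h.trans ?_
  calc ∫⁻ s in Ioc (0 : ℝ) 1, ∫⁻ x, ‖s ^ m * f (dil s x)‖ₑ ^ 2
      ≤ ∫⁻ _ in Ioc (0 : ℝ) 1, ∫⁻ x, ‖f x‖ₑ ^ 2 := by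
        refine setLIntegral_mono' measurableSet_Ioc fun s hs => ?_
        have hm1 : Measurable fun x => ‖f x‖ₑ ^ 2 := (hf.measurable.enorm).pow_const 2
        have : ∀ x, ‖s ^ m * f (dil s x)‖ₑ ^ 2
            = ENNReal.ofReal ((s ^ m) ^ 2) * ‖f (dil s x)‖ₑ ^ 2 := fun x => by
          rw [enorm_mul, mul_pow, Real.enorm_eq_ofReal (pow_nonneg hs.1.le m),
            ENNReal.ofReal_pow (pow_nonneg hs.1.le m)]
        simp only [this]
        rw [lintegral_const_mul (f := fun x => ‖f (dil s x)‖ₑ ^ 2) _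
            (hm1.comp (dil s).continuous.measurable),
          lintegral_comp_dil hs.1 hm1, ← mul_assoc, ← ENNReal.ofReal_mul (by positivity)]
        refine mul_le_of_le_one_left' ?_
        rw [ENNReal.ofReal_le_one, ← div_eq_mul_inv, div_le_one (by have := hs.1; positivity)]
        refine pow_le_pow_left₀ (pow_nonneg hs.1.le m) ?_ 2
        exact pow_le_of_le_one hs.1.le hs.2 (by omega)
    _ = ∫⁻ x, ‖f x‖ₑ ^ 2 := by simp

lemma SobInf.avg (hf : SobInf f) {m : ℕ} (hm : 1 ≤ m) : SobInf (avg m f) := by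
  refine ⟨contDiff_avg m hf.1, fun l => ?_⟩
  have : ∃ k ≥ 1, l.foldr AxiNS.pd (AxiNS.avg m f) = AxiNS.avg k (l.foldr AxiNS.pd f) := by
    induction l with
    | nil => exact ⟨m, hm, rfl⟩
    | cons i l ih =>
      obtain ⟨k, hk, e⟩ := ih
      refine ⟨avgExp i k, by unfold avgExp; split <;> omega, ?_⟩
      simp only [List.foldr_cons, e]
      exact funext fun x => pd_avg i k (contDiff_foldr_pd hf.1 l) x
  obtain ⟨k, hk, e⟩ := this
  rw [e]
  have hc := contDiff_foldr_pd hf.1 l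
  exact ⟨(contDiff_avg k hc).continuous.aestronglyMeasurable,
    (eLpNorm_avg_le hk hc.continuous).trans_lt (hf.2 l).2⟩

end

section

variable {f g h : E3 → ℝ}

/-! ### Infinitesimal axisymmetry -/

/-- Infinitesimal form of axisymmetry: the angular derivative `x₁ ∂₂ f - x₂ ∂₁ f` vanishes. -/
def Axi (f : E3 → ℝ) : Prop := ∀ x : E3, x 0 * pd 1 f x = x 1 * pd 0 f x

/-- Infinitesimal form of axisymmetry for the horizontal part `(f, g)` of a vector field: the
angular derivative of `(f, g)` is `(-g, f)`. -/
def RotPair (f g : E3 → ℝ) : Prop :=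
  ∀ x : E3, x 0 * pd 1 f x - x 1 * pd 0 f x = - g x ∧ x 0 * pd 1 g x - x 1 * pd 0 g x = f x

lemma smooth_diff_coord (i : Fin 3) : Differentiable ℝ (fun x : E3 => x i) :=
  smooth_differentiable (contDiff_coord i)

lemma pd_coord_mul (i j : Fin 3) (hf : Differentiable ℝ f) (x : E3) :
    pd i (fun y => y j * f y) x = (if i = j then 1 else 0) * f x + x j * pd i f x := by
  rw [pd_mul i (smooth_diff_coord j) hf, pd_coord]

lemma Axi.const_mul (hf : Axi f) (hd : Differentiable ℝ f) (c : ℝ) : Axi (fun x => c * f x) := by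
  intro x
  rw [pd_const_mul _ _ hd, pd_const_mul _ _ hd]
  linear_combination c * hf x

lemma Axi.add (hf : Axi f) (hg : Axi g) (hdf : Differentiable ℝ f) (hdg : Differentiable ℝ g) :
    Axi (fun x => f x + g x) := by
  intro x
  rw [pd_add _ hdf hdg, pd_add _ hdf hdg]
  linear_combination hf x + hg x

lemma Axi.sub (hf : Axi f) (hg : Axi g) (hdf : Differentiable ℝ f) (hdg : Differentiable ℝ g) :
    Axi (fun x => f x - g x) := by
  intro x
  rw [pd_sub _ hdf hdg, pd_sub _ hdf hdg]
  linear_combination hf x - hg x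

lemma Axi.mul (hf : Axi f) (hg : Axi g) (hdf : Differentiable ℝ f) (hdg : Differentiable ℝ g) :
    Axi (fun x => f x * g x) := by
  intro x
  rw [pd_mul _ hdf hdg, pd_mul _ hdf hdg]
  linear_combination g x * hf x + f x * hg x

/-- The angular derivative of a partial derivative, for a function with known angular
derivative. -/
lemma pd_of_angular (hf : ContDiff ℝ ∞ f)
    (hfg : ∀ x : E3, x 0 * pd 1 f x - x 1 * pd 0 f x = g x) (i : Fin 3) (x : E3) :
    x 0 * pd 1 (pd i f) x - x 1 * pd 0 (pd i f) x
      = pd i g x - (if i = 0 then 1 else 0) * pd 1 f x + (if i = 1 then 1 else 0) * pd 0 f x := by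
  have e : g = fun x : E3 => x 0 * pd 1 f x - x 1 * pd 0 f x := funext fun x => (hfg x).symm
  have h1 := smooth_differentiable (contDiff_pd 1 hf)
  have h0 := smooth_differentiable (contDiff_pd 0 hf)
  rw [e, pd_sub i ((smooth_diff_coord 0).fun_mul h1) ((smooth_diff_coord 1).fun_mul h0),
    pd_coord_mul _ _ h1, pd_coord_mul _ _ h0, pd_comm i 1 hf, pd_comm i 0 hf]
  ring

lemma Axi.pd_two (hf : Axi f) (hs : ContDiff ℝ ∞ f) : Axi (pd 2 f) := by
  intro x
  have := pd_of_angular hs (g := fun _ => 0)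
    (fun x => by linear_combination hf x) 2 x
  rw [pd_const] at this
  simp at this
  linear_combination this

lemma Axi.rotPair_pd (hf : Axi f) (hs : ContDiff ℝ ∞ f) : RotPair (pd 0 f) (pd 1 f) := by
  intro x
  have h := pd_of_angular hs (g := fun _ => 0)
    (fun x => by linear_combination hf x)
  have h0 := h 0 x
  have h1 := h 1 x
  rw [pd_const] at h0 h1
  simp at h0 h1
  exact ⟨h0, h1⟩

lemma Axi.avg (hf : Axi f) (hs : ContDiff ℝ ∞ f) (m : ℕ) : Axi (avg m f) := by
  intro x
  rw [pd_zero_avg m hs, pd_one_avg m hs]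
  unfold AxiNS.avg
  rw [← intervalIntegral.integral_const_mul, ← intervalIntegral.integral_const_mul]
  congr 1; funext s
  have := hf (dil s x)
  simp only [dil_apply_zero, dil_apply_one] at this
  linear_combination s ^ m * this

lemma hasDerivAt_comp_dil (hf : ContDiff ℝ ∞ f) (x : E3) (s : ℝ) :
    HasDerivAt (fun s : ℝ => f (dil s x))
      (x 0 * pd 0 f (dil s x) + x 1 * pd 1 f (dil s x)) s := by
  have hdil : HasDerivAt (fun s : ℝ => dil s x) (x - (x 2) • ee 2) s := by
    have h1 : HasDerivAt (fun s : ℝ => s • x) x s := by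
      simpa using (hasDerivAt_id s).smul_const x
    have h2 : HasDerivAt (fun s : ℝ => (1 - s) • ((x 2) • ee 2)) (-((x 2) • ee 2)) s := by
      simpa using ((hasDerivAt_id s).const_sub 1).smul_const ((x 2) • ee 2)
    have := h1.add h2
    rw [← sub_eq_add_neg] at this
    refine this.congr_of_eventuallyEq (Eventually.of_forall fun t => ?_)
    simp [dil]
  have := ((smooth_differentiable hf) (dil s x)).hasFDerivAt.comp_hasDerivAt s hdil
  rw [fderiv_eq_sum_pd, Fin.sum_univ_three] at this
  simpa [Function.comp_def] using this

namespace RotPair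

lemma rotate (hfg : RotPair f g) : RotPair g (fun x => - f x) := by
  intro x
  refine ⟨by linear_combination (hfg x).2, ?_⟩
  rw [pd_neg, pd_neg]
  linear_combination -(hfg x).1

lemma axi_div (hfg : RotPair f g) (hf : ContDiff ℝ ∞ f) (hg : ContDiff ℝ ∞ g) :
    Axi (fun x => pd 0 f x + pd 1 g x) := by
  intro x
  have h0 := smooth_differentiable (contDiff_pd 0 hf)
  have h1 := smooth_differentiable (contDiff_pd 1 hg)
  rw [pd_add _ h0 h1, pd_add _ h0 h1]
  have a := pd_of_angular hf (g := fun x => - g x) (fun x => (hfg x).1) 0 x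
  have b := pd_of_angular hg (fun x => (hfg x).2) 1 x
  rw [pd_neg] at a
  simp at a b
  linear_combination a + b

/-- The radial part of an axisymmetric horizontal field is the primitive of its divergence. -/
lemma radial (hfg : RotPair f g) (hf : ContDiff ℝ ∞ f) (hg : ContDiff ℝ ∞ g) (x : E3) :
    x 0 * f x + x 1 * g x
      = (x 0 ^ 2 + x 1 ^ 2) * AxiNS.avg 1 (fun y => pd 0 f y + pd 1 g y) x := by
  have hc : Continuous fun y => pd 0 f y + pd 1 g y :=
    (contDiff_pd 0 hf).continuous.add (contDiff_pd 1 hg).continuous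
  have hder : ∀ s : ℝ, HasDerivAt (fun s => s * (x 0 * f (dil s x) + x 1 * g (dil s x)))
      ((x 0 ^ 2 + x 1 ^ 2) * (s ^ 1 * (pd 0 f (dil s x) + pd 1 g (dil s x)))) s := by
    intro s
    have := (hasDerivAt_id s).mul 
      (((hasDerivAt_comp_dil hf x s).const_mul (x 0)).add
        ((hasDerivAt_comp_dil hg x s).const_mul (x 1)))
    refine this.congr_deriv ?_
    have e := hfg (dil s x)
    simp only [dil_apply_zero, dil_apply_one] at e
    simp only [id, Pi.add_apply]
    linear_combination x 1 * e.1 - x 0 * e.2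
  have := intervalIntegral.integral_eq_sub_of_hasDerivAt (a := 0) (b := 1) (fun s _ => hder s)
    (((continuous_avg_integrand_left 1 hc x).const_mul _).intervalIntegrable _ _)
  rw [intervalIntegral.integral_const_mul] at this
  simp only [dil_one] at this
  unfold AxiNS.avg
  linarith

/-- `(f, g) = b (x₁, x₂) + c (-x₂, x₁)` with smooth `b` and `c`. -/
lemma decomp (hfg : RotPair f g) (hf : ContDiff ℝ ∞ f) (hg : ContDiff ℝ ∞ g) (x : E3) :
    f x = x 0 * AxiNS.avg 1 (fun y => pd 0 f y + pd 1 g y) x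
        - x 1 * AxiNS.avg 1 (fun y => pd 0 g y - pd 1 f y) x ∧
    g x = x 1 * AxiNS.avg 1 (fun y => pd 0 f y + pd 1 g y) x
        + x 0 * AxiNS.avg 1 (fun y => pd 0 g y - pd 1 f y) x := by
  have hb := contDiff_avg 1 ((contDiff_pd 0 hf).add (contDiff_pd 1 hg))
  have hc := contDiff_avg 1 ((contDiff_pd 0 hg).sub (contDiff_pd 1 hf))
  have c0 := contDiff_coord 0
  have c1 := contDiff_coord 1
  have ang : ∀ x : E3, x 0 * g x - x 1 * f x
      = (x 0 ^ 2 + x 1 ^ 2) * AxiNS.avg 1 (fun y => pd 0 g y - pd 1 f y) x := by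
    intro x
    have := hfg.rotate.radial hg hf.neg x
    simp only [pd_neg, ← sub_eq_add_neg] at this
    rw [← this]; ring
  have rd := hfg.radial hf hg
  constructor
  · refine eq_of_rad_sq_mul hf.continuous ((c0.mul hb).sub (c1.mul hc)).continuous
      (fun y => ?_) x
    linear_combination y 0 * rd y - y 1 * ang y
  · refine eq_of_rad_sq_mul hg.continuous ((c1.mul hb).add (c0.mul hc)).continuous
      (fun y => ?_) x
    linear_combination y 1 * rd y + y 0 * ang y

end RotPair

/-- The smooth extension of `r⁻¹ ∂_r f` for a smooth axisymmetric function `f`. -/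
def kap (f : E3 → ℝ) : E3 → ℝ := avg 1 fun x => pd 0 (pd 0 f) x + pd 1 (pd 1 f) x

lemma contDiff_kap (hf : ContDiff ℝ ∞ f) : ContDiff ℝ ∞ (kap f) :=
  contDiff_avg 1 ((contDiff_pd 0 (contDiff_pd 0 hf)).add (contDiff_pd 1 (contDiff_pd 1 hf)))

lemma SobInf.kap (hf : SobInf f) : SobInf (kap f) :=
  (((hf.pd 0).pd 0).add ((hf.pd 1).pd 1)).avg le_rfl

lemma pd_eq_mul_kap (ha : Axi f) (hf : ContDiff ℝ ∞ f) (x : E3) :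
    pd 0 f x = x 0 * kap f x ∧ pd 1 f x = x 1 * kap f x := by
  have h := (ha.rotPair_pd hf).decomp (contDiff_pd 0 hf) (contDiff_pd 1 hf) x
  have e : (fun y => pd 0 (pd 1 f) y - pd 1 (pd 0 f) y) = fun _ => 0 :=
    funext fun y => by rw [pd_comm 0 1 hf, sub_self]
  have z : avg 1 (fun _ => (0 : ℝ)) x = 0 := by simp [avg]
  rw [e, z] at h
  exact ⟨by simpa [kap] using h.1, by simpa [kap] using h.2⟩

lemma pd_zero_eq (ha : Axi f) (hf : ContDiff ℝ ∞ f) (x : E3) : pd 0 f x = x 0 * kap f x :=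
  (pd_eq_mul_kap ha hf x).1

lemma pd_one_eq (ha : Axi f) (hf : ContDiff ℝ ∞ f) (x : E3) : pd 1 f x = x 1 * kap f x :=
  (pd_eq_mul_kap ha hf x).2

/-- `kap f` is the only continuous `k` with `∂ᵢ f = xᵢ k` for the two horizontal directions. -/
lemma kap_unique (ha : Axi f) (hf : ContDiff ℝ ∞ f) {k : E3 → ℝ} (hk : Continuous k)
    (h0 : ∀ x, pd 0 f x = x 0 * k x) (h1 : ∀ x, pd 1 f x = x 1 * k x) (x : E3) :
    kap f x = k x := by
  refine eq_of_rad_sq_mul (contDiff_kap hf).continuous hk (fun y => ?_) x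
  linear_combination y 0 * (h0 y) + y 1 * h1 y - y 0 * pd_zero_eq ha hf y
    - y 1 * pd_one_eq ha hf y

lemma Axi.kap (ha : Axi f) (hf : ContDiff ℝ ∞ f) : Axi (kap f) :=
  ((ha.rotPair_pd hf).axi_div (contDiff_pd 0 hf) (contDiff_pd 1 hf)).avg
    ((contDiff_pd 0 (contDiff_pd 0 hf)).add (contDiff_pd 1 (contDiff_pd 1 hf))) 1

lemma kap_pd_two (ha : Axi f) (hf : ContDiff ℝ ∞ f) (x : E3) :
    kap (pd 2 f) x = pd 2 (kap f) x := by
  have hk := contDiff_kap hf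
  refine kap_unique (ha.pd_two hf) (contDiff_pd 2 hf) (contDiff_pd 2 hk).continuous
    (fun y => ?_) (fun y => ?_) x
  · rw [pd_comm 0 2 hf, funext (pd_zero_eq ha hf), pd_coord_mul _ _ (smooth_differentiable hk)]
    simp
  · rw [pd_comm 1 2 hf, funext (pd_one_eq ha hf), pd_coord_mul _ _ (smooth_differentiable hk)]
    simp

lemma kap_mul (haf : Axi f) (hag : Axi g) (hf : ContDiff ℝ ∞ f) (hg : ContDiff ℝ ∞ g) (x : E3) :
    kap (fun y => f y * g y) x = kap f x * g x + f x * kap g x := by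
  have df := smooth_differentiable hf
  have dg := smooth_differentiable hg
  refine kap_unique (haf.mul hag df dg) (hf.mul hg)
    (k := fun x => kap f x * g x + f x * kap g x)
    (((contDiff_kap hf).mul hg).add (hf.mul (contDiff_kap hg))).continuous
    (fun y => ?_) (fun y => ?_) x
  · rw [pd_mul _ df dg, pd_zero_eq haf hf, pd_zero_eq hag hg]; ring
  · rw [pd_mul _ df dg, pd_one_eq haf hf, pd_one_eq hag hg]; ring

lemma kap_add (haf : Axi f) (hag : Axi g) (hf : ContDiff ℝ ∞ f) (hg : ContDiff ℝ ∞ g) (x : E3) :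
    kap (fun y => f y + g y) x = kap f x + kap g x := by
  have df := smooth_differentiable hf
  have dg := smooth_differentiable hg
  refine kap_unique (haf.add hag df dg) (hf.add hg) (k := fun x => kap f x + kap g x)
    ((contDiff_kap hf).add (contDiff_kap hg)).continuous (fun y => ?_) (fun y => ?_) x
  · rw [pd_add _ df dg, pd_zero_eq haf hf, pd_zero_eq hag hg]; ring
  · rw [pd_add _ df dg, pd_one_eq haf hf, pd_one_eq hag hg]; ring

lemma kap_const_mul (c : ℝ) (haf : Axi f) (hf : ContDiff ℝ ∞ f) (x : E3) :
    kap (fun y => c * f y) x = c * kap f x := by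
  have df := smooth_differentiable hf
  refine kap_unique (haf.const_mul df c) (contDiff_const.mul hf) (k := fun x => c * kap f x)
    (contDiff_const.mul (contDiff_kap hf)).continuous (fun y => ?_) (fun y => ?_) x
  · rw [pd_const_mul _ _ df, pd_zero_eq haf hf]; ring
  · rw [pd_const_mul _ _ df, pd_one_eq haf hf]; ring

lemma kap_sub (haf : Axi f) (hag : Axi g) (hf : ContDiff ℝ ∞ f) (hg : ContDiff ℝ ∞ g) (x : E3) :
    kap (fun y => f y - g y) x = kap f x - kap g x := by
  have df := smooth_differentiable hf
  have dg := smooth_differentiable hg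
  refine kap_unique (haf.sub hag df dg) (hf.sub hg) (k := fun x => kap f x - kap g x)
    ((contDiff_kap hf).sub (contDiff_kap hg)).continuous (fun y => ?_) (fun y => ?_) x
  · rw [pd_sub _ df dg, pd_zero_eq haf hf, pd_zero_eq hag hg]; ring
  · rw [pd_sub _ df dg, pd_one_eq haf hf, pd_one_eq hag hg]; ring

/-- Taylor expansion at the axis. -/
lemma eq_axis_add (ha : Axi f) (hf : ContDiff ℝ ∞ f) (x : E3) :
    f x = f (dil 0 x) + (x 0 ^ 2 + x 1 ^ 2) * avg 1 (kap f) x := by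
  have hk := (contDiff_kap hf).continuous
  have hder : ∀ s : ℝ, HasDerivAt (fun s => f (dil s x))
      ((x 0 ^ 2 + x 1 ^ 2) * (s ^ 1 * kap f (dil s x))) s := fun s => by
    refine (hasDerivAt_comp_dil hf x s).congr_deriv ?_
    rw [pd_zero_eq ha hf, pd_one_eq ha hf]
    simp only [dil_apply_zero, dil_apply_one]; ring
  have := intervalIntegral.integral_eq_sub_of_hasDerivAt (a := 0) (b := 1) (fun s _ => hder s)
    (((continuous_avg_integrand_left 1 hk x).const_mul _).intervalIntegrable _ _)
  rw [intervalIntegral.integral_const_mul] at this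
  simp only [dil_one] at this
  unfold avg
  linarith

/-- The horizontal Laplacian `∂_r² + r⁻¹ ∂_r` of an axisymmetric function. -/
lemma horizontal_laplacian_eq (ha : Axi f) (hf : ContDiff ℝ ∞ f) (x : E3) :
    pd 0 (pd 0 f) x + pd 1 (pd 1 f) x
      = 2 * kap f x + (x 0 ^ 2 + x 1 ^ 2) * kap (kap f) x := by
  have hk := contDiff_kap hf
  have dk := smooth_differentiable hk
  rw [funext (pd_zero_eq ha hf), funext (pd_one_eq ha hf), pd_coord_mul _ _ dk,
    pd_coord_mul _ _ dk, pd_zero_eq (ha.kap hf) hk, pd_one_eq (ha.kap hf) hk]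
  simp; ring

/-! ### Integration by parts -/

lemma integral_mul_pd (i : Fin 3) (hf : Differentiable ℝ f) (hg : Differentiable ℝ g)
    (h1 : Integrable fun x => pd i f x * g x) (h2 : Integrable fun x => f x * pd i g x)
    (h3 : Integrable fun x => f x * g x) :
    ∫ x, f x * pd i g x = - ∫ x, pd i f x * g x :=
  integral_mul_fderiv_eq_neg_fderiv_mul_of_integrable h1 h2 h3 (fun x _ => hf x) (fun x _ => hg x)

lemma SobInf.integrable_mul (hf : SobInf f) (hg : SobInf g) : Integrable fun x => f x * g x :=
  hf.memLp.integrable_mul hg.memLp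

lemma SobInf.integral_mul_pd (hf : SobInf f) (hg : SobInf g) (i : Fin 3) :
    ∫ x, f x * AxiNS.pd i g x = - ∫ x, AxiNS.pd i f x * g x :=
  AxiNS.integral_mul_pd i hf.diff hg.diff ((hf.pd i).integrable_mul hg)
    (hf.integrable_mul (hg.pd i)) (hf.integrable_mul hg)

end

section

variable {f g h : E3 → ℝ}

/-! ### Divergence theorem with weights that are singular on the axis -/

lemma pd_comp {φ : ℝ → ℝ} {φ' : ℝ} (i : Fin 3) (hf : Differentiable ℝ f) (x : E3)
    (hφ : HasDerivAt φ φ' (f x)) : pd i (fun y => φ (f y)) x = φ' * pd i f x := by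
  have := hφ.comp_hasFDerivAt x (hf x).hasFDerivAt
  rw [pd, show (fun y => φ (f y)) = φ ∘ f from rfl, this.fderiv]
  simp [pd]

lemma pd_sq (i j : Fin 3) (x : E3) :
    pd i (fun y : E3 => y j ^ 2) x = if i = j then 2 * x j else 0 := by
  have := pd_comp (φ := fun t => t ^ 2) i (smooth_diff_coord j) x
    (by simpa using hasDerivAt_pow 2 (x j))
  rw [this, pd_coord]; split <;> simp

lemma smooth_radSq : ContDiff ℝ ∞ (fun x : E3 => x 0 ^ 2 + x 1 ^ 2) :=
  ((contDiff_coord 0).pow 2).add ((contDiff_coord 1).pow 2)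

lemma pd_radSq (i : Fin 3) (x : E3) :
    pd i (fun y : E3 => y 0 ^ 2 + y 1 ^ 2) x = if i = 2 then 0 else 2 * x i := by
  rw [pd_add _ ((smooth_diff_coord 0).fun_pow 2) ((smooth_diff_coord 1).fun_pow 2), pd_sq, pd_sq]
  fin_cases i <;> simp

/-- The regularised weight `(r² + ε)^(-p)`. -/
def wgt (ε p : ℝ) (x : E3) : ℝ := (x 0 ^ 2 + x 1 ^ 2 + ε) ^ (-p)

lemma radSq_add_pos {ε : ℝ} (hε : 0 < ε) (x : E3) : 0 < x 0 ^ 2 + x 1 ^ 2 + ε := by positivity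

lemma wgt_nonneg {ε : ℝ} (hε : 0 < ε) (p : ℝ) (x : E3) : 0 ≤ wgt ε p x :=
  Real.rpow_nonneg (radSq_add_pos hε x).le _

lemma smooth_wgt {ε : ℝ} (hε : 0 < ε) (p : ℝ) : ContDiff ℝ ∞ (wgt ε p) := by
  unfold wgt
  exact (smooth_radSq.add contDiff_const).rpow_const_of_ne fun x => (radSq_add_pos hε x).ne'

lemma pd_wgt {ε : ℝ} (hε : 0 < ε) (p : ℝ) (i : Fin 3) (x : E3) :
    pd i (wgt ε p) x = -2 * p * (if i = 2 then 0 else x i) * wgt ε (p + 1) x := by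
  have hs : ContDiff ℝ ∞ (fun x : E3 => x 0 ^ 2 + x 1 ^ 2 + ε) := smooth_radSq.add contDiff_const
  have h := pd_comp (φ := fun t => t ^ (-p)) i (smooth_differentiable hs) x
    (Real.hasDerivAt_rpow_const (p := -p) (Or.inl (radSq_add_pos hε x).ne'))
  rw [pd_add _ (smooth_differentiable smooth_radSq) (differentiable_const ε), pd_radSq,
    pd_const] at h
  change pd i (wgt ε p) x = _ at h
  rw [h]
  have : -p - 1 = -(p + 1) := by ring
  rw [this]
  unfold wgt
  split <;> ring

lemma radSq_add_mul_wgt {ε : ℝ} (hε : 0 < ε) (p : ℝ) (x : E3) :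
    (x 0 ^ 2 + x 1 ^ 2 + ε) * wgt ε (p + 1) x = wgt ε p x := by
  unfold wgt
  have hp := radSq_add_pos hε x
  rw [mul_comm, ← Real.rpow_add_one hp.ne']
  congr 1; ring

lemma rad_mul_wgt_le {ε : ℝ} (hε : 0 < ε) (p : ℝ) (x : E3) :
    rad x * wgt ε p x ≤ wgt ε (p - 1 / 2) x := by
  have hp := radSq_add_pos hε x
  have e : wgt ε (p - 1 / 2) x = √(x 0 ^ 2 + x 1 ^ 2 + ε) * wgt ε p x := by
    unfold wgt
    rw [Real.sqrt_eq_rpow, ← Real.rpow_add hp]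
    congr 1; ring
  rw [e]
  refine mul_le_mul_of_nonneg_right (Real.sqrt_le_sqrt (by linarith)) (wgt_nonneg hε p x)

lemma abs_coord_le_rad (x : E3) : |x 0| ≤ rad x ∧ |x 1| ≤ rad x :=
  ⟨Real.abs_le_sqrt (by nlinarith [sq_nonneg (x 1)]),
    Real.abs_le_sqrt (by nlinarith [sq_nonneg (x 0)])⟩

lemma wgt_le {ε p : ℝ} (hε : 0 < ε) (hp : 0 ≤ p) (x : E3) : wgt ε p x ≤ ε ^ (-p) := by
  unfold wgt
  exact Real.rpow_le_rpow_of_nonpos hε (by nlinarith [sq_nonneg (x 0), sq_nonneg (x 1)])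
    (by linarith)

lemma integrable_bdd_mul {w : E3 → ℝ} {C : ℝ} (hg : Integrable g) (hw : Continuous w)
    (hC : ∀ x, |w x| ≤ C) : Integrable fun x => w x * g x :=
  hg.bdd_mul hw.aestronglyMeasurable (Eventually.of_forall hC)

/-- The divergence theorem for the field `(x₁, x₂, 0) (r² + ε)^(-p) g`. The condition `1/2 ≤ p`
makes the weighted field bounded. -/
lemma integral_wgt_div {ε p : ℝ} (hε : 0 < ε) (hp : 1 / 2 ≤ p) (hg : Differentiable ℝ g)
    (h0 : Integrable g) (h1 : Integrable (pd 0 g)) (h2 : Integrable (pd 1 g)) :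
    ∫ x, (2 * wgt ε p x - 2 * p * (x 0 ^ 2 + x 1 ^ 2) * wgt ε (p + 1) x) * g x
      = - ∫ x, wgt ε p x * (x 0 * pd 0 g x + x 1 * pd 1 g x) := by
  have hw := smooth_wgt hε p
  have hw1 := smooth_wgt hε (p + 1)
  have bd : ∀ i : Fin 3, i ≠ 2 → ∀ x : E3, |x i * wgt ε p x| ≤ ε ^ (-(p - 1 / 2)) := by
    intro i hi x
    rw [abs_mul, abs_of_nonneg (wgt_nonneg hε p x)]
    refine le_trans (mul_le_mul_of_nonneg_right ?_ (wgt_nonneg hε p x))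
      ((rad_mul_wgt_le hε p x).trans (wgt_le hε (by linarith) x))
    fin_cases i
    · exact (abs_coord_le_rad x).1
    · exact (abs_coord_le_rad x).2
    · exact absurd rfl hi
  have e1 : ∀ i : Fin 3, i ≠ 2 → ∀ x : E3, pd i (fun y => y i * wgt ε p y) x
      = wgt ε p x - 2 * p * x i ^ 2 * wgt ε (p + 1) x := by
    intro i hi x
    rw [pd_coord_mul _ _ (smooth_differentiable hw), pd_wgt hε]
    simp [hi]; ring
  have bd2 : ∀ i : Fin 3, i ≠ 2 → ∀ x : E3,
      |wgt ε p x - 2 * p * x i ^ 2 * wgt ε (p + 1) x| ≤ (1 + 2 * p) * ε ^ (-p) := by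
    intro i hi x
    have hq : x i ^ 2 ≤ x 0 ^ 2 + x 1 ^ 2 + ε := by
      fin_cases i
      · simp; nlinarith [sq_nonneg (x 1)]
      · simp; nlinarith [sq_nonneg (x 0)]
      · exact absurd rfl hi
    have hn := wgt_nonneg hε (p + 1) x
    have a1 : x i ^ 2 * wgt ε (p + 1) x ≤ wgt ε p x := by
      rw [← radSq_add_mul_wgt hε p]
      exact mul_le_mul_of_nonneg_right hq hn
    have a2 : 0 ≤ x i ^ 2 * wgt ε (p + 1) x := by positivity
    have a3 := wgt_le hε (by linarith : 0 ≤ p) x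
    have a4 := wgt_nonneg hε p x
    rw [abs_le]
    constructor <;> nlinarith
  have step : ∀ i : Fin 3, i ≠ 2 → Integrable (pd i g) →
      Integrable (fun x => (wgt ε p x - 2 * p * x i ^ 2 * wgt ε (p + 1) x) * g x) ∧
      Integrable (fun x => x i * wgt ε p x * pd i g x) ∧
      ∫ x, (wgt ε p x - 2 * p * x i ^ 2 * wgt ε (p + 1) x) * g x
        = - ∫ x, x i * wgt ε p x * pd i g x := by
    intro i hi hgi
    have c1 := ((contDiff_coord i).mul hw)
    have c2 : Continuous fun x : E3 => wgt ε p x - 2 * p * x i ^ 2 * wgt ε (p + 1) x :=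
      hw.continuous.sub ((continuous_const.mul ((contDiff_coord i).continuous.pow 2)).mul
        hw1.continuous)
    have i1 := integrable_bdd_mul h0 c2 (bd2 i hi)
    have i2 := integrable_bdd_mul hgi c1.continuous (bd i hi)
    have i3 := integrable_bdd_mul h0 c1.continuous (bd i hi)
    refine ⟨i1, i2, ?_⟩
    have := integral_mul_pd i (smooth_differentiable c1) hg
      (by simpa only [e1 i hi] using i1) i2 i3
    rw [this]; simp only [e1 i hi, neg_neg]
  obtain ⟨a1, a2, a3⟩ := step 0 (by decide) h1
  obtain ⟨b1, b2, b3⟩ := step 1 (by decide) h2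
  have l := integral_add a1 b1
  have r := integral_add a2 b2
  calc _ = ∫ x, ((wgt ε p x - 2 * p * x 0 ^ 2 * wgt ε (p + 1) x) * g x
        + (wgt ε p x - 2 * p * x 1 ^ 2 * wgt ε (p + 1) x) * g x) := by
          congr 1; funext x; ring
    _ = - ∫ x, (x 0 * wgt ε p x * pd 0 g x + x 1 * wgt ε p x * pd 1 g x) := by
          rw [l, r, a3, b3]; ring
    _ = _ := by congr 2; funext x; ring

/-- If `h = r⁻¹ ∂_r g`, then `∫ h` is the limit of the masses of `g` near the axis. -/
lemma tendsto_integral_near_axis (hg : Differentiable ℝ g)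
    (h0 : Integrable g) (h1 : Integrable (pd 0 g)) (h2 : Integrable (pd 1 g))
    (hh : Integrable h)
    (hgh : ∀ x : E3, x 0 * pd 0 g x + x 1 * pd 1 g x = (x 0 ^ 2 + x 1 ^ 2) * h x) :
    Tendsto (fun n : ℕ => ∫ x, 2 * (1 / ((n : ℝ) + 1)) * wgt (1 / ((n : ℝ) + 1)) 2 x * g x) atTop
      (𝓝 (- ∫ x, h x)) := by
  have key : ∀ n : ℕ, ∫ x, 2 * (1 / ((n : ℝ) + 1)) * wgt (1 / ((n : ℝ) + 1)) 2 x * g x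
      = - ∫ x, (x 0 ^ 2 + x 1 ^ 2) * wgt (1 / ((n : ℝ) + 1)) 1 x * h x := by
    intro n
    have hε : (0 : ℝ) < 1 / ((n : ℝ) + 1) := by positivity
    have := integral_wgt_div hε (p := 1) (by norm_num) hg h0 h1 h2
    convert this using 3 with x
    · have := radSq_add_mul_wgt hε 1 x
      norm_num at this ⊢
      left
      linear_combination 2 * this
    · funext x; rw [hgh]; ring
  simp only [key]
  refine Tendsto.neg ?_
  refine tendsto_integral_of_dominated_convergence (fun x => |h x|) (fun n => ?_) hh.abs
    (fun n => ?_) ?_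
  · have hε : (0 : ℝ) < 1 / ((n : ℝ) + 1) := by positivity
    exact ((smooth_radSq.mul (smooth_wgt hε 1)).continuous.aestronglyMeasurable).mul
      hh.aestronglyMeasurable
  · have hε : (0 : ℝ) < 1 / ((n : ℝ) + 1) := by positivity
    refine Eventually.of_forall fun x => ?_
    have hp := radSq_add_pos hε x
    rw [Real.norm_eq_abs, abs_mul]
    refine mul_le_of_le_one_left (abs_nonneg _) ?_
    rw [wgt, Real.rpow_neg_one, ← div_eq_mul_inv, abs_div, abs_of_pos hp,
      abs_of_nonneg (by positivity), div_le_one hp]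
    linarith
  · filter_upwards [ae_rad_ne_zero] with x hx
    have hq : 0 < x 0 ^ 2 + x 1 ^ 2 := by rw [← rad_sq]; positivity
    have : Tendsto (fun n : ℕ => (x 0 ^ 2 + x 1 ^ 2)
        * (x 0 ^ 2 + x 1 ^ 2 + 1 / ((n : ℝ) + 1))⁻¹ * h x) atTop
        (𝓝 ((x 0 ^ 2 + x 1 ^ 2) * (x 0 ^ 2 + x 1 ^ 2 + 0)⁻¹ * h x)) := by
      refine Tendsto.mul_const _ (Tendsto.const_mul _ (Tendsto.inv₀ ?_ (by linarith)))
      exact tendsto_const_nhds.add tendsto_one_div_add_atTop_nhds_zero_nat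
    simpa [wgt, Real.rpow_neg_one, hq.ne'] using this

/-- `∫ r⁻¹ ∂_r g` is minus a multiple of the integral of `g` along the axis. -/
lemma integral_radial_deriv_nonpos (hg : Differentiable ℝ g)
    (h0 : Integrable g) (h1 : Integrable (pd 0 g)) (h2 : Integrable (pd 1 g))
    (hh : Integrable h)
    (hgh : ∀ x : E3, x 0 * pd 0 g x + x 1 * pd 1 g x = (x 0 ^ 2 + x 1 ^ 2) * h x)
    (hpos : ∀ x, 0 ≤ g x) : ∫ x, h x ≤ 0 := by
  have := ge_of_tendsto' (tendsto_integral_near_axis hg h0 h1 h2 hh hgh) (b := 0) fun n =>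
    integral_nonneg fun x => mul_nonneg (mul_nonneg (by positivity)
      (wgt_nonneg (by positivity) _ _)) (hpos x)
  linarith

/-- If `g = O(r²)`, the fundamental theorem of calculus for `∂_r` with the measure
`r⁻¹ dx = dr dθ dx₃` has no boundary term on the axis. -/
lemma integral_radial_deriv_eq_zero (hg : Differentiable ℝ g)
    (h0 : Integrable g) (h1 : Integrable (pd 0 g)) (h2 : Integrable (pd 1 g))
    (hh : Integrable h)
    (hgh : ∀ x : E3, x 0 * pd 0 g x + x 1 * pd 1 g x = (x 0 ^ 2 + x 1 ^ 2) * h x)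
    {m : E3 → ℝ} (hm : Integrable m) (hgm : ∀ x, |g x| ≤ (x 0 ^ 2 + x 1 ^ 2) * m x) :
    ∫ x, h x = 0 := by
  have lim := tendsto_integral_near_axis hg h0 h1 h2 hh hgh
  have lim0 : Tendsto (fun n : ℕ =>
      ∫ x, 2 * (1 / ((n : ℝ) + 1)) * wgt (1 / ((n : ℝ) + 1)) 2 x * g x) atTop
      (𝓝 (∫ _ : E3, (0 : ℝ))) := by
    refine tendsto_integral_of_dominated_convergence (fun x => 2 * |m x|) (fun n => ?_)
      (hm.abs.const_mul 2) (fun n => ?_) ?_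
    · have hε : (0 : ℝ) < 1 / ((n : ℝ) + 1) := by positivity
      exact ((continuous_const.mul (smooth_wgt hε 2).continuous).aestronglyMeasurable).mul
        h0.aestronglyMeasurable
    · have hε : (0 : ℝ) < 1 / ((n : ℝ) + 1) := by positivity
      refine Eventually.of_forall fun x => ?_
      set ε := 1 / ((n : ℝ) + 1)
      have e := radSq_add_mul_wgt hε 1 x
      norm_num at e
      have e1 : (x 0 ^ 2 + x 1 ^ 2 + ε) * wgt ε 1 x = 1 := by
        rw [wgt, Real.rpow_neg_one, mul_inv_cancel₀ (radSq_add_pos hε x).ne']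
      have n1 := wgt_nonneg hε 1 x
      have n2 := wgt_nonneg hε 2 x
      have hq : 0 ≤ x 0 ^ 2 + x 1 ^ 2 := by positivity
      have b1 : ε * wgt ε 1 x ≤ 1 := by nlinarith
      have b2 : (x 0 ^ 2 + x 1 ^ 2) * wgt ε 2 x ≤ wgt ε 1 x := by nlinarith
      have b3 : ε * ((x 0 ^ 2 + x 1 ^ 2) * wgt ε 2 x) ≤ 1 :=
        (mul_le_mul_of_nonneg_left b2 hε.le).trans b1
      rw [Real.norm_eq_abs, abs_mul, abs_of_nonneg (by positivity)]
      calc 2 * ε * wgt ε 2 x * |g x|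
          ≤ 2 * ε * wgt ε 2 x * ((x 0 ^ 2 + x 1 ^ 2) * |m x|) := by
            refine mul_le_mul_of_nonneg_left ((hgm x).trans ?_) (by positivity)
            exact mul_le_mul_of_nonneg_left (le_abs_self _) hq
        _ = 2 * (ε * ((x 0 ^ 2 + x 1 ^ 2) * wgt ε 2 x)) * |m x| := by ring
        _ ≤ 2 * 1 * |m x| := by gcongr
        _ = 2 * |m x| := by ring
    · filter_upwards [ae_rad_ne_zero] with x hx
      have hq : 0 < x 0 ^ 2 + x 1 ^ 2 := by rw [← rad_sq]; positivity
      have t : Tendsto (fun n : ℕ => (1 : ℝ) / ((n : ℝ) + 1)) atTop (𝓝 0) :=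
        tendsto_one_div_add_atTop_nhds_zero_nat
      have : Tendsto (fun n : ℕ => 2 * (1 / ((n : ℝ) + 1))
          * (x 0 ^ 2 + x 1 ^ 2 + 1 / ((n : ℝ) + 1)) ^ (-2 : ℝ) * g x) atTop
          (𝓝 (2 * 0 * (x 0 ^ 2 + x 1 ^ 2 + 0) ^ (-2 : ℝ) * g x)) := by
        refine Tendsto.mul_const _ ((t.const_mul 2).mul ?_)
        exact (tendsto_const_nhds.add t).rpow_const (Or.inl (by linarith))
      simpa [wgt] using this
  have := tendsto_nhds_unique lim lim0
  simpa using this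

/-- `∫ f r⁻¹ ∂_r f ≤ 0`: the integral is `-π ∫ f(0, 0, x₃)² dx₃`. -/
lemma integral_mul_kap_nonpos (hf : SobInf f) (ha : Axi f) : ∫ x, f x * kap f x ≤ 0 := by
  have := integral_radial_deriv_nonpos (g := fun x => f x * f x) (h := fun x => 2 * (f x * kap f x))
    (hf.diff.fun_mul hf.diff) (hf.integrable_mul hf)
    ?_ ?_ ((hf.integrable_mul hf.kap).const_mul 2) (fun x => ?_) (fun x => mul_self_nonneg _)
  · rw [integral_const_mul] at this; linarith
  · have := ((hf.pd 0).integrable_mul hf).add (hf.integrable_mul (hf.pd 0))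
    exact this.congr (Eventually.of_forall fun x => (pd_mul 0 hf.diff hf.diff x).symm)
  · have := ((hf.pd 1).integrable_mul hf).add (hf.integrable_mul (hf.pd 1))
    exact this.congr (Eventually.of_forall fun x => (pd_mul 1 hf.diff hf.diff x).symm)
  · rw [pd_mul 0 hf.diff hf.diff, pd_mul 1 hf.diff hf.diff, pd_zero_eq ha hf.1,
      pd_one_eq ha hf.1]
    ring

end

section

variable {f g h : E3 → ℝ}

/-! ### Lebesgue norms and Hölder's inequality -/

section Norms

variable {F : Type*} [NormedAddCommGroup F]

lemma lpNorm_pow_eq {v : E3 → F} (n : ℕ) (hn : n ≠ 0) (hv : AEStronglyMeasurable v volume) :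
    lpNorm v n volume ^ n = ∫ x, ‖v x‖ ^ n := by
  have hn' : (n : ℝ) ≠ 0 := by exact_mod_cast hn
  rw [lpNorm_eq_integral_norm_rpow_toReal (by exact_mod_cast hn) (by simp) hv]
  simp only [ENNReal.toReal_natCast, Real.rpow_natCast]
  exact Real.rpow_inv_natCast_pow (integral_nonneg fun x => by positivity) hn

lemma norm2_sq {v : E3 → F} (hv : AEStronglyMeasurable v volume) :
    norm2 v ^ 2 = ∫ x, ‖v x‖ ^ 2 := by
  simpa [norm2] using lpNorm_pow_eq 2 two_ne_zero hv

lemma norm2_nonneg (v : E3 → F) : 0 ≤ norm2 v := lpNorm_nonneg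

lemma norm2_le_of_ae_le {v : E3 → F} {G : Type*} [NormedAddCommGroup G] {w : E3 → G}
    (hv : AEStronglyMeasurable v volume) (hw : MemLp w 2 volume)
    (h : ∀ᵐ x, ‖v x‖ ≤ ‖w x‖) : norm2 v ≤ norm2 w := by
  rw [norm2, norm2, ← toReal_eLpNorm hv, ← toReal_eLpNorm hw.1]
  exact ENNReal.toReal_mono hw.2.ne (eLpNorm_mono_ae h)

end Norms

/-- Hölder's inequality for three factors. -/
lemma integral_abs_mul_le {p q r s : ENNReal} [hqr : ENNReal.HolderTriple q r s]
    [hps : ENNReal.HolderTriple p s 1] (hf : MemLp f p volume) (hg : MemLp g q volume)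
    (hh : MemLp h r volume) :
    Integrable (fun x => f x * (g x * h x)) ∧
    ∫ x, |f x * (g x * h x)| ≤ lpNorm f p volume * (lpNorm g q volume * lpNorm h r volume) := by
  have h1 : MemLp (fun x => g x * h x) s volume := hh.mul' hg
  have h2 : MemLp (fun x => f x * (g x * h x)) 1 volume := h1.mul' hf
  refine ⟨memLp_one_iff_integrable.1 h2, ?_⟩
  have e := lpNorm_one_eq_integral_norm h2.1
  simp only [Real.norm_eq_abs] at e
  rw [← e, ← toReal_eLpNorm h2.1, ← toReal_eLpNorm hf.1, ← toReal_eLpNorm hg.1,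
    ← toReal_eLpNorm hh.1, ← ENNReal.toReal_mul, ← ENNReal.toReal_mul]
  have a1 := eLpNorm_smul_le_mul_eLpNorm (p := q) (q := r) (r := s) hh.1 hg.1
  have a2 := eLpNorm_smul_le_mul_eLpNorm (p := p) (q := s) (r := 1) h1.1 hf.1
  refine ENNReal.toReal_mono
    (ENNReal.mul_ne_top hf.2.ne (ENNReal.mul_ne_top hg.2.ne hh.2.ne)) ?_
  exact a2.trans (mul_le_mul_right a1 _)

/-- The Cauchy–Schwarz inequality. -/
lemma integral_abs_mul_le_norm2 (hf : MemLp f 2 volume) (hg : MemLp g 2 volume) :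
    ∫ x, |f x * g x| ≤ norm2 f * norm2 g := by
  have h2 : MemLp (fun x => f x * g x) 1 volume := MemLp.mul' (p := 2) (q := 2) (r := 1) hg hf
  have e := lpNorm_one_eq_integral_norm h2.1
  simp only [Real.norm_eq_abs] at e
  have a := eLpNorm_smul_le_mul_eLpNorm (p := 2) (q := 2) (r := 1) hg.1 hf.1
  change eLpNorm (fun x => f x * g x) 1 volume ≤ _ at a
  have t := ENNReal.toReal_mono (ENNReal.mul_ne_top hf.2.ne hg.2.ne) a
  rwa [ENNReal.toReal_mul, toReal_eLpNorm h2.1, e, toReal_eLpNorm hf.1, toReal_eLpNorm hg.1] at t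

/-! ### The Sobolev inequality -/

lemma continuous_gradient (hf : ContDiff ℝ ∞ f) : Continuous (∇ f) :=
  (InnerProductSpace.toDual ℝ E3).symm.continuous.comp (hf.continuous_fderiv (by simp))

lemma norm_gradient_eq (f : E3 → ℝ) (x : E3) : ‖∇ f x‖ = ‖fderiv ℝ f x‖ := by
  simp [gradient]

lemma abs_pd_le_norm_gradient (i : Fin 3) (f : E3 → ℝ) (x : E3) : |pd i f x| ≤ ‖∇ f x‖ := by
  refine abs_le_of_sq_le_sq ?_ (norm_nonneg _)
  rw [norm_gradient_sq]
  fin_cases i <;> simp <;>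
    nlinarith [sq_nonneg (pd 0 f x), sq_nonneg (pd 1 f x), sq_nonneg (pd 2 f x)]

lemma SobInf.memLp_gradient (hf : SobInf f) : MemLp (∇ f) 2 volume := by
  have hc := continuous_gradient hf.1
  rw [memLp_two_iff_integrable_sq_norm hc.aestronglyMeasurable]
  simp only [norm_gradient_sq]
  exact (((hf.pd 0).memLp.integrable_sq).add (hf.pd 1).memLp.integrable_sq).add
    (hf.pd 2).memLp.integrable_sq

/-- The square of `‖∇f‖₂` in terms of the partial derivatives. -/
lemma SobInf.norm2_gradient_sq (hf : SobInf f) :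
    norm2 (∇ f) ^ 2 = (∫ x, AxiNS.pd 0 f x ^ 2) + (∫ x, AxiNS.pd 1 f x ^ 2)
      + ∫ x, AxiNS.pd 2 f x ^ 2 := by
  rw [norm2_sq hf.memLp_gradient.1]
  simp only [norm_gradient_sq]
  have i0 := (hf.pd 0).memLp.integrable_sq
  have i1 := (hf.pd 1).memLp.integrable_sq
  have i01 : Integrable fun x => AxiNS.pd 0 f x ^ 2 + AxiNS.pd 1 f x ^ 2 := i0.add i1
  rw [integral_add i01 (hf.pd 2).memLp.integrable_sq, integral_add i0 i1]

/-- The Sobolev inequality in `ℝ³`, extended from compactly supported functions by cutting off at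
distance `n` from the origin. -/
lemma exists_sobolev : ∃ C : ℝ, 0 < C ∧ ∀ f : E3 → ℝ, SobInf f →
    MemLp f 6 volume ∧ lpNorm f 6 volume ≤ C * norm2 (∇ f) := by
  set K : NNReal := SNormLESNormFDerivOfEqConst ℝ (volume : Measure E3) 2
  refine ⟨K + 1, by positivity, fun f hf => ?_⟩
  have hc := continuous_gradient hf.1
  have hfd : MemLp (fderiv ℝ f) 2 volume :=
    (memLp_congr_norm hf.memLp_gradient.1
      (hf.1.continuous_fderiv (by simp)).aestronglyMeasurable
      (Eventually.of_forall fun x => norm_gradient_eq f x)).1 hf.memLp_gradient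
  have hfd2 : eLpNorm (fderiv ℝ f) 2 volume = eLpNorm (∇ f) 2 volume :=
    eLpNorm_congr_norm_ae (Eventually.of_forall fun x => (norm_gradient_eq f x).symm)
  let χ : ContDiffBump (0 : E3) := ⟨1, 2, one_pos, one_lt_two⟩
  have hχ : ContDiff ℝ ∞ (χ : E3 → ℝ) := χ.contDiff
  obtain ⟨M, hM⟩ := (hχ.continuous_fderiv (by simp)).bounded_above_of_compact_support
    (χ.hasCompactSupport.fderiv ℝ)
  have hM0 : 0 ≤ M := (norm_nonneg _).trans (hM 0)
  let η : ℕ → E3 → ℝ := fun n x => χ ((1 / ((n : ℝ) + 1)) • x)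
  have hη : ∀ n, ContDiff ℝ ∞ (η n) := fun n => hχ.comp (contDiff_const_smul _)
  have hηc : ∀ n, HasCompactSupport (η n) := fun n => by
    have hn : (1 / ((n : ℝ) + 1)) ≠ 0 := by positivity
    exact χ.hasCompactSupport.comp_homeomorph (Homeomorph.smulOfNeZero _ hn)
  have bound : ∀ n, eLpNorm (fun x => η n x * f x) 6 volume
      ≤ K * (eLpNorm (∇ f) 2 volume
          + ENNReal.ofReal (M * (1 / ((n : ℝ) + 1))) * eLpNorm f 2 volume) := by
    intro n
    have hd : ContDiff ℝ ∞ (fun x => η n x * f x) := (hη n).mul hf.1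
    have h6 := eLpNorm_le_eLpNorm_fderiv_of_eq (volume : Measure E3) (F := ℝ)
      (hd.of_le (by exact_mod_cast le_top)) ((hηc n).mul_right (f' := f)) (p := 2) (p' := 6)
      (by norm_num) (by simp) (by simp; norm_num)
    refine h6.trans (mul_le_mul_right ?_ _)
    have e : ∀ x, fderiv ℝ (fun x => η n x * f x) x
        = η n x • fderiv ℝ f x + f x • fderiv ℝ (η n) x := fun x =>
      fderiv_fun_mul ((smooth_differentiable (hη n)) x) (hf.diff x)
    have e2 : ∀ x, ‖fderiv ℝ (η n) x‖ ≤ M * (1 / ((n : ℝ) + 1)) := by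
      intro x
      have := ((smooth_differentiable hχ) ((1 / ((n : ℝ) + 1)) • x)).hasFDerivAt.comp x
        ((ContinuousLinearMap.id ℝ E3).hasFDerivAt.const_smul (1 / ((n : ℝ) + 1)))
      have e3 : fderiv ℝ (η n) x = (1 / ((n : ℝ) + 1)) •
          fderiv ℝ χ ((1 / ((n : ℝ) + 1)) • x) := by
        refine this.fderiv.trans ?_
        ext v; simp
      rw [e3, norm_smul, Real.norm_of_nonneg (by positivity), mul_comm]
      exact mul_le_mul_of_nonneg_right (hM _) (by positivity)
    calc eLpNorm (fderiv ℝ fun x => η n x * f x) 2 volume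
        ≤ eLpNorm (fun x => ‖fderiv ℝ f x‖ + (M * (1 / ((n : ℝ) + 1))) * ‖f x‖) 2 volume := by
          refine eLpNorm_mono_real fun x => ?_
          rw [e]
          refine (norm_add_le _ _).trans (add_le_add ?_ ?_)
          · rw [norm_smul]
            refine mul_le_of_le_one_left (norm_nonneg _) ?_
            rw [Real.norm_of_nonneg χ.nonneg]; exact χ.le_one
          · rw [norm_smul, mul_comm]
            exact mul_le_mul_of_nonneg_right (e2 x) (norm_nonneg _)
      _ ≤ eLpNorm (fun x => ‖fderiv ℝ f x‖) 2 volume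
          + eLpNorm (fun x => (M * (1 / ((n : ℝ) + 1))) * ‖f x‖) 2 volume :=
          eLpNorm_add_le hfd.1.norm (hf.cont.norm.aestronglyMeasurable.const_mul _) (by norm_num)
      _ = _ := by
          rw [eLpNorm_norm, hfd2]
          congr 1
          have := eLpNorm_const_smul (M * (1 / ((n : ℝ) + 1))) (fun x => ‖f x‖) 2
            (volume : Measure E3)
          rw [eLpNorm_norm] at this
          rw [Real.enorm_eq_ofReal (by positivity)] at this
          exact this
  have hlim : ∀ x, Tendsto (fun n => η n x * f x) atTop (𝓝 (f x)) := by
    intro x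
    have t : Tendsto (fun n : ℕ => (1 / ((n : ℝ) + 1)) • x) atTop (𝓝 ((0 : ℝ) • x)) :=
      tendsto_one_div_add_atTop_nhds_zero_nat.smul_const x
    have t2 := ((hχ.continuous.tendsto _).comp t).mul_const (f x)
    rw [zero_smul, χ.one_of_mem_closedBall (by simp [χ]), one_mul] at t2
    exact t2
  have lim2 : Tendsto (fun n : ℕ => (K : ENNReal) * (eLpNorm (∇ f) 2 volume
          + ENNReal.ofReal (M * (1 / ((n : ℝ) + 1))) * eLpNorm f 2 volume)) atTop
      (𝓝 (K * (eLpNorm (∇ f) 2 volume + ENNReal.ofReal (M * 0) * eLpNorm f 2 volume))) := by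
    refine ENNReal.Tendsto.const_mul (tendsto_const_nhds.add ?_) (Or.inr (by simp))
    refine ENNReal.Tendsto.mul_const ?_ (Or.inr hf.memLp.2.ne)
    exact ENNReal.tendsto_ofReal (tendsto_one_div_add_atTop_nhds_zero_nat.const_mul M)
  simp only [mul_zero, ENNReal.ofReal_zero, zero_mul, add_zero] at lim2
  have main : eLpNorm f 6 volume ≤ K * eLpNorm (∇ f) 2 volume := by
    refine (Lp.eLpNorm_lim_le_liminf_eLpNorm
      (fun n => ((hη n).continuous.mul hf.cont).aestronglyMeasurable) f
      (Eventually.of_forall hlim)).trans ?_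
    rw [← lim2.liminf_eq]
    exact liminf_le_liminf (Eventually.of_forall bound)
  have hfin : (K : ENNReal) * eLpNorm (∇ f) 2 volume ≠ ⊤ :=
    ENNReal.mul_ne_top (by simp) hf.memLp_gradient.2.ne
  refine ⟨⟨hf.cont.aestronglyMeasurable, main.trans_lt hfin.lt_top⟩, ?_⟩
  rw [norm2, ← toReal_eLpNorm hf.cont.aestronglyMeasurable, ← toReal_eLpNorm hf.memLp_gradient.1]
  have := ENNReal.toReal_mono hfin main
  rw [ENNReal.toReal_mul] at this
  refine this.trans ?_
  simp only [ENNReal.coe_toReal]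
  nlinarith [ENNReal.toReal_nonneg (a := eLpNorm (∇ f) 2 volume)]

/-- A constant for the Sobolev inequality `‖f‖₆ ≤ C ‖∇f‖₂` in `ℝ³`. -/
def sobC : ℝ := exists_sobolev.choose

lemma sobC_pos : 0 < sobC := exists_sobolev.choose_spec.1

namespace SobInf

lemma memLp_six (hf : SobInf f) : MemLp f 6 volume := (exists_sobolev.choose_spec.2 f hf).1

lemma lpNorm_six_le (hf : SobInf f) : lpNorm f 6 volume ≤ sobC * norm2 (∇ f) :=
  (exists_sobolev.choose_spec.2 f hf).2

lemma integrable_pow_six (hf : SobInf f) : Integrable fun x => f x ^ 6 := by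
  have h6 : MemLp f (6 : ℕ) volume := by exact_mod_cast hf.memLp_six
  have := h6.integrable_norm_pow (by norm_num)
  refine this.congr (Eventually.of_forall fun x => ?_)
  simp only [Real.norm_eq_abs]
  exact Even.pow_abs (by decide) _

lemma integrable_pow_four (hf : SobInf f) : Integrable fun x => f x ^ 4 := by
  refine (hf.memLp.integrable_sq.add hf.integrable_pow_six).mono'
    (hf.cont.pow 4).aestronglyMeasurable (Eventually.of_forall fun x => ?_)
  simp only [Pi.add_apply]
  rw [Real.norm_of_nonneg (by positivity)]
  nlinarith [mul_nonneg (sq_nonneg (f x)) (sq_nonneg (f x ^ 2 - 1)), sq_nonneg (f x),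
    sq_nonneg (f x ^ 3), sq_nonneg (f x ^ 2)]

lemma memLp_sq (hf : SobInf f) : MemLp (fun x => f x ^ 2) 2 volume := by
  refine (memLp_two_iff_integrable_sq (f := fun x => f x ^ 2)
    (hf.cont.pow 2).aestronglyMeasurable).2 ?_
  refine hf.integrable_pow_four.congr (Eventually.of_forall fun x => ?_)
  ring

lemma memLp_cube (hf : SobInf f) : MemLp (fun x => f x ^ 3) 2 volume := by
  refine (memLp_two_iff_integrable_sq (f := fun x => f x ^ 3)
    (hf.cont.pow 3).aestronglyMeasurable).2 ?_
  refine hf.integrable_pow_six.congr (Eventually.of_forall fun x => ?_)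
  ring

lemma memLp_mul (hf : SobInf f) (hg : SobInf g) : MemLp (fun x => f x * g x) 2 volume := by
  refine (hf.memLp_sq.add hg.memLp_sq).of_le (hf.cont.mul hg.cont).aestronglyMeasurable
    (Eventually.of_forall fun x => ?_)
  simp only [Pi.add_apply, Real.norm_eq_abs]
  rw [abs_of_nonneg (by positivity : 0 ≤ f x ^ 2 + g x ^ 2), abs_le]
  constructor <;> nlinarith [sq_nonneg (f x - g x), sq_nonneg (f x + g x)]

lemma integrable_mul_mul (hf : SobInf f) (hg : SobInf g) (hh : SobInf h) :
    Integrable fun x => f x * g x * h x :=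
  (hf.memLp_mul hg).integrable_mul hh.memLp

lemma integrable_abs_cube (hf : SobInf f) : Integrable fun x => |f x| ^ 3 := by
  refine (hf.memLp.integrable_sq.add hf.integrable_pow_four).mono'
    (hf.cont.abs.pow 3).aestronglyMeasurable (Eventually.of_forall fun x => ?_)
  simp only [Pi.add_apply]
  have e4 : f x ^ 4 = |f x| ^ 4 := (Even.pow_abs ⟨2, rfl⟩ _).symm
  rw [Real.norm_of_nonneg (by positivity), ← sq_abs, e4]
  have : 0 ≤ |f x| ^ 2 - |f x| + 1 := by nlinarith [sq_nonneg (|f x| - 1), abs_nonneg (f x)]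
  nlinarith [mul_nonneg (sq_nonneg (|f x|)) this]

lemma memLp_three (hf : SobInf f) : MemLp f 3 volume := by
  refine (integrable_norm_rpow_iff hf.cont.aestronglyMeasurable (by norm_num) (by norm_num)).1 ?_
  refine hf.integrable_abs_cube.congr (Eventually.of_forall fun x => ?_)
  change |f x| ^ 3 = |f x| ^ ENNReal.toReal 3
  rw [← Real.rpow_natCast]
  norm_num

end SobInf

/-! ### A Hardy–Sobolev inequality with weight on the axis -/

lemma abs_radial_le (f : E3 → ℝ) (x : E3) :
    |x 0 * pd 0 f x + x 1 * pd 1 f x| ≤ rad x * ‖∇ f x‖ := by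
  refine abs_le_of_sq_le_sq ?_ (mul_nonneg (rad_nonneg x) (norm_nonneg _))
  rw [mul_pow, rad_sq, norm_gradient_sq]
  nlinarith [sq_nonneg (x 0 * pd 1 f x - x 1 * pd 0 f x),
    mul_nonneg (add_nonneg (sq_nonneg (x 0)) (sq_nonneg (x 1))) (sq_nonneg (pd 2 f x))]

/-- The weighted inequality behind the Hardy–Sobolev inequality: the divergence of
`(x₁, x₂, 0) (r² + ε)^(-p)` is at least `(2 - 2p) (r² + ε)^(-p)`. -/
lemma integral_wgt_le {ε p : ℝ} (hε : 0 < ε) (hp : 1 / 2 ≤ p) (hg : Differentiable ℝ g)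
    (h0 : Integrable g) (h1 : Integrable (pd 0 g)) (h2 : Integrable (pd 1 g))
    (hpos : ∀ x, 0 ≤ g x) {m : E3 → ℝ} (hm0 : ∀ x, 0 ≤ m x)
    (hm : Integrable fun x => wgt ε (p - 1 / 2) x * m x)
    (hgm : ∀ x, |x 0 * pd 0 g x + x 1 * pd 1 g x| ≤ rad x * m x) :
    (2 - 2 * p) * ∫ x, wgt ε p x * g x ≤ ∫ x, wgt ε (p - 1 / 2) x * m x := by
  have hw := smooth_wgt hε p
  have iw : ∀ q, 0 ≤ q → Integrable fun x => wgt ε q x * g x := fun q hq =>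
    integrable_bdd_mul h0 (smooth_wgt hε q).continuous (C := ε ^ (-q)) fun x => by
      rw [abs_of_nonneg (wgt_nonneg hε q x)]; exact wgt_le hε hq x
  have e : ∀ x : E3, (2 * wgt ε p x - 2 * p * (x 0 ^ 2 + x 1 ^ 2) * wgt ε (p + 1) x) * g x
      = (2 - 2 * p) * (wgt ε p x * g x) + 2 * p * ε * (wgt ε (p + 1) x * g x) := fun x => by
    have := radSq_add_mul_wgt hε p x
    linear_combination (-2 * p * g x) * this
  have key := integral_wgt_div hε hp hg h0 h1 h2
  simp only [e] at key
  rw [integral_add ((iw p (by linarith)).const_mul _) ((iw (p + 1) (by linarith)).const_mul _),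
    integral_const_mul, integral_const_mul] at key
  have n1 : 0 ≤ ∫ x, wgt ε (p + 1) x * g x :=
    integral_nonneg fun x => mul_nonneg (wgt_nonneg hε _ x) (hpos x)
  have n2 : 0 ≤ 2 * p * ε * ∫ x, wgt ε (p + 1) x * g x := by positivity
  have n3 : - ∫ x, wgt ε p x * (x 0 * pd 0 g x + x 1 * pd 1 g x)
      ≤ ∫ x, wgt ε (p - 1 / 2) x * m x := by
    refine (neg_le_abs _).trans ?_
    rw [← Real.norm_eq_abs]
    refine norm_integral_le_of_norm_le hm (Eventually.of_forall fun x => ?_)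
    rw [Real.norm_eq_abs, abs_mul, abs_of_nonneg (wgt_nonneg hε p x)]
    calc wgt ε p x * |x 0 * pd 0 g x + x 1 * pd 1 g x|
        ≤ wgt ε p x * (rad x * m x) := mul_le_mul_of_nonneg_left (hgm x) (wgt_nonneg hε p x)
      _ = (rad x * wgt ε p x) * m x := by ring
      _ ≤ wgt ε (p - 1 / 2) x * m x :=
        mul_le_mul_of_nonneg_right (rad_mul_wgt_le hε p x) (hm0 x)
  linarith

end

section

variable {f g h : E3 → ℝ}

lemma pd_pow_succ (i : Fin 3) (n : ℕ) (hf : Differentiable ℝ f) (x : E3) :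
    pd i (fun y => f y ^ (n + 1)) x = (n + 1) * f x ^ n * pd i f x := by
  have := pd_comp (φ := fun t => t ^ (n + 1)) i hf x (hasDerivAt_pow (n + 1) (f x))
  simpa using this

lemma hasDerivAt_abs_cube (t : ℝ) : HasDerivAt (fun t : ℝ => |t| ^ 3) (3 * |t| * t) t := by
  have := hasDerivAt_abs_rpow t (p := 3) (by norm_num)
  norm_num at this
  refine this.congr_of_eventuallyEq (Eventually.of_forall fun s => ?_)
  simp only [← Real.rpow_natCast, Nat.cast_ofNat]

lemma pd_abs_cube (i : Fin 3) (hf : Differentiable ℝ f) (x : E3) :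
    pd i (fun y => |f y| ^ 3) x = 3 * |f x| * f x * pd i f x :=
  pd_comp (φ := fun t => |t| ^ 3) i hf x (hasDerivAt_abs_cube (f x))

lemma differentiable_abs_cube (hf : Differentiable ℝ f) :
    Differentiable ℝ (fun y => |f y| ^ 3) := fun x =>
  ((hasDerivAt_abs_cube (f x)).differentiableAt.comp x (hf x))

lemma wgt_zero (ε : ℝ) (x : E3) : wgt ε 0 x = 1 := by simp [wgt]

namespace SobInf

lemma norm2_cube (hf : SobInf f) : norm2 (fun x => f x ^ 3) = lpNorm f 6 volume ^ 3 := by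
  have h6 := lpNorm_pow_eq (v := f) 6 (by norm_num) hf.cont.aestronglyMeasurable
  have h2 := norm2_sq hf.memLp_cube.1
  have e : ∀ x, ‖f x ^ 3‖ ^ 2 = ‖f x‖ ^ 6 := fun x => by rw [norm_pow]; ring
  simp only [e] at h2
  rw [← h6] at h2
  push_cast at h2
  refine (pow_left_inj₀ (norm2_nonneg _) (pow_nonneg lpNorm_nonneg 3) two_ne_zero).1 ?_
  rw [h2]; ring

/-- `∫ f⁴ / r ≤ C ‖∇f‖₂⁴`, with a regularised weight: apply `integral_wgt_le` to `f⁴`, then the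
Cauchy–Schwarz and Sobolev inequalities to `∫ |f|³ |∇f|`. -/
lemma integral_wgt_pow_four_le (hf : SobInf f) {ε : ℝ} (hε : 0 < ε) :
    ∫ x, wgt ε (1 / 2) x * f x ^ 4 ≤ 4 * sobC ^ 3 * norm2 (∇ f) ^ 4 := by
  have hN := norm2_nonneg (∇ f)
  have hG := hf.memLp_gradient
  have c3 : MemLp (fun x => |f x ^ 3|) 2 volume := hf.memLp_cube.abs
  have hm : Integrable fun x => 4 * (|f x ^ 3| * ‖∇ f x‖) :=
    (c3.integrable_mul hG.norm).const_mul 4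
  have e : ∀ i x, AxiNS.pd i (fun y => f y ^ 4) x = 4 * (f x ^ 3 * AxiNS.pd i f x) := fun i x => by
    rw [pd_pow_succ i 3 hf.diff]; push_cast; ring
  have hi : ∀ i, Integrable (AxiNS.pd i fun y => f y ^ 4) := fun i =>
    ((hf.memLp_cube.integrable_mul (hf.pd i).memLp).const_mul 4).congr
      (Eventually.of_forall fun x => (e i x).symm)
  have key := integral_wgt_le hε (p := 1 / 2) le_rfl (hf.diff.fun_pow 4) hf.integrable_pow_four
    (hi 0) (hi 1) (fun x => by positivity) (m := fun x => 4 * (|f x ^ 3| * ‖∇ f x‖))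
    (fun x => by positivity) (by norm_num [wgt_zero]; simpa only [abs_pow] using hm) (fun x => by
      rw [e, e, show x 0 * (4 * (f x ^ 3 * AxiNS.pd 0 f x)) + x 1 * (4 * (f x ^ 3 * AxiNS.pd 1 f x))
        = 4 * (f x ^ 3 * (x 0 * AxiNS.pd 0 f x + x 1 * AxiNS.pd 1 f x)) by ring, abs_mul, abs_mul,
        abs_of_pos (four_pos)]
      have := mul_le_mul_of_nonneg_left (abs_radial_le f x) (abs_nonneg (f x ^ 3))
      linarith)
  norm_num [wgt_zero] at key
  rw [integral_const_mul] at key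
  have cs := integral_abs_mul_le_norm2 hf.memLp_cube hG.norm
  have e2 : norm2 (fun x => ‖∇ f x‖) = norm2 (∇ f) := lpNorm_norm hG.1 2
  rw [e2, hf.norm2_cube] at cs
  simp only [abs_mul, abs_norm, abs_pow] at cs
  have s6 := hf.lpNorm_six_le
  have s6' : lpNorm f 6 volume ^ 3 ≤ (sobC * norm2 (∇ f)) ^ 3 :=
    pow_le_pow_left₀ lpNorm_nonneg s6 3
  calc _ ≤ 4 * (lpNorm f 6 volume ^ 3 * norm2 (∇ f)) := by
        refine key.trans ?_
        linarith
    _ ≤ 4 * ((sobC * norm2 (∇ f)) ^ 3 * norm2 (∇ f)) := by gcongr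
    _ = _ := by ring

/-- `∫ |f|³ / r^(3/2) ≤ C ‖∇f‖₂³`, with a regularised weight: apply `integral_wgt_le` to `|f|³`,
then the Cauchy–Schwarz inequality to `∫ r^(-1/2) f² |∇f|`, with the bound of `∫ f⁴ / r`. -/
lemma integral_wgt_abs_cube_le (hf : SobInf f) {ε : ℝ} (hε : 0 < ε) :
    ∫ x, wgt ε (3 / 4) x * |f x| ^ 3 ≤ 6 * √(4 * sobC ^ 3) * norm2 (∇ f) ^ 3 := by
  have hN := norm2_nonneg (∇ f)
  have hG := hf.memLp_gradient
  have hw := smooth_wgt hε (1 / 4)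
  have w2 : ∀ x, wgt ε (1 / 4) x ^ 2 = wgt ε (1 / 2) x := fun x => by
    rw [wgt, wgt, ← Real.rpow_natCast, ← Real.rpow_mul (radSq_add_pos hε x).le]
    norm_num
  have hwf : MemLp (fun x => wgt ε (1 / 4) x * f x ^ 2) 2 volume := by
    refine hf.memLp_sq.of_le_mul (c := ε ^ (-(1 / 4 : ℝ)))
      (hw.continuous.mul (hf.cont.pow 2)).aestronglyMeasurable (Eventually.of_forall fun x => ?_)
    rw [norm_mul, Real.norm_of_nonneg (wgt_nonneg hε _ x)]
    exact mul_le_mul_of_nonneg_right (wgt_le hε (by norm_num) x) (norm_nonneg _)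
  have hm : Integrable fun x => wgt ε (1 / 4) x * (3 * (f x ^ 2 * ‖∇ f x‖)) :=
    ((hwf.integrable_mul hG.norm).const_mul 3).congr (Eventually.of_forall fun x => by
      simp only [Pi.mul_apply]; ring)
  have hi : ∀ i, Integrable (AxiNS.pd i fun y => |f y| ^ 3) := fun i => by
    have : MemLp (fun x => |f x| * f x) 2 volume :=
      (memLp_congr_norm (hf.cont.abs.mul hf.cont).aestronglyMeasurable hf.memLp_sq.1
        (Eventually.of_forall fun x => by simp [sq])).2 hf.memLp_sq
    refine ((this.integrable_mul (hf.pd i).memLp).const_mul 3).congr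
      (Eventually.of_forall fun x => ?_)
    simp only [Pi.mul_apply]
    rw [pd_abs_cube i hf.diff]; ring
  have key := integral_wgt_le hε (p := 3 / 4) (by norm_num) (differentiable_abs_cube hf.diff)
    hf.integrable_abs_cube (hi 0) (hi 1) (fun x => by positivity)
    (m := fun x => 3 * (f x ^ 2 * ‖∇ f x‖))
    (fun x => by positivity) (by norm_num; norm_num at hm; exact hm) (fun x => by
      rw [pd_abs_cube 0 hf.diff, pd_abs_cube 1 hf.diff,
        show x 0 * (3 * |f x| * f x * AxiNS.pd 0 f x) + x 1 * (3 * |f x| * f x * AxiNS.pd 1 f x)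
        = 3 * (|f x| * f x * (x 0 * AxiNS.pd 0 f x + x 1 * AxiNS.pd 1 f x)) by ring, abs_mul,
        abs_mul, abs_mul, abs_abs, abs_of_pos (three_pos), ← sq, sq_abs]
      have := mul_le_mul_of_nonneg_left (abs_radial_le f x) (sq_nonneg (f x))
      linarith)
  norm_num at key
  have e3 : ∀ x, wgt ε (1 / 4) x * (3 * (f x ^ 2 * ‖∇ f x‖))
      = 3 * ((wgt ε (1 / 4) x * f x ^ 2) * ‖∇ f x‖) := fun x => by ring
  norm_num at e3
  simp only [e3] at key
  rw [integral_const_mul] at key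
  have cs := integral_abs_mul_le_norm2 hwf hG.norm
  have e2 : norm2 (fun x => ‖∇ f x‖) = norm2 (∇ f) := lpNorm_norm hG.1 2
  have eabs : ∀ x, |wgt ε (1 / 4) x * f x ^ 2 * ‖∇ f x‖| = wgt ε (1 / 4) x * f x ^ 2 * ‖∇ f x‖ :=
    fun x => abs_of_nonneg (mul_nonneg (mul_nonneg (wgt_nonneg hε _ x) (sq_nonneg _))
      (norm_nonneg _))
  rw [e2] at cs
  simp only [eabs] at cs
  norm_num at cs
  have hA : norm2 (fun x => wgt ε (1 / 4) x * f x ^ 2) ≤ √(4 * sobC ^ 3) * norm2 (∇ f) ^ 2 := by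
    have h2 := norm2_sq hwf.1
    have e4 : ∀ x, ‖wgt ε (1 / 4) x * f x ^ 2‖ ^ 2 = wgt ε (1 / 2) x * f x ^ 4 := fun x => by
      rw [Real.norm_eq_abs, sq_abs, mul_pow, w2]; ring
    simp only [e4] at h2
    have := hf.integral_wgt_pow_four_le hε
    refine abs_le_of_sq_le_sq' ?_ (by positivity) |>.2
    rw [mul_pow, Real.sq_sqrt (by have := sobC_pos; positivity), h2]
    linarith
  norm_num at hA
  have hA2 := mul_le_mul_of_nonneg_right hA hN
  have e5 : √(4 * sobC ^ 3) = 2 * √(sobC ^ 3) := by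
    rw [Real.sqrt_mul (by norm_num), show (4 : ℝ) = 2 ^ 2 by norm_num, Real.sqrt_sq (by norm_num)]
  rw [e5]
  nlinarith

/-- The Hardy–Sobolev inequality `‖f / √r‖₃ ≤ C ‖∇f‖₂`: Fatou's lemma removes the regularisation
of the weight. -/
lemma exists_hardy_sobolev : ∃ K : ℝ, 0 < K ∧ ∀ f : E3 → ℝ, SobInf f →
    MemLp (fun x => f x / √(rad x)) 3 volume ∧
      lpNorm (fun x => f x / √(rad x)) 3 volume ≤ K * norm2 (∇ f) := by
  have hC := sobC_pos
  set A : ℝ := 6 * √(4 * sobC ^ 3)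
  have hA : 0 < A := by positivity
  refine ⟨A + 1, by positivity, fun f hf => ?_⟩
  have hN := norm2_nonneg (∇ f)
  have hmeas : AEStronglyMeasurable (fun x => f x / √(rad x)) volume :=
    (hf.cont.measurable.div continuous_rad.sqrt.measurable).aestronglyMeasurable
  have hlint : ∫⁻ x, ‖f x / √(rad x)‖ₑ ^ 3 ≤ ENNReal.ofReal (A * norm2 (∇ f) ^ 3) := by
    let ε : ℕ → ℝ := fun n => 1 / ((n : ℝ) + 1)
    have hε : ∀ n, 0 < ε n := fun n => by positivity
    have bd : ∀ n, ∫⁻ x, ENNReal.ofReal (wgt (ε n) (3 / 4) x * |f x| ^ 3)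
        ≤ ENNReal.ofReal (A * norm2 (∇ f) ^ 3) := by
      intro n
      rw [← ofReal_integral_eq_lintegral_ofReal]
      · exact ENNReal.ofReal_le_ofReal (hf.integral_wgt_abs_cube_le (hε n))
      · exact integrable_bdd_mul hf.integrable_abs_cube (smooth_wgt (hε n) _).continuous
          fun x => by
            rw [abs_of_nonneg (wgt_nonneg (hε n) _ x)]; exact wgt_le (hε n) (by norm_num) x
      · exact Eventually.of_forall fun x => mul_nonneg (wgt_nonneg (hε n) _ x) (by positivity)
    have lim : ∀ᵐ x, Tendsto (fun n => ENNReal.ofReal (wgt (ε n) (3 / 4) x * |f x| ^ 3)) atTop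
        (𝓝 (‖f x / √(rad x)‖ₑ ^ 3)) := by
      filter_upwards [ae_rad_ne_zero] with x hx
      have hr : 0 < rad x := (rad_nonneg x).lt_of_ne' hx
      have e : ‖f x / √(rad x)‖ₑ ^ 3
          = ENNReal.ofReal ((x 0 ^ 2 + x 1 ^ 2 + 0) ^ (-(3 / 4) : ℝ) * |f x| ^ 3) := by
        rw [← ofReal_norm, ← ENNReal.ofReal_pow (norm_nonneg _), norm_div, div_pow, add_zero,
          ← rad_sq, Real.norm_eq_abs, Real.norm_of_nonneg (Real.sqrt_nonneg _), div_eq_inv_mul]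
        congr 2
        rw [Real.sqrt_eq_rpow, ← Real.rpow_natCast, ← Real.rpow_natCast, ← Real.rpow_mul hr.le,
          ← Real.rpow_mul hr.le, ← Real.rpow_neg hr.le]
        norm_num
      rw [e]
      refine ENNReal.tendsto_ofReal (Tendsto.mul_const _ ?_)
      have hq : 0 < x 0 ^ 2 + x 1 ^ 2 := by rw [← rad_sq]; positivity
      exact (tendsto_const_nhds.add tendsto_one_div_add_atTop_nhds_zero_nat).rpow_const
        (Or.inl (by linarith))
    calc ∫⁻ x, ‖f x / √(rad x)‖ₑ ^ 3
        = ∫⁻ x, liminf (fun n => ENNReal.ofReal (wgt (ε n) (3 / 4) x * |f x| ^ 3)) atTop :=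
          lintegral_congr_ae (lim.mono fun x hx => hx.liminf_eq.symm)
      _ ≤ liminf (fun n => ∫⁻ x, ENNReal.ofReal (wgt (ε n) (3 / 4) x * |f x| ^ 3)) atTop :=
          lintegral_liminf_le fun n => ENNReal.measurable_ofReal.comp
            ((smooth_wgt (hε n) _).continuous.mul (hf.cont.abs.pow 3)).measurable
      _ ≤ _ := liminf_le_of_frequently_le' (Frequently.of_forall bd)
  have h3 : eLpNorm (fun x => f x / √(rad x)) 3 volume ^ 3 = ∫⁻ x, ‖f x / √(rad x)‖ₑ ^ 3 := by
    have := eLpNorm_nnreal_pow_eq_lintegral (f := fun x => f x / √(rad x))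
      (μ := (volume : Measure E3)) (p := 3) (by norm_num)
    have h2 : ∀ a : ENNReal, a ^ (((3 : NNReal) : ℝ)) = a ^ 3 := fun a => by
      rw [← ENNReal.rpow_natCast]; norm_num
    simp only [h2] at this
    exact this
  have hfin : eLpNorm (fun x => f x / √(rad x)) 3 volume < ⊤ := by
    by_contra hcon
    rw [not_lt, top_le_iff] at hcon
    rw [hcon] at h3
    rw [← h3] at hlint
    simp at hlint
  refine ⟨⟨hmeas, hfin⟩, ?_⟩
  rw [← toReal_eLpNorm hmeas]
  refine le_of_pow_le_pow_left₀ (n := 3) three_ne_zero (by positivity) ?_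
  rw [← ENNReal.toReal_pow, h3]
  have := ENNReal.toReal_mono ENNReal.ofReal_ne_top hlint
  rw [ENNReal.toReal_ofReal (by positivity)] at this
  refine this.trans ?_
  rw [mul_pow]
  refine mul_le_mul_of_nonneg_right ?_ (by positivity)
  nlinarith [sq_nonneg A, pow_pos hA 3]

end SobInf

/-- A constant for the Hardy–Sobolev inequality `‖f / √r‖₃ ≤ C ‖∇f‖₂`. -/
def hardyC : ℝ := SobInf.exists_hardy_sobolev.choose

lemma hardyC_pos : 0 < hardyC := SobInf.exists_hardy_sobolev.choose_spec.1

lemma SobInf.memLp_div_sqrt (hf : SobInf f) : MemLp (fun x => f x / √(rad x)) 3 volume :=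
  (SobInf.exists_hardy_sobolev.choose_spec.2 f hf).1

lemma SobInf.lpNorm_div_sqrt_le (hf : SobInf f) :
    lpNorm (fun x => f x / √(rad x)) 3 volume ≤ hardyC * norm2 (∇ f) :=
  (SobInf.exists_hardy_sobolev.choose_spec.2 f hf).2

end

section

variable {f g h : E3 → ℝ} {v : Fin 3 → E3 → ℝ}

/-! ### Transport by a divergence-free field -/

lemma integral_add_three {f₁ f₂ f₃ : E3 → ℝ} (h₁ : Integrable f₁) (h₂ : Integrable f₂)
    (h₃ : Integrable f₃) :
    ∫ x, (f₁ x + f₂ x + f₃ x) = (∫ x, f₁ x) + (∫ x, f₂ x) + ∫ x, f₃ x := by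
  have h12 : Integrable fun x => f₁ x + f₂ x := h₁.add h₂
  rw [integral_add h12 h₃, integral_add h₁ h₂]

lemma integral_add_four {f₁ f₂ f₃ f₄ : E3 → ℝ} (h₁ : Integrable f₁) (h₂ : Integrable f₂)
    (h₃ : Integrable f₃) (h₄ : Integrable f₄) :
    ∫ x, (f₁ x + f₂ x + f₃ x + f₄ x)
      = (∫ x, f₁ x) + (∫ x, f₂ x) + (∫ x, f₃ x) + ∫ x, f₄ x := by
  have h123 : Integrable fun x => f₁ x + f₂ x + f₃ x := (h₁.add h₂).add h₃
  rw [integral_add h123 h₄, integral_add_three h₁ h₂ h₃]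

/-- The derivative `v · ∇f` along the field with components `v i`. -/
def adv (v : Fin 3 → E3 → ℝ) (f : E3 → ℝ) (x : E3) : ℝ := ∑ i, v i x * pd i f x

lemma memLp_adv (hv : ∀ i, SobInf (v i)) (hf : SobInf f) : MemLp (adv v f) 2 volume := by
  unfold adv
  exact memLp_finsetSum _ fun i _ => (hv i).memLp_mul (hf.pd i)

/-- Transport by a divergence-free field is skew-adjoint. -/
lemma integral_mul_adv (hv : ∀ i, SobInf (v i)) (hdiv : ∀ x, ∑ i, pd i (v i) x = 0)
    (hf : SobInf f) (hg : SobInf g) :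
    ∫ x, f x * adv v g x = - ∫ x, adv v f x * g x := by
  have i1 : ∀ i, Integrable fun x => v i x * f x * pd i g x := fun i =>
    (hv i).integrable_mul_mul hf (hg.pd i)
  have i2 : ∀ i, Integrable fun x => pd i (v i) x * f x * g x := fun i =>
    ((hv i).pd i).integrable_mul_mul hf hg
  have i3 : ∀ i, Integrable fun x => v i x * pd i f x * g x := fun i =>
    (hv i).integrable_mul_mul (hf.pd i) hg
  have step : ∀ i, ∫ x, v i x * f x * pd i g x
      = - ((∫ x, pd i (v i) x * f x * g x) + ∫ x, v i x * pd i f x * g x) := by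
    intro i
    have e : ∀ x, pd i (fun y => v i y * f y) x * g x
        = pd i (v i) x * f x * g x + v i x * pd i f x * g x := fun x => by
      rw [pd_mul i (hv i).diff hf.diff]; ring
    rw [integral_mul_pd i ((hv i).diff.fun_mul hf.diff) hg.diff (by
      simp only [e]; exact (i2 i).add (i3 i)) (i1 i) ((hv i).integrable_mul_mul hf hg)]
    simp only [e]
    rw [integral_add (i2 i) (i3 i)]
  have d0 : ∑ i, ∫ x, pd i (v i) x * f x * g x = 0 := by
    rw [← integral_finsetSum _ fun i _ => i2 i]
    simp [← Finset.sum_mul, hdiv]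
  have l : ∫ x, f x * adv v g x = ∑ i, ∫ x, v i x * f x * pd i g x := by
    rw [← integral_finsetSum _ fun i _ => i1 i]
    congr 1; funext x
    rw [adv, Finset.mul_sum]
    exact Finset.sum_congr rfl fun i _ => by ring
  have r : ∫ x, adv v f x * g x = ∑ i, ∫ x, v i x * pd i f x * g x := by
    rw [← integral_finsetSum _ fun i _ => i3 i]
    congr 1; funext x
    rw [adv, Finset.sum_mul]
  rw [l, r]
  simp only [step, Finset.sum_neg_distrib, Finset.sum_add_distrib, d0, zero_add]

lemma integral_mul_adv_self (hv : ∀ i, SobInf (v i)) (hdiv : ∀ x, ∑ i, pd i (v i) x = 0)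
    (hf : SobInf f) : ∫ x, f x * adv v f x = 0 := by
  have h := integral_mul_adv hv hdiv hf hf
  have e : ∫ x, adv v f x * f x = ∫ x, f x * adv v f x := by
    congr 1; funext x; ring
  linarith

/-- Moving a vertical derivative from `∂₃² f` onto the transporting field. -/
lemma integral_pd_two_mul_adv (hv : ∀ i, SobInf (v i)) (hdiv : ∀ x, ∑ i, pd i (v i) x = 0)
    (hf : SobInf f) :
    ∫ x, pd 2 (pd 2 f) x * adv v f x = ∫ x, f x * adv (fun i => pd 2 (v i)) (pd 2 f) x := by
  have h2 := hf.pd 2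
  have h22 := h2.pd 2
  have hv2 : ∀ i, SobInf (pd 2 (v i)) := fun i => (hv i).pd 2
  rw [integral_mul_adv hv hdiv h22 hf]
  have i1 : ∀ i, Integrable fun x => f x * (pd 2 (v i) x * pd i (pd 2 f) x) := fun i =>
    (hf.integrable_mul_mul (hv2 i) (h2.pd i)).congr (Eventually.of_forall fun x => by ring)
  have i2 : ∀ i, Integrable fun x => f x * (v i x * pd i (pd 2 (pd 2 f)) x) := fun i =>
    (hf.integrable_mul_mul (hv i) (h22.pd i)).congr (Eventually.of_forall fun x => by ring)
  have i3 : ∀ i, Integrable fun x => pd 2 f x * (v i x * pd i (pd 2 f) x) := fun i =>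
    (h2.integrable_mul_mul (hv i) (h2.pd i)).congr (Eventually.of_forall fun x => by ring)
  have i4 : ∀ i, Integrable fun x => f x * (v i x * pd i (pd 2 f) x) := fun i =>
    (hf.integrable_mul_mul (hv i) (h2.pd i)).congr (Eventually.of_forall fun x => by ring)
  have step : ∀ i, (∫ x, f x * (pd 2 (v i) x * pd i (pd 2 f) x))
      + ∫ x, f x * (v i x * pd i (pd 2 (pd 2 f)) x)
      = - ∫ x, pd 2 f x * (v i x * pd i (pd 2 f) x) := by
    intro i
    have e : ∀ x, f x * pd 2 (fun y => v i y * pd i (pd 2 f) y) x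
        = f x * (pd 2 (v i) x * pd i (pd 2 f) x) + f x * (v i x * pd i (pd 2 (pd 2 f)) x) :=
      fun x => by
        rw [pd_mul 2 (hv i).diff (h2.pd i).diff, pd_comm 2 i h2.1]; ring
    rw [← integral_add (i1 i) (i2 i), ← integral_mul_pd 2 hf.diff
      ((hv i).diff.fun_mul (h2.pd i).diff) (i3 i)
      (by simp only [e]; exact (i1 i).add (i2 i)) (i4 i)]
    simp only [e]
  have s1 : ∫ x, f x * adv (fun i => pd 2 (v i)) (pd 2 f) x
      = ∑ i, ∫ x, f x * (pd 2 (v i) x * pd i (pd 2 f) x) := by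
    rw [← integral_finsetSum _ fun i _ => i1 i]
    congr 1; funext x; rw [adv, Finset.mul_sum]
  have s2 : ∫ x, adv v (pd 2 (pd 2 f)) x * f x
      = ∑ i, ∫ x, f x * (v i x * pd i (pd 2 (pd 2 f)) x) := by
    rw [← integral_finsetSum _ fun i _ => i2 i]
    congr 1; funext x; rw [adv, Finset.sum_mul]
    exact Finset.sum_congr rfl fun i _ => by ring
  have s3 : ∫ x, pd 2 f x * adv v (pd 2 f) x
      = ∑ i, ∫ x, pd 2 f x * (v i x * pd i (pd 2 f) x) := by
    rw [← integral_finsetSum _ fun i _ => i3 i]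
    congr 1; funext x; rw [adv, Finset.mul_sum]
  have z := integral_mul_adv_self hv hdiv h2
  rw [s3] at z
  have tot := Finset.sum_congr (rfl : (Finset.univ : Finset (Fin 3)) = Finset.univ)
    fun i _ => step i
  rw [Finset.sum_add_distrib, Finset.sum_neg_distrib, z] at tot
  rw [s1, s2]
  linarith

/-! ### The five-dimensional Laplacian -/

/-- The operator `Δ + (2/r) ∂_r`, which acts on axisymmetric functions of `(r, x₃)` as the
Laplacian of `ℝ⁵`. -/
def lap5 (f : E3 → ℝ) (x : E3) : ℝ :=
  pd 0 (pd 0 f) x + pd 1 (pd 1 f) x + pd 2 (pd 2 f) x + 2 * kap f x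

lemma SobInf.lap5 (hf : SobInf f) : SobInf (lap5 f) :=
  ((((hf.pd 0).pd 0).add ((hf.pd 1).pd 1)).add ((hf.pd 2).pd 2)).add (hf.kap.const_mul 2)

lemma SobInf.integral_mul_pd_pd (hf : SobInf f) (i : Fin 3) :
    ∫ x, f x * AxiNS.pd i (AxiNS.pd i f) x = - ∫ x, AxiNS.pd i f x ^ 2 := by
  rw [hf.integral_mul_pd (hf.pd i)]
  simp only [sq]

/-- Dissipation: `-∫ f (Δ + (2/r) ∂_r) f ≥ ‖∇f‖₂²`. -/
lemma integral_mul_lap5_le (hf : SobInf f) (ha : Axi f) :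
    ∫ x, f x * lap5 f x ≤ - norm2 (∇ f) ^ 2 := by
  have j : ∀ i, Integrable fun x => f x * pd i (pd i f) x := fun i =>
    hf.integrable_mul ((hf.pd i).pd i)
  have jk : Integrable fun x => f x * kap f x := hf.integrable_mul hf.kap
  have e : ∫ x, f x * lap5 f x = (∫ x, f x * pd 0 (pd 0 f) x) + (∫ x, f x * pd 1 (pd 1 f) x)
      + (∫ x, f x * pd 2 (pd 2 f) x) + 2 * ∫ x, f x * kap f x := by
    rw [← integral_const_mul, ← integral_add_four (j 0) (j 1) (j 2) (jk.const_mul 2)]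
    congr 1; funext x; simp only [lap5]; ring
  rw [e, hf.integral_mul_pd_pd, hf.integral_mul_pd_pd, hf.integral_mul_pd_pd,
    hf.norm2_gradient_sq]
  have := integral_mul_kap_nonpos hf ha
  linarith

lemma SobInf.integral_pd_pd_mul (hf : SobInf f) (i j : Fin 3) :
    ∫ x, AxiNS.pd i (AxiNS.pd i f) x * AxiNS.pd j (AxiNS.pd j f) x
      = ∫ x, AxiNS.pd j (AxiNS.pd i f) x ^ 2 := by
  rw [((hf.pd i).pd i).integral_mul_pd (hf.pd j) j]
  have e : ∀ x, AxiNS.pd j (AxiNS.pd i (AxiNS.pd i f)) x * AxiNS.pd j f x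
      = AxiNS.pd j f x * AxiNS.pd i (AxiNS.pd j (AxiNS.pd i f)) x := fun x => by
    rw [pd_comm j i (hf.pd i).1]; ring
  simp only [e]
  rw [(hf.pd j).integral_mul_pd ((hf.pd i).pd j) i, neg_neg]
  congr 1; funext x
  rw [pd_comm i j hf.1]; ring

/-- All second derivatives are controlled in `L²` by the five-dimensional Laplacian: the cross terms
`∫ Δf (2/r) ∂_r f` are nonnegative. -/
lemma sum_norm2_gradient_pd_le (hf : SobInf f) (ha : Axi f) :
    norm2 (∇ (pd 0 f)) ^ 2 + norm2 (∇ (pd 1 f)) ^ 2 + norm2 (∇ (pd 2 f)) ^ 2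
      ≤ norm2 (lap5 f) ^ 2 := by
  have hk := hf.kap
  have hp : ∀ i, SobInf (pd i (pd i f)) := fun i => (hf.pd i).pd i
  have hh : SobInf (fun x => pd 0 (pd 0 f) x + pd 1 (pd 1 f) x) := (hp 0).add (hp 1)
  have hl : SobInf (fun x => pd 0 (pd 0 f) x + pd 1 (pd 1 f) x + pd 2 (pd 2 f) x) := hh.add (hp 2)
  -- the horizontal Laplacian tested against `r⁻¹ ∂_r f`
  have X : ∫ x, (pd 0 (pd 0 f) x + pd 1 (pd 1 f) x) * kap f x = ∫ x, kap f x ^ 2 := by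
    have i0 := hk.integrable_mul (hp 0)
    have i1 := hk.integrable_mul (hp 1)
    have k0 := (hk.pd 0).integrable_mul (hf.pd 0)
    have k1 := (hk.pd 1).integrable_mul (hf.pd 1)
    have e1 : ∫ x, (pd 0 (pd 0 f) x + pd 1 (pd 1 f) x) * kap f x
        = (∫ x, kap f x * pd 0 (pd 0 f) x) + ∫ x, kap f x * pd 1 (pd 1 f) x := by
      rw [← integral_add i0 i1]; congr 1; funext x; ring
    have e2 : ∫ x, (pd 0 (pd 0 f) x + pd 1 (pd 1 f) x) * kap f x
        = (∫ x, pd 0 (kap f) x * pd 0 f x) + (∫ x, pd 1 (kap f) x * pd 1 f x)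
          + 2 * ∫ x, kap f x ^ 2 := by
      rw [← integral_const_mul, ← integral_add_three k0 k1 (hk.memLp.integrable_sq.const_mul 2)]
      congr 1; funext x
      rw [horizontal_laplacian_eq ha hf.1, pd_zero_eq ha hf.1, pd_one_eq ha hf.1,
        pd_zero_eq (ha.kap hf.1) hk.1, pd_one_eq (ha.kap hf.1) hk.1]
      ring
    rw [hk.integral_mul_pd (hf.pd 0), hk.integral_mul_pd (hf.pd 1)] at e1
    linarith
  -- `∫ ∂₃² f r⁻¹ ∂_r f = -∫ ∂₃ f r⁻¹ ∂_r ∂₃ f`, which is the square of `∂₃ f` on the axis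
  have Y : 0 ≤ ∫ x, pd 2 (pd 2 f) x * kap f x := by
    have e : ∫ x, pd 2 (pd 2 f) x * kap f x = ∫ x, kap f x * pd 2 (pd 2 f) x := by
      congr 1; funext x; ring
    have := integral_mul_kap_nonpos (hf.pd 2) (ha.pd_two hf.1)
    rw [e, hk.integral_mul_pd (hf.pd 2)]
    have e2 : ∫ x, pd 2 (kap f) x * pd 2 f x = ∫ x, pd 2 f x * kap (pd 2 f) x := by
      congr 1; funext x; rw [kap_pd_two ha hf.1]; ring
    linarith
  have ZZ : ∫ x, (pd 0 (pd 0 f) x + pd 1 (pd 1 f) x + pd 2 (pd 2 f) x) ^ 2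
      = norm2 (∇ (pd 0 f)) ^ 2 + norm2 (∇ (pd 1 f)) ^ 2 + norm2 (∇ (pd 2 f)) ^ 2 := by
    rw [(hf.pd 0).norm2_gradient_sq, (hf.pd 1).norm2_gradient_sq, (hf.pd 2).norm2_gradient_sq]
    simp only [← hf.integral_pd_pd_mul]
    have m : ∀ i j, Integrable fun x => pd i (pd i f) x * pd j (pd j f) x := fun i j =>
      (hp i).integrable_mul (hp j)
    have tot : ∫ x, (pd 0 (pd 0 f) x + pd 1 (pd 1 f) x + pd 2 (pd 2 f) x) ^ 2
        = ∫ x, ∑ i, ∑ j, pd i (pd i f) x * pd j (pd j f) x := by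
      congr 1; funext x
      simp only [Fin.sum_univ_three]; ring
    rw [tot, integral_finsetSum _ fun i _ => integrable_finsetSum _ fun j _ => m i j]
    simp only [fun i => integral_finsetSum Finset.univ fun j _ => m i j]
    simp only [Fin.sum_univ_three]
  have e : ∫ x, lap5 f x ^ 2
      = (∫ x, (pd 0 (pd 0 f) x + pd 1 (pd 1 f) x + pd 2 (pd 2 f) x) ^ 2)
        + 4 * (∫ x, (pd 0 (pd 0 f) x + pd 1 (pd 1 f) x) * kap f x)
        + 4 * (∫ x, pd 2 (pd 2 f) x * kap f x) + 4 * ∫ x, kap f x ^ 2 := by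
    have a1 := hl.memLp.integrable_sq
    have a2 := (hh.integrable_mul hk).const_mul 4
    have a3 := ((hp 2).integrable_mul hk).const_mul 4
    have a4 := hk.memLp.integrable_sq.const_mul 4
    rw [← integral_const_mul, ← integral_const_mul, ← integral_const_mul,
      ← integral_add_four a1 a2 a3 a4]
    congr 1; funext x; simp only [lap5]; ring
  rw [norm2_sq hf.lap5.memLp.1]
  simp only [Real.norm_eq_abs, sq_abs]
  rw [e, ZZ, X]
  have : 0 ≤ ∫ x, kap f x ^ 2 := integral_nonneg fun x => sq_nonneg _
  linarith

end

section

variable {f g h : E3 → ℝ} {v : Fin 3 → E3 → ℝ} {b c : E3 → ℝ}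

/-! ### Calculus of `∂ᵢ` and `r⁻¹ ∂_r` -/

/-- `f` is smooth and its partial derivative `∂ᵢ f` at `x` is `d`. -/
structure HasPd (i : Fin 3) (f : E3 → ℝ) (x : E3) (d : ℝ) : Prop where
  smooth : ContDiff ℝ ∞ f
  eq : pd i f x = d

/-- `f` is smooth and axisymmetric, and `r⁻¹ ∂_r f` at `x` is `d`. -/
structure HasKap (f : E3 → ℝ) (x : E3) (d : ℝ) : Prop where
  smooth : ContDiff ℝ ∞ f
  axi : Axi f
  eq : kap f x = d

section Rules

variable {i : Fin 3} {x : E3} {d e : ℝ}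

lemma hasPd (i : Fin 3) (hf : ContDiff ℝ ∞ f) (x : E3) : HasPd i f x (pd i f x) := ⟨hf, rfl⟩

lemma HasPd.add (hf : HasPd i f x d) (hg : HasPd i g x e) :
    HasPd i (fun y => f y + g y) x (d + e) :=
  ⟨hf.1.add hg.1, by
    rw [pd_add i (smooth_differentiable hf.1) (smooth_differentiable hg.1), hf.2, hg.2]⟩

lemma HasPd.sub (hf : HasPd i f x d) (hg : HasPd i g x e) :
    HasPd i (fun y => f y - g y) x (d - e) :=
  ⟨hf.1.sub hg.1, by
    rw [pd_sub i (smooth_differentiable hf.1) (smooth_differentiable hg.1), hf.2, hg.2]⟩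

lemma HasPd.mul (hf : HasPd i f x d) (hg : HasPd i g x e) :
    HasPd i (fun y => f y * g y) x (d * g x + f x * e) :=
  ⟨hf.1.mul hg.1, by
    rw [pd_mul i (smooth_differentiable hf.1) (smooth_differentiable hg.1), hf.2, hg.2]⟩

lemma HasPd.const_mul (hf : HasPd i f x d) (a : ℝ) :
    HasPd i (fun y => a * f y) x (a * d) :=
  ⟨contDiff_const.mul hf.1, by
    rw [pd_const_mul i a (smooth_differentiable hf.1), hf.2]⟩

lemma hasPd_coord (i j : Fin 3) (x : E3) : HasPd i (fun y => y j) x (if i = j then 1 else 0) :=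
  ⟨contDiff_coord j, pd_coord i j x⟩

lemma hasPd_radSq (i : Fin 3) (x : E3) :
    HasPd i (fun y => y 0 ^ 2 + y 1 ^ 2) x (if i = 2 then 0 else 2 * x i) :=
  ⟨smooth_radSq, pd_radSq i x⟩

lemma hasKap (hf : ContDiff ℝ ∞ f) (ha : Axi f) (x : E3) : HasKap f x (kap f x) := ⟨hf, ha, rfl⟩

lemma HasKap.add (hf : HasKap f x d) (hg : HasKap g x e) :
    HasKap (fun y => f y + g y) x (d + e) :=
  ⟨hf.1.add hg.1, hf.2.add hg.2 (smooth_differentiable hf.1) (smooth_differentiable hg.1), by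
    rw [kap_add hf.2 hg.2 hf.1 hg.1, hf.3, hg.3]⟩

lemma HasKap.sub (hf : HasKap f x d) (hg : HasKap g x e) :
    HasKap (fun y => f y - g y) x (d - e) :=
  ⟨hf.1.sub hg.1, hf.2.sub hg.2 (smooth_differentiable hf.1) (smooth_differentiable hg.1), by
    rw [kap_sub hf.2 hg.2 hf.1 hg.1, hf.3, hg.3]⟩

lemma HasKap.mul (hf : HasKap f x d) (hg : HasKap g x e) :
    HasKap (fun y => f y * g y) x (d * g x + f x * e) :=
  ⟨hf.1.mul hg.1, hf.2.mul hg.2 (smooth_differentiable hf.1) (smooth_differentiable hg.1), by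
    rw [kap_mul hf.2 hg.2 hf.1 hg.1, hf.3, hg.3]⟩

lemma HasKap.const_mul (hf : HasKap f x d) (a : ℝ) : HasKap (fun y => a * f y) x (a * d) :=
  ⟨contDiff_const.mul hf.1, hf.2.const_mul (smooth_differentiable hf.1) a, by
    rw [kap_const_mul a hf.2 hf.1, hf.3]⟩

lemma hasKap_radSq (x : E3) : HasKap (fun y => y 0 ^ 2 + y 1 ^ 2) x 2 := by
  have ha : Axi (fun y : E3 => y 0 ^ 2 + y 1 ^ 2) := fun y => by
    rw [pd_radSq, pd_radSq]; simp; ring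
  refine ⟨smooth_radSq, ha, kap_unique ha smooth_radSq continuous_const (fun y => ?_)
    (fun y => ?_) x⟩ <;> rw [pd_radSq] <;> simp <;> ring

end Rules

/-- The Laplacian as a sum of second partial derivatives. -/
def lapl (f : E3 → ℝ) (x : E3) : ℝ := pd 0 (pd 0 f) x + pd 1 (pd 1 f) x + pd 2 (pd 2 f) x

lemma SobInf.lapl (hf : SobInf f) : SobInf (lapl f) :=
  (((hf.pd 0).pd 0).add ((hf.pd 1).pd 1)).add ((hf.pd 2).pd 2)

lemma lapl_eq (ha : Axi f) (hf : ContDiff ℝ ∞ f) (x : E3) :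
    lapl f x = 2 * kap f x + (x 0 ^ 2 + x 1 ^ 2) * kap (kap f) x + pd 2 (pd 2 f) x := by
  rw [lapl, horizontal_laplacian_eq ha hf]

lemma lap5_eq (ha : Axi f) (hf : ContDiff ℝ ∞ f) (x : E3) :
    lap5 f x = 4 * kap f x + (x 0 ^ 2 + x 1 ^ 2) * kap (kap f) x + pd 2 (pd 2 f) x := by
  rw [lap5, horizontal_laplacian_eq ha hf]; ring

lemma kap_pd_two_two (ha : Axi f) (hf : ContDiff ℝ ∞ f) (x : E3) :
    kap (pd 2 (pd 2 f)) x = pd 2 (pd 2 (kap f)) x := by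
  rw [kap_pd_two (ha.pd_two hf) (contDiff_pd 2 hf), funext (kap_pd_two ha hf)]

/-- `r⁻¹ ∂_r` intertwines the Laplacian with `Δ + (2/r) ∂_r`. -/
lemma hasKap_lapl (ha : Axi f) (hf : ContDiff ℝ ∞ f) (x : E3) :
    HasKap (lapl f) x (lap5 (kap f) x) := by
  have hk := contDiff_kap hf
  have hkk := contDiff_kap hk
  have h3 := contDiff_pd 2 (contDiff_pd 2 hf)
  have a3 := (ha.pd_two hf).pd_two (contDiff_pd 2 hf)
  have ak := ha.kap hf
  have key := (((hasKap hk ak x).const_mul 2).add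
    ((hasKap_radSq x).mul (hasKap hkk (ak.kap hk) x))).add (hasKap h3 a3 x)
  rw [← funext (lapl_eq ha hf)] at key
  refine ⟨key.1, key.2, ?_⟩
  rw [key.3, lap5_eq ak hk, kap_pd_two_two ha hf]
  ring

lemma pd_two_lap5 (ha : Axi f) (hf : ContDiff ℝ ∞ f) (x : E3) :
    pd 2 (lap5 f) x = lap5 (pd 2 f) x := by
  have h : ∀ i, ContDiff ℝ ∞ (pd i (pd i f)) := fun i => contDiff_pd i (contDiff_pd i hf)
  have key := (((hasPd 2 (h 0) x).add (hasPd 2 (h 1) x)).add (hasPd 2 (h 2) x)).add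
    ((hasPd 2 (contDiff_kap hf) x).const_mul 2)
  have e : ∀ i, pd 2 (pd i (pd i f)) x = pd i (pd i (pd 2 f)) x := fun i => by
    rw [pd_comm 2 i (contDiff_pd i hf), funext (pd_comm 2 i hf)]
  refine key.2.trans ?_
  rw [e, e, e, ← kap_pd_two ha hf]; rfl

lemma lap5_sub (haf : Axi f) (hag : Axi g) (hf : ContDiff ℝ ∞ f) (hg : ContDiff ℝ ∞ g) (x : E3) :
    lap5 (fun y => f y - g y) x = lap5 f x - lap5 g x := by
  have e1 : ∀ i, pd i (fun y => f y - g y) = fun y => pd i f y - pd i g y := fun i =>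
    funext fun y => ((hasPd i hf y).sub (hasPd i hg y)).2
  have e2 : ∀ i, pd i (pd i (fun y => f y - g y)) x = pd i (pd i f) x - pd i (pd i g) x :=
    fun i => by
      rw [e1]; exact ((hasPd i (contDiff_pd i hf) x).sub (hasPd i (contDiff_pd i hg) x)).2
  simp only [lap5, e2, kap_sub haf hag hf hg]
  ring

/-! ### Axisymmetric vector fields -/

/-- `v` is the field `b (x₁, x₂, 0) + c (-x₂, x₁, 0) + v₃ (0, 0, 1)`, with axisymmetric
coefficients `b = vʳ/r`, `c = v^θ/r` and `v₃`, all smooth with square integrable derivatives. -/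
structure CylField (v : Fin 3 → E3 → ℝ) (b c : E3 → ℝ) : Prop where
  mem : ∀ i, SobInf (v i)
  mem_b : SobInf b
  mem_c : SobInf c
  axi_b : Axi b
  axi_c : Axi c
  axi_two : Axi (v 2)
  eq_zero : ∀ x, v 0 x = x 0 * b x - x 1 * c x
  eq_one : ∀ x, v 1 x = x 1 * b x + x 0 * c x

namespace CylField

lemma pd_two (hv : CylField v b c) :
    CylField (fun i => pd 2 (v i)) (pd 2 b) (pd 2 c) where
  mem i := (hv.mem i).pd 2
  mem_b := hv.mem_b.pd 2
  mem_c := hv.mem_c.pd 2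
  axi_b := hv.axi_b.pd_two hv.mem_b.1
  axi_c := hv.axi_c.pd_two hv.mem_c.1
  axi_two := hv.axi_two.pd_two (hv.mem 2).1
  eq_zero x := by
    rw [funext hv.eq_zero]
    refine (((hasPd_coord 2 0 x).mul (hasPd 2 hv.mem_b.1 x)).sub
      ((hasPd_coord 2 1 x).mul (hasPd 2 hv.mem_c.1 x))).2.trans ?_
    simp
  eq_one x := by
    rw [funext hv.eq_one]
    refine (((hasPd_coord 2 1 x).mul (hasPd 2 hv.mem_b.1 x)).add
      ((hasPd_coord 2 0 x).mul (hasPd 2 hv.mem_c.1 x))).2.trans ?_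
    simp

lemma adv_eq (hv : CylField v b c) (ha : Axi f) (hf : ContDiff ℝ ∞ f) (x : E3) :
    adv v f x = (x 0 ^ 2 + x 1 ^ 2) * b x * kap f x + v 2 x * pd 2 f x := by
  rw [adv, Fin.sum_univ_three, hv.eq_zero, hv.eq_one, pd_zero_eq ha hf, pd_one_eq ha hf]
  ring

lemma pd_horizontal (hv : CylField v b c) (i : Fin 3) (x : E3) :
    pd i (v 0) x = (if i = 0 then 1 else 0) * b x + x 0 * pd i b x
      - ((if i = 1 then 1 else 0) * c x + x 1 * pd i c x) ∧
    pd i (v 1) x = (if i = 1 then 1 else 0) * b x + x 1 * pd i b x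
      + ((if i = 0 then 1 else 0) * c x + x 0 * pd i c x) := by
  rw [funext hv.eq_zero, funext hv.eq_one]
  exact ⟨(((hasPd_coord i 0 x).mul (hasPd i hv.mem_b.1 x)).sub
      ((hasPd_coord i 1 x).mul (hasPd i hv.mem_c.1 x))).2,
    (((hasPd_coord i 1 x).mul (hasPd i hv.mem_b.1 x)).add
      ((hasPd_coord i 0 x).mul (hasPd i hv.mem_c.1 x))).2⟩

lemma div_eq (hv : CylField v b c) (hdiv : ∀ x, ∑ i, pd i (v i) x = 0) (x : E3) :
    2 * b x + (x 0 ^ 2 + x 1 ^ 2) * kap b x + pd 2 (v 2) x = 0 := by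
  have h := hdiv x
  rw [Fin.sum_univ_three, (hv.pd_horizontal 0 x).1, (hv.pd_horizontal 1 x).2,
    pd_zero_eq hv.axi_b hv.mem_b.1, pd_zero_eq hv.axi_c hv.mem_c.1,
    pd_one_eq hv.axi_b hv.mem_b.1, pd_one_eq hv.axi_c hv.mem_c.1] at h
  simp at h
  linear_combination h

lemma adv_horizontal (hv : CylField v b c) (x : E3) :
    adv v (v 0) x = x 0 * (adv v b x + b x ^ 2 - c x ^ 2) - x 1 * (adv v c x + 2 * b x * c x) ∧
    adv v (v 1) x = x 1 * (adv v b x + b x ^ 2 - c x ^ 2) + x 0 * (adv v c x + 2 * b x * c x) := by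
  have h0 := fun i => (hv.pd_horizontal i x).1
  have h1 := fun i => (hv.pd_horizontal i x).2
  simp only [adv, Fin.sum_univ_three, h0, h1]
  rw [hv.eq_zero, hv.eq_one]
  simp
  constructor <;> ring

lemma lapl_horizontal (hv : CylField v b c) (x : E3) :
    lapl (v 0) x = x 0 * lap5 b x - x 1 * lap5 c x ∧
    lapl (v 1) x = x 1 * lap5 b x + x 0 * lap5 c x := by
  have h0 := fun i => funext fun x => (hv.pd_horizontal i x).1
  have h1 := fun i => funext fun x => (hv.pd_horizontal i x).2
  have hb := hv.mem_b.1
  have hc := hv.mem_c.1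
  have e0 : ∀ i, pd i (pd i (v 0)) x = 2 * (if i = 0 then 1 else 0) * pd i b x
      + x 0 * pd i (pd i b) x
      - (2 * (if i = 1 then 1 else 0) * pd i c x + x 1 * pd i (pd i c) x) := fun i => by
    rw [h0 i]
    refine ((((hasPd i hb x).const_mul _).add
      ((hasPd_coord i 0 x).mul (hasPd i (contDiff_pd i hb) x))).sub
      (((hasPd i hc x).const_mul _).add
      ((hasPd_coord i 1 x).mul (hasPd i (contDiff_pd i hc) x)))).2.trans ?_
    ring
  have e1 : ∀ i, pd i (pd i (v 1)) x = 2 * (if i = 1 then 1 else 0) * pd i b x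
      + x 1 * pd i (pd i b) x
      + (2 * (if i = 0 then 1 else 0) * pd i c x + x 0 * pd i (pd i c) x) := fun i => by
    rw [h1 i]
    refine ((((hasPd i hb x).const_mul _).add
      ((hasPd_coord i 1 x).mul (hasPd i (contDiff_pd i hb) x))).add
      (((hasPd i hc x).const_mul _).add
      ((hasPd_coord i 0 x).mul (hasPd i (contDiff_pd i hc) x)))).2.trans ?_
    ring
  simp only [lapl, lap5, e0, e1]
  simp
  rw [pd_zero_eq hv.axi_b hb, pd_zero_eq hv.axi_c hc, pd_one_eq hv.axi_b hb,
    pd_one_eq hv.axi_c hc]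
  constructor <;> ring

/-- The quantity `ω^θ / r = ∂₃ (vʳ/r) - r⁻¹ ∂_r v₃`. -/
def gam (v : Fin 3 → E3 → ℝ) (b : E3 → ℝ) (x : E3) : ℝ := pd 2 b x - kap (v 2) x

lemma mem_gam (hv : CylField v b c) : SobInf (gam v b) := (hv.mem_b.pd 2).sub (hv.mem 2).kap

lemma axi_gam (hv : CylField v b c) : Axi (gam v b) :=
  (hv.axi_b.pd_two hv.mem_b.1).sub (hv.axi_two.kap (hv.mem 2).1) (hv.mem_b.pd 2).diff
    (hv.mem 2).kap.diff

lemma kap_pd_two_vertical (hv : CylField v b c) (hdiv : ∀ x, ∑ i, pd i (v i) x = 0) (x : E3) :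
    pd 2 (kap (v 2)) x = - (4 * kap b x + (x 0 ^ 2 + x 1 ^ 2) * kap (kap b) x) := by
  have hb := hv.mem_b.1
  have e : pd 2 (v 2) = fun x => (-1) * (2 * b x + (x 0 ^ 2 + x 1 ^ 2) * kap b x) := by
    funext y; linear_combination hv.div_eq hdiv y
  rw [← kap_pd_two hv.axi_two (hv.mem 2).1, e]
  refine ((((hasKap hb hv.axi_b x).const_mul 2).add ((hasKap_radSq x).mul
    (hasKap (contDiff_kap hb) (hv.axi_b.kap hb) x))).const_mul (-1)).3.trans ?_
  ring

/-- `(Δ + (2/r) ∂_r) (vʳ/r) = ∂₃ (ω^θ/r)`. -/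
lemma lap5_eq_pd_gam (hv : CylField v b c) (hdiv : ∀ x, ∑ i, pd i (v i) x = 0) (x : E3) :
    lap5 b x = pd 2 (gam v b) x := by
  have hb := hv.mem_b.1
  rw [lap5_eq hv.axi_b hb]
  refine Eq.trans ?_ ((hasPd 2 (contDiff_pd 2 hb) x).sub
    (hasPd 2 (contDiff_kap (hv.mem 2).1) x)).2.symm
  rw [hv.kap_pd_two_vertical hdiv]
  ring

/-- `Δ v₃ = - r⁻¹ ∂_r (r ω^θ)`. -/
lemma lapl_vertical (hv : CylField v b c) (hdiv : ∀ x, ∑ i, pd i (v i) x = 0) (x : E3) :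
    lapl (v 2) x = - (2 * gam v b x + (x 0 ^ 2 + x 1 ^ 2) * kap (gam v b) x) := by
  have hb := hv.mem_b.1
  have e : pd 2 (v 2) = fun x => (-1) * (2 * b x + (x 0 ^ 2 + x 1 ^ 2) * kap b x) := by
    funext y; linear_combination hv.div_eq hdiv y
  have e2 : pd 2 (pd 2 (v 2)) x = -(2 * pd 2 b x + (x 0 ^ 2 + x 1 ^ 2) * pd 2 (kap b) x) := by
    rw [e]
    refine ((((hasPd 2 hb x).const_mul 2).add ((hasPd_radSq 2 x).mul
      (hasPd 2 (contDiff_kap hb) x))).const_mul (-1)).2.trans ?_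
    simp
  have e3 : kap (gam v b) x = pd 2 (kap b) x - kap (kap (v 2)) x := by
    refine ((hasKap (contDiff_pd 2 hb) (hv.axi_b.pd_two hb) x).sub
      (hasKap (contDiff_kap (hv.mem 2).1) (hv.axi_two.kap (hv.mem 2).1) x)).3.trans ?_
    rw [kap_pd_two hv.axi_b hb]
  rw [lapl_eq hv.axi_two (hv.mem 2).1, e2, e3, gam]
  ring

/-- The nonlinear and viscous terms of the equation for `Γ = ω^θ/r`: taking
`∂₃ (·) - r⁻¹ ∂_r (·)` of the equations for `vʳ/r` and `v₃`. -/
lemma gam_equation (hv : CylField v b c) (hdiv : ∀ x, ∑ i, pd i (v i) x = 0) {P : E3 → ℝ}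
    (hP : ContDiff ℝ ∞ P) (haP : Axi P) (x : E3) :
    HasPd 2 (fun y => lap5 b y - kap P y - (adv v b y + (b y * b y - c y * c y))) x
      (pd 2 (fun y => lap5 b y - kap P y - (adv v b y + (b y * b y - c y * c y))) x) ∧
    HasKap (fun y => lapl (v 2) y - pd 2 P y - adv v (v 2) y) x
      (kap (fun y => lapl (v 2) y - pd 2 P y - adv v (v 2) y) x) ∧
    pd 2 (fun y => lap5 b y - kap P y - (adv v b y + (b y * b y - c y * c y))) x
      - kap (fun y => lapl (v 2) y - pd 2 P y - adv v (v 2) y) x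
      = lap5 (gam v b) x - adv v (gam v b) x + 2 * c x * pd 2 c x := by
  have hb := hv.mem_b.1
  have hc := hv.mem_c.1
  have hd := (hv.mem 2).1
  have ab := hv.axi_b
  have ad := hv.axi_two
  have hkb := contDiff_kap hb
  have hkd := contDiff_kap hd
  have h2b := contDiff_pd 2 hb
  have h2d := contDiff_pd 2 hd
  have l1 := (((hasPd 2 hv.mem_b.lap5.1 x).sub (hasPd 2 (contDiff_kap hP) x)).sub
    (((((hasPd_radSq 2 x).mul (hasPd 2 hb x)).mul (hasPd 2 hkb x)).add
      ((hasPd 2 hd x).mul (hasPd 2 h2b x))).add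
      (((hasPd 2 hb x).mul (hasPd 2 hb x)).sub ((hasPd 2 hc x).mul (hasPd 2 hc x)))))
  have l2 := ((hasKap_lapl ad hd x).sub
    (hasKap (contDiff_pd 2 hP) (haP.pd_two hP) x)).sub
    ((((hasKap_radSq x).mul (hasKap hb ab x)).mul (hasKap hkd (ad.kap hd) x)).add
      ((hasKap hd ad x).mul (hasKap h2d (ad.pd_two hd) x)))
  simp only [← hv.adv_eq ab hb, ← hv.adv_eq ad hd] at l1 l2
  refine ⟨hasPd 2 l1.1 x, hasKap l2.1 l2.2 x, ?_⟩
  rw [l1.2, l2.3]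
  have e3 : kap (gam v b) x = pd 2 (kap b) x - kap (kap (v 2)) x := by
    refine ((hasKap h2b (ab.pd_two hb) x).sub (hasKap hkd (ad.kap hd) x)).3.trans ?_
    rw [kap_pd_two ab hb]
  have e4 : pd 2 (gam v b) x = pd 2 (pd 2 b) x - pd 2 (kap (v 2)) x :=
    ((hasPd 2 h2b x).sub (hasPd 2 hkd x)).2
  have e5 : lap5 (gam v b) x = lap5 (pd 2 b) x - lap5 (kap (v 2)) x :=
    lap5_sub (ab.pd_two hb) (ad.kap hd) h2b hkd x
  have dv := hv.div_eq hdiv x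
  rw [hv.adv_eq hv.axi_gam hv.mem_gam.1, pd_two_lap5 ab hb, kap_pd_two haP hP, kap_pd_two ad hd,
    e3, e4, e5]
  simp
  linear_combination (-(pd 2 b x - kap (v 2) x)) * dv

end CylField

end

section

variable {f g h : E3 → ℝ} {v : Fin 3 → E3 → ℝ} {b c a : E3 → ℝ}

/-! ### Estimates of the individual terms -/

instance holderTriple_three_three : ENNReal.HolderTriple 3 3 (3 / 2) := ⟨by
  rw [ENNReal.inv_div (by simp) (by simp)]
  rw [← ENNReal.toReal_eq_toReal_iff' (by simp) (by finiteness),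
    ENNReal.toReal_add (by simp) (by simp)]
  simp; norm_num⟩

instance holderTriple_six_two : ENNReal.HolderTriple 6 2 (3 / 2) := ⟨by
  rw [ENNReal.inv_div (by simp) (by simp)]
  rw [← ENNReal.toReal_eq_toReal_iff' (by simp) (by finiteness),
    ENNReal.toReal_add (by simp) (by simp)]
  simp; norm_num⟩

instance holderTriple_three_threeHalves : ENNReal.HolderTriple 3 (3 / 2) 1 := ⟨by
  rw [ENNReal.inv_div (by simp) (by simp)]
  rw [← ENNReal.toReal_eq_toReal_iff' (by finiteness) (by simp),
    ENNReal.toReal_add (by simp) (by finiteness)]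
  simp; norm_num⟩

lemma norm_gradient_sq_of_axi (ha : Axi f) (hf : ContDiff ℝ ∞ f) (x : E3) :
    ‖∇ f x‖ ^ 2 = (rad x * kap f x) ^ 2 + pd 2 f x ^ 2 := by
  rw [norm_gradient_sq, pd_zero_eq ha hf, pd_one_eq ha hf, mul_pow (rad x), rad_sq]; ring

lemma abs_rad_mul_kap_le (ha : Axi f) (hf : ContDiff ℝ ∞ f) (x : E3) :
    |rad x * kap f x| ≤ ‖∇ f x‖ := by
  refine abs_le_of_sq_le_sq ?_ (norm_nonneg _)
  rw [norm_gradient_sq_of_axi ha hf]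
  nlinarith [sq_nonneg (pd 2 f x)]

lemma continuous_rad_mul (hf : Continuous f) : Continuous fun x => rad x * f x :=
  continuous_rad.mul hf

lemma memLp_rad_mul_kap (ha : Axi f) (hf : SobInf f) :
    MemLp (fun x => rad x * kap f x) 2 volume :=
  hf.memLp_gradient.of_le (continuous_rad_mul hf.kap.cont).aestronglyMeasurable
    (Eventually.of_forall fun x => abs_rad_mul_kap_le ha hf.1 x)

lemma norm2_rad_mul_kap_le (ha : Axi f) (hf : SobInf f) :
    norm2 (fun x => rad x * kap f x) ≤ norm2 (∇ f) :=
  norm2_le_of_ae_le (continuous_rad_mul hf.kap.cont).aestronglyMeasurable hf.memLp_gradient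
    (Eventually.of_forall fun x => abs_rad_mul_kap_le ha hf.1 x)

lemma norm2_pd_le (hf : SobInf f) (i : Fin 3) : norm2 (pd i f) ≤ norm2 (∇ f) :=
  norm2_le_of_ae_le (hf.pd i).cont.aestronglyMeasurable hf.memLp_gradient
    (Eventually.of_forall fun x => abs_pd_le_norm_gradient i f x)

/-- `‖∇f‖₆ ≤ C ‖(Δ + (2/r) ∂_r) f‖₂`. -/
lemma lpNorm_gradient_six_le (hf : SobInf f) (ha : Axi f) :
    MemLp (fun x => ‖∇ f x‖) 6 volume ∧
      lpNorm (fun x => ‖∇ f x‖) 6 volume ≤ 3 * sobC * norm2 (lap5 f) := by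
  have h6 : ∀ i, MemLp (fun x => |pd i f x|) 6 volume := fun i => (hf.pd i).memLp_six.abs
  have hs : MemLp (fun x => |pd 0 f x| + |pd 1 f x| + |pd 2 f x|) 6 volume :=
    ((h6 0).add (h6 1)).add (h6 2)
  have hle : ∀ x, ‖‖∇ f x‖‖ ≤ |pd 0 f x| + |pd 1 f x| + |pd 2 f x| := fun x => by
    rw [norm_norm]
    refine abs_le_of_sq_le_sq' ?_ (by positivity) |>.2
    rw [norm_gradient_sq]
    nlinarith [abs_nonneg (pd 0 f x), abs_nonneg (pd 1 f x), abs_nonneg (pd 2 f x),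
      sq_abs (pd 0 f x), sq_abs (pd 1 f x), sq_abs (pd 2 f x),
      mul_nonneg (abs_nonneg (pd 0 f x)) (abs_nonneg (pd 1 f x)),
      mul_nonneg (abs_nonneg (pd 0 f x)) (abs_nonneg (pd 2 f x)),
      mul_nonneg (abs_nonneg (pd 1 f x)) (abs_nonneg (pd 2 f x))]
  refine ⟨hs.mono' (continuous_gradient hf.1).norm.aestronglyMeasurable
    (Eventually.of_forall hle), (lpNorm_mono_real hs hle).trans ?_⟩
  have hsum := sum_norm2_gradient_pd_le hf ha
  have bd : ∀ i, lpNorm (fun x => |pd i f x|) 6 volume ≤ sobC * norm2 (lap5 f) := fun i => by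
    rw [lpNorm_fun_abs (hf.pd i).cont.aestronglyMeasurable]
    refine (hf.pd i).lpNorm_six_le.trans (mul_le_mul_of_nonneg_left ?_ sobC_pos.le)
    refine abs_le_of_sq_le_sq' ?_ (norm2_nonneg _) |>.2
    refine le_trans ?_ hsum
    fin_cases i <;> simp <;> nlinarith [sq_nonneg (norm2 (∇ (pd 0 f))),
      sq_nonneg (norm2 (∇ (pd 1 f))), sq_nonneg (norm2 (∇ (pd 2 f)))]
  have t1 : lpNorm (fun x => |pd 0 f x| + |pd 1 f x| + |pd 2 f x|) 6 volume
      ≤ lpNorm (fun x => |pd 0 f x| + |pd 1 f x|) 6 volume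
        + lpNorm (fun x => |pd 2 f x|) 6 volume :=
    lpNorm_add_le ((h6 0).add (h6 1)) (by norm_num)
  have t2 : lpNorm (fun x => |pd 0 f x| + |pd 1 f x|) 6 volume
      ≤ lpNorm (fun x => |pd 0 f x|) 6 volume + lpNorm (fun x => |pd 1 f x|) 6 volume :=
    lpNorm_add_le (h6 0) (by norm_num)
  linarith [bd 0, bd 1, bd 2]

/-- The term `∫ (u^θ/r) f g`, by the Hardy–Sobolev inequality. -/
lemma integral_mul_mul_le_hardy (hf : SobInf f) (hg : SobInf g)
    (hc : MemLp (fun x => rad x * c x) 3 volume) :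
    |∫ x, c x * f x * g x| ≤ hardyC ^ 2 * lpNorm (fun x => rad x * c x) 3 volume
      * norm2 (∇ f) * norm2 (∇ g) := by
  have hol := (integral_abs_mul_le (s := 3 / 2) hc hf.memLp_div_sqrt hg.memLp_div_sqrt).2
  have e : ∫ x, |c x * f x * g x|
      = ∫ x, |rad x * c x * (f x / √(rad x) * (g x / √(rad x)))| := by
    refine integral_congr_ae ?_
    filter_upwards [ae_rad_ne_zero] with x hx
    have hr : 0 < rad x := (rad_nonneg x).lt_of_ne' hx
    have h1 : f x / √(rad x) * (g x / √(rad x)) = f x * g x / rad x := by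
      rw [div_mul_div_comm, Real.mul_self_sqrt hr.le]
    rw [h1]
    congr 1
    field_simp
  have hh := hardyC_pos
  have l0 : 0 ≤ lpNorm (fun x => rad x * c x) 3 volume := lpNorm_nonneg
  have l1 : 0 ≤ lpNorm (fun x => g x / √(rad x)) 3 volume := lpNorm_nonneg
  have n1 := norm2_nonneg (∇ f)
  calc |∫ x, c x * f x * g x| ≤ ∫ x, |c x * f x * g x| := abs_integral_le_integral_abs
    _ ≤ _ := e.trans_le hol
    _ ≤ lpNorm (fun x => rad x * c x) 3 volume
        * ((hardyC * norm2 (∇ f)) * (hardyC * norm2 (∇ g))) := by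
        exact mul_le_mul_of_nonneg_left (mul_le_mul hf.lpNorm_div_sqrt_le hg.lpNorm_div_sqrt_le
          l1 (by positivity)) l0
    _ = _ := by ring

/-- The vortex stretching term, after integration by parts. The factor `r²` of the Jacobian of
`(f, g)` is split between `c`, which becomes `u^θ ∈ L³`, and `∂_r g = r kap g`. -/
lemma integral_stretching_le (hf : SobInf f) (haf : Axi f) (hg : SobInf g) (hag : Axi g)
    (hc : MemLp (fun x => rad x * c x) 3 volume) :
    |∫ x, c x * ((x 0 ^ 2 + x 1 ^ 2) * (pd 2 f x * kap g x - kap f x * pd 2 g x))|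
      ≤ 3 * sobC * lpNorm (fun x => rad x * c x) 3 volume * norm2 (lap5 f) * norm2 (∇ g) := by
  obtain ⟨m6, l6⟩ := lpNorm_gradient_six_le hf haf
  have hG := hg.memLp_gradient
  obtain ⟨hi, hol⟩ := integral_abs_mul_le (s := 3 / 2) hc m6 hG.norm
  have l0 : 0 ≤ lpNorm (fun x => rad x * c x) 3 volume := lpNorm_nonneg
  have e2 : lpNorm (fun x => ‖∇ g x‖) 2 volume = norm2 (∇ g) := lpNorm_norm hG.1 2
  have n1 := norm2_nonneg (∇ g)
  rw [← Real.norm_eq_abs]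
  calc _ ≤ ∫ x, |rad x * c x * (‖∇ f x‖ * ‖∇ g x‖)| := by
        refine norm_integral_le_of_norm_le hi.abs (Eventually.of_forall fun x => ?_)
        have e : c x * ((x 0 ^ 2 + x 1 ^ 2) * (pd 2 f x * kap g x - kap f x * pd 2 g x))
            = rad x * c x * (pd 2 f x * (rad x * kap g x) - (rad x * kap f x) * pd 2 g x) := by
          rw [← rad_sq]; ring
        rw [e, Real.norm_eq_abs, abs_mul, abs_mul (rad x * c x)]
        refine mul_le_mul_of_nonneg_left ?_ (abs_nonneg _)
        refine sq_le_sq.1 ?_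
        rw [mul_pow, norm_gradient_sq_of_axi haf hf.1, norm_gradient_sq_of_axi hag hg.1]
        nlinarith [sq_nonneg ((rad x * kap f x) * (rad x * kap g x) + pd 2 f x * pd 2 g x)]
    _ ≤ _ := hol
    _ ≤ lpNorm (fun x => rad x * c x) 3 volume * ((3 * sobC * norm2 (lap5 f)) * norm2 (∇ g)) := by
        rw [e2]; gcongr
    _ = _ := by ring

/-- What is needed of `a = 1/ρ - 1`: smoothness, axisymmetry, and vanishing on the axis. The
constant `B` is a bound for `a`, its first derivatives, `r⁻¹ ∂_r a` and `a / r²`; it serves only to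
justify integrations by parts. The constant `M` is a bound for `|a| / r` and enters the
estimates. -/
structure AxisCoeff (a : E3 → ℝ) (B M : ℝ) : Prop where
  smooth : ContDiff ℝ ∞ a
  axi : Axi a
  bdd : ∀ x, |a x| ≤ B
  bdd_pd : ∀ i x, |pd i a x| ≤ B
  bdd_kap : ∀ x, |kap a x| ≤ B
  le_radSq : ∀ x, |a x| ≤ B * (x 0 ^ 2 + x 1 ^ 2)
  nonneg : 0 ≤ M
  le_rad : ∀ x, |a x| ≤ M * rad x

namespace AxisCoeff

variable {B M : ℝ}

lemma abs_integral_le (ha : AxisCoeff a B M) (hf : MemLp f 2 volume)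
    (hg : MemLp (fun x => rad x * g x) 2 volume) :
    |∫ x, f x * (a x * g x)| ≤ M * norm2 (fun x => rad x * g x) * norm2 f := by
  have hi : Integrable fun x => f x * (rad x * g x) := hf.integrable_mul hg
  rw [← Real.norm_eq_abs]
  calc _ ≤ ∫ x, M * |f x * (rad x * g x)| := by
        refine norm_integral_le_of_norm_le (hi.abs.const_mul M) (Eventually.of_forall fun x => ?_)
        rw [Real.norm_eq_abs, abs_mul, abs_mul, abs_mul, abs_mul, abs_of_nonneg (rad_nonneg x)]
        calc |f x| * (|a x| * |g x|) ≤ |f x| * ((M * rad x) * |g x|) := by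
              gcongr; exact ha.le_rad x
          _ = _ := by ring
    _ = M * ∫ x, |f x * (rad x * g x)| := integral_const_mul _ _
    _ ≤ M * (norm2 f * norm2 (fun x => rad x * g x)) :=
        mul_le_mul_of_nonneg_left (integral_abs_mul_le_norm2 hf hg) ha.nonneg
    _ = _ := by ring

lemma memLp_mul (ha : AxisCoeff a B M) (hf : SobInf f) : MemLp (fun x => a x * f x) 2 volume :=
  hf.memLp.of_le_mul (c := B) (ha.smooth.continuous.mul hf.cont).aestronglyMeasurable
    (Eventually.of_forall fun x => by
      rw [norm_mul]; exact mul_le_mul_of_nonneg_right (ha.bdd x) (norm_nonneg _))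

lemma memLp_pd_mul (ha : AxisCoeff a B M) (hf : SobInf f) (i : Fin 3) :
    MemLp (fun x => pd i (fun y => a y * f y) x) 2 volume := by
  have h1 : MemLp (fun x => pd i a x * f x) 2 volume :=
    hf.memLp.of_le_mul (c := B)
      ((contDiff_pd i ha.smooth).continuous.mul hf.cont).aestronglyMeasurable
      (Eventually.of_forall fun x => by
        rw [norm_mul]; exact mul_le_mul_of_nonneg_right (ha.bdd_pd i x) (norm_nonneg _))
  refine (h1.add (ha.memLp_mul (hf.pd i))).ae_eq (Eventually.of_forall fun x => ?_)
  exact (pd_mul i (smooth_differentiable ha.smooth) hf.diff x).symm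

lemma memLp_kap_mul (ha : AxisCoeff a B M) (hf : SobInf f) (haf : Axi f) :
    MemLp (fun x => kap (fun y => a y * f y) x) 2 volume := by
  have h1 : MemLp (fun x => kap a x * f x) 2 volume :=
    hf.memLp.of_le_mul (c := B)
      ((contDiff_kap ha.smooth).continuous.mul hf.cont).aestronglyMeasurable
      (Eventually.of_forall fun x => by
        rw [norm_mul]; exact mul_le_mul_of_nonneg_right (ha.bdd_kap x) (norm_nonneg _))
  refine (h1.add (ha.memLp_mul hf.kap)).ae_eq (Eventually.of_forall fun x => ?_)
  exact (kap_mul ha.axi haf ha.smooth hf.1 x).symm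

lemma integral_mul_pd_mul (ha : AxisCoeff a B M) (hf : SobInf f) (hg : SobInf g) (i : Fin 3) :
    ∫ x, f x * pd i (fun y => a y * g y) x = - ∫ x, pd i f x * (a x * g x) :=
  integral_mul_pd i hf.diff (smooth_differentiable (ha.smooth.mul hg.1))
    ((hf.pd i).memLp.integrable_mul (ha.memLp_mul hg))
    (hf.memLp.integrable_mul (ha.memLp_pd_mul hg i))
    (hf.memLp.integrable_mul (ha.memLp_mul hg))

/-- Integration by parts for `r⁻¹ ∂_r`. The boundary term on the axis vanishes with `a`. -/
lemma integral_mul_kap_mul (ha : AxisCoeff a B M) (hf : SobInf f) (haf : Axi f)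
    (hg : SobInf g) (hag : Axi g) :
    ∫ x, f x * kap (fun y => a y * g y) x = - ∫ x, g x * (a x * kap f x) := by
  have da := smooth_differentiable ha.smooth
  have sag := ha.smooth.mul hg.1
  have aag := ha.axi.mul hag da hg.diff
  have sh := hf.1.mul sag
  have ah := haf.mul aag hf.diff (smooth_differentiable sag)
  have i1 : Integrable fun x => f x * kap (fun y => a y * g y) x :=
    hf.memLp.integrable_mul (ha.memLp_kap_mul hg hag)
  have i2 : Integrable fun x => g x * (a x * kap f x) :=
    hg.memLp.integrable_mul (ha.memLp_mul hf.kap)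
  have hi : ∀ i, Integrable (pd i fun x => f x * (a x * g x)) := fun i => by
    have := ((hf.pd i).memLp.integrable_mul (ha.memLp_mul hg)).add
      (hf.memLp.integrable_mul (ha.memLp_pd_mul hg i))
    exact this.congr (Eventually.of_forall fun x =>
      (pd_mul i hf.diff (smooth_differentiable sag) x).symm)
  have key := integral_radial_deriv_eq_zero (g := fun x => f x * (a x * g x))
    (h := fun x => f x * kap (fun y => a y * g y) x + g x * (a x * kap f x))
    (m := fun x => B * |f x * g x|)
    (smooth_differentiable sh) (hf.memLp.integrable_mul (ha.memLp_mul hg)) (hi 0) (hi 1)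
    (i1.add i2) (fun x => ?_) ((hf.integrable_mul hg).abs.const_mul B) (fun x => ?_)
  · rw [integral_add i1 i2] at key
    linarith
  · rw [pd_zero_eq ah sh, pd_one_eq ah sh, kap_mul haf aag hf.1 sag]
    ring
  · rw [show f x * (a x * g x) = a x * (f x * g x) by ring, abs_mul]
    have := mul_le_mul_of_nonneg_right (ha.le_radSq x) (abs_nonneg (f x * g x))
    linarith

end AxisCoeff

/-! ### Energy inequalities for the two vorticity quotients -/

namespace CylField

variable {B M : ℝ}

/-- The energy inequality for `∂₃ c = -ω^r/r`, where `γ` stands for the time derivative of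
`c = v^θ/r`. The equation of `c` is tested with `∂₃² c` rather than differentiated, so no derivative
falls on `a`. -/
lemma energy_swirl (hv : CylField v b c) (hdiv : ∀ x, ∑ i, pd i (v i) x = 0)
    (ha : AxisCoeff a B M) {γ : E3 → ℝ} (hγ : SobInf γ)
    (eγ : ∀ x, γ x = lap5 c x - (adv v c x + 2 * b x * c x) + a x * lap5 c x)
    (hc3 : MemLp (fun x => rad x * c x) 3 volume)
    (hl : MemLp (fun x => rad x * lap5 c x) 2 volume) :
    (∫ x, pd 2 c x * pd 2 γ x) + norm2 (∇ (pd 2 c)) ^ 2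
      ≤ M * norm2 (fun x => rad x * lap5 c x) * norm2 (∇ (pd 2 c))
        + 3 * sobC * lpNorm (fun x => rad x * c x) 3 volume * norm2 (∇ (gam v b))
          * norm2 (∇ (pd 2 c)) := by
  have hc := hv.mem_c
  have h2 := hc.pd 2
  have h22 := h2.pd 2
  have a2 := hv.axi_c.pd_two hc.1
  have m1 := memLp_adv hv.mem hc
  have m2 := hv.mem_b.memLp_mul hc
  have m4 := ha.memLp_mul hc.lap5
  have i1 : Integrable fun x => pd 2 (pd 2 c) x * adv v c x := h22.memLp.integrable_mul m1
  have i2 : Integrable fun x => pd 2 (pd 2 c) x * (b x * c x) := h22.memLp.integrable_mul m2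
  have i3 : Integrable fun x => pd 2 (pd 2 c) x * lap5 c x := h22.integrable_mul hc.lap5
  have i4 : Integrable fun x => pd 2 (pd 2 c) x * (a x * lap5 c x) := h22.memLp.integrable_mul m4
  have i5 : Integrable fun x => c x * adv (fun i => pd 2 (v i)) (pd 2 c) x :=
    hc.memLp.integrable_mul (memLp_adv (fun i => (hv.mem i).pd 2) h2)
  -- the identity obtained by testing the equation of `c` with `∂₃² c`
  have main : ∫ x, pd 2 c x * pd 2 γ x
      = (∫ x, c x * ((x 0 ^ 2 + x 1 ^ 2)
            * (pd 2 b x * kap (pd 2 c) x - kap b x * pd 2 (pd 2 c) x)))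
        + (∫ x, pd 2 c x * lap5 (pd 2 c) x) - ∫ x, pd 2 (pd 2 c) x * (a x * lap5 c x) := by
    have e3 : ∫ x, pd 2 c x * lap5 (pd 2 c) x = - ∫ x, pd 2 (pd 2 c) x * lap5 c x := by
      rw [← h2.integral_mul_pd hc.lap5 2]
      congr 1; funext x; rw [pd_two_lap5 hv.axi_c hc.1]
    have e0 : ∫ x, pd 2 (pd 2 c) x * γ x
        = (∫ x, pd 2 (pd 2 c) x * lap5 c x) + (-1) * (∫ x, pd 2 (pd 2 c) x * adv v c x)
          + (-2) * (∫ x, pd 2 (pd 2 c) x * (b x * c x))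
          + ∫ x, pd 2 (pd 2 c) x * (a x * lap5 c x) := by
      rw [← integral_const_mul, ← integral_const_mul,
        ← integral_add_four i3 (i1.const_mul _) (i2.const_mul _) i4]
      congr 1; funext x; rw [eγ]; ring
    have e5 : ∫ x, c x * ((x 0 ^ 2 + x 1 ^ 2)
            * (pd 2 b x * kap (pd 2 c) x - kap b x * pd 2 (pd 2 c) x))
        = (∫ x, c x * adv (fun i => pd 2 (v i)) (pd 2 c) x)
          + 2 * ∫ x, pd 2 (pd 2 c) x * (b x * c x) := by
      rw [← integral_const_mul, ← integral_add i5 (i2.const_mul 2)]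
      congr 1; funext x
      rw [hv.pd_two.adv_eq a2 h2.1]
      linear_combination (- c x * pd 2 (pd 2 c) x) * hv.div_eq hdiv x
    rw [h2.integral_mul_pd hγ 2, e0, e3, e5, integral_pd_two_mul_adv hv.mem hdiv hc]
    ring
  have s1 := integral_stretching_le hv.mem_b hv.axi_b h2 a2 hc3
  have s2 := integral_mul_lap5_le h2 a2
  have s3 := ha.abs_integral_le h22.memLp hl
  have s4 : norm2 (lap5 b) ≤ norm2 (∇ (gam v b)) := by
    rw [funext (hv.lap5_eq_pd_gam hdiv)]; exact norm2_pd_le hv.mem_gam 2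
  have s5 := norm2_pd_le h2 2
  have p1 : 3 * sobC * lpNorm (fun x => rad x * c x) 3 volume * norm2 (lap5 b)
        * norm2 (∇ (pd 2 c))
      ≤ 3 * sobC * lpNorm (fun x => rad x * c x) 3 volume * norm2 (∇ (gam v b))
        * norm2 (∇ (pd 2 c)) := by
    have := sobC_pos
    have := norm2_nonneg (∇ (pd 2 c))
    have : 0 ≤ lpNorm (fun x => rad x * c x) 3 volume := lpNorm_nonneg
    gcongr
  have p2 : M * norm2 (fun x => rad x * lap5 c x) * norm2 (pd 2 (pd 2 c))
      ≤ M * norm2 (fun x => rad x * lap5 c x) * norm2 (∇ (pd 2 c)) :=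
    mul_le_mul_of_nonneg_left s5 (mul_nonneg ha.nonneg (norm2_nonneg _))
  rw [main]
  linarith [le_abs_self (∫ x, c x * ((x 0 ^ 2 + x 1 ^ 2)
    * (pd 2 b x * kap (pd 2 c) x - kap b x * pd 2 (pd 2 c) x))),
    neg_abs_le (∫ x, pd 2 (pd 2 c) x * (a x * lap5 c x))]

/-- The energy inequality for `Γ = ω^θ/r`, where `β` and `δ` stand for the time derivatives of
`b = vʳ/r` and of `v₃`. The derivatives of the terms with `a` are moved onto `Γ`. -/
lemma energy_gam (hv : CylField v b c) (hdiv : ∀ x, ∑ i, pd i (v i) x = 0)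
    (ha : AxisCoeff a B M) {P β δ : E3 → ℝ} (hP : ContDiff ℝ ∞ P) (haP : Axi P)
    (hP2 : ∀ i, SobInf (pd i P))
    (eβ : ∀ x, β x = lap5 b x - kap P x - (adv v b x + (b x * b x - c x * c x))
      + a x * (lap5 b x - kap P x))
    (eδ : ∀ x, δ x = lapl (v 2) x - pd 2 P x - adv v (v 2) x
      + a x * (lapl (v 2) x - pd 2 P x))
    (hc3 : MemLp (fun x => rad x * c x) 3 volume)
    (hl : MemLp (fun x => rad x * (lap5 b x - kap P x)) 2 volume) :
    (∫ x, gam v b x * (pd 2 β x - kap δ x)) + norm2 (∇ (gam v b)) ^ 2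
      ≤ M * (norm2 (fun x => rad x * (lap5 b x - kap P x))
          + norm2 (fun x => lapl (v 2) x - pd 2 P x)) * norm2 (∇ (gam v b))
        + 2 * hardyC ^ 2 * lpNorm (fun x => rad x * c x) 3 volume * norm2 (∇ (gam v b))
          * norm2 (∇ (pd 2 c)) := by
  have hΓ := hv.mem_gam
  have aΓ := hv.axi_gam
  have h2 := hv.mem_c.pd 2
  have hkP : SobInf (kap P) := (((hP2 0).pd 0).add ((hP2 1).pd 1)).avg le_rfl
  have hgb : SobInf (fun x => lap5 b x - kap P x) := hv.mem_b.lap5.sub hkP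
  have hG : SobInf (fun x => lapl (v 2) x - pd 2 P x) := (hv.mem 2).lapl.sub (hP2 2)
  have aG : Axi (fun x => lapl (v 2) x - pd 2 P x) :=
    (hasKap_lapl hv.axi_two (hv.mem 2).1 0).2.sub (haP.pd_two hP) (hv.mem 2).lapl.diff
      (hP2 2).diff
  -- the pointwise equation for `Γ`
  have eq : ∀ x, pd 2 β x - kap δ x = lap5 (gam v b) x - adv v (gam v b) x + 2 * c x * pd 2 c x
      + pd 2 (fun y => a y * (lap5 b y - kap P y)) x
      - kap (fun y => a y * (lapl (v 2) y - pd 2 P y)) x := by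
    intro x
    obtain ⟨k1, k2, k3⟩ := hv.gam_equation hdiv hP haP x
    have m1 := (k1.add (hasPd 2 (ha.smooth.mul hgb.1) x)).2
    have m2 := (k2.add (hasKap (ha.smooth.mul hG.1)
      (ha.axi.mul aG (smooth_differentiable ha.smooth) hG.diff) x)).3
    rw [funext eβ, funext eδ, m1, m2]
    linear_combination k3
  have i1 : Integrable fun x => gam v b x * lap5 (gam v b) x := hΓ.integrable_mul hΓ.lap5
  have i2 : Integrable fun x => gam v b x * adv v (gam v b) x :=
    hΓ.memLp.integrable_mul (memLp_adv hv.mem hΓ)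
  have i3 : Integrable fun x => c x * gam v b x * pd 2 c x :=
    hv.mem_c.integrable_mul_mul hΓ h2
  have i4 : Integrable fun x => gam v b x * pd 2 (fun y => a y * (lap5 b y - kap P y)) x :=
    hΓ.memLp.integrable_mul (ha.memLp_pd_mul hgb 2)
  have i5 : Integrable fun x => gam v b x * kap (fun y => a y * (lapl (v 2) y - pd 2 P y)) x :=
    hΓ.memLp.integrable_mul (ha.memLp_kap_mul hG aG)
  have i45 : Integrable fun x => gam v b x * pd 2 (fun y => a y * (lap5 b y - kap P y)) x
      - gam v b x * kap (fun y => a y * (lapl (v 2) y - pd 2 P y)) x := i4.sub i5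
  have main : ∫ x, gam v b x * (pd 2 β x - kap δ x)
      = (∫ x, gam v b x * lap5 (gam v b) x) + (-1) * (∫ x, gam v b x * adv v (gam v b) x)
        + 2 * (∫ x, c x * gam v b x * pd 2 c x)
        + ((∫ x, gam v b x * pd 2 (fun y => a y * (lap5 b y - kap P y)) x)
          - ∫ x, gam v b x * kap (fun y => a y * (lapl (v 2) y - pd 2 P y)) x) := by
    rw [← integral_const_mul, ← integral_const_mul, ← integral_sub i4 i5,
      ← integral_add_four i1 (i2.const_mul _) (i3.const_mul _) i45]
    congr 1; funext x; rw [eq]; ring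
  rw [integral_mul_adv_self hv.mem hdiv hΓ, ha.integral_mul_pd_mul hΓ hgb 2,
    ha.integral_mul_kap_mul hΓ aΓ hG aG] at main
  have s1 := integral_mul_lap5_le hΓ aΓ
  have s2 := integral_mul_mul_le_hardy hΓ h2 hc3
  have s3 := ha.abs_integral_le (hΓ.pd 2).memLp hl
  have s4 := ha.abs_integral_le hG.memLp (memLp_rad_mul_kap aΓ hΓ)
  have p3 : M * norm2 (fun x => rad x * (lap5 b x - kap P x)) * norm2 (pd 2 (gam v b))
      ≤ M * norm2 (fun x => rad x * (lap5 b x - kap P x)) * norm2 (∇ (gam v b)) :=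
    mul_le_mul_of_nonneg_left (norm2_pd_le hΓ 2) (mul_nonneg ha.nonneg (norm2_nonneg _))
  have p4 : M * norm2 (fun x => rad x * kap (gam v b) x)
        * norm2 (fun x => lapl (v 2) x - pd 2 P x)
      ≤ M * norm2 (∇ (gam v b)) * norm2 (fun x => lapl (v 2) x - pd 2 P x) :=
    mul_le_mul_of_nonneg_right (mul_le_mul_of_nonneg_left (norm2_rad_mul_kap_le aΓ hΓ) ha.nonneg)
      (norm2_nonneg _)
  rw [main]
  linarith [le_abs_self (∫ x, c x * gam v b x * pd 2 c x),
    neg_abs_le (∫ x, pd 2 (gam v b) x * (a x * (lap5 b x - kap P x))),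
    le_abs_self (∫ x, (lapl (v 2) x - pd 2 P x) * (a x * kap (gam v b) x))]

end CylField

end

section

variable {f g h : E3 → ℝ} {v : E3 → E3} {b c a : E3 → ℝ}

/-! ### Axisymmetric functions and fields -/

lemma coord_eq_zero_of_rad_eq_zero {x : E3} (hx : rad x = 0) : x 0 = 0 ∧ x 1 = 0 := by
  have h := rad_sq x
  rw [hx] at h
  constructor <;> nlinarith [sq_nonneg (x 0), sq_nonneg (x 1)]

/-- Differentiating along the rotations about the axis. -/
lemma AxisymmetricScalar.axi (hax : AxisymmetricScalar f) (hf : Differentiable ℝ f) :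
    Axi f := by
  intro x
  set φ : ℝ → E3 := fun θ => x + (x 0 * (Real.cos θ - 1) - x 1 * Real.sin θ) • ee 0
    + (x 0 * Real.sin θ + x 1 * (Real.cos θ - 1)) • ee 1 with hφ
  have hd : HasDerivAt φ ((-x 1) • ee 0 + (x 0) • ee 1) 0 := by
    have hc : HasDerivAt (fun θ => Real.cos θ - 1) 0 0 := by
      simpa using (Real.hasDerivAt_cos 0).sub_const 1
    have hs : HasDerivAt Real.sin 1 0 := by simpa using Real.hasDerivAt_sin 0
    have h0 := (((hc.const_mul (x 0)).sub (hs.const_mul (x 1))).smul_const (ee 0)).const_add x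
    have h1 := ((hs.const_mul (x 0)).add (hc.const_mul (x 1))).smul_const (ee 1)
    refine (h0.add h1).congr_deriv ?_
    simp
  have hφ0 : φ 0 = x := by simp [hφ]
  have hcst : (fun θ => f (φ θ)) = fun _ => f x := by
    funext θ
    refine hax _ _ ?_ (by simp [hφ])
    unfold rad
    congr 1
    simp [hφ]
    linear_combination (x 0 ^ 2 + x 1 ^ 2) * Real.sin_sq_add_cos_sq θ
  have hcomp := (hf (φ 0)).hasFDerivAt.comp_hasDerivAt 0 hd
  have e := hcomp.unique (by
    rw [show f ∘ φ = fun _ => f x from hcst]; exact hasDerivAt_const 0 (f x))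
  rw [hφ0] at e
  simp only [map_add, map_smul, smul_eq_mul] at e
  simp only [pd]
  linear_combination e

lemma inner_eR (v : E3 → E3) (x : E3) : compR v x = (x 0 * v x 0 + x 1 * v x 1) / rad x := by
  simp [compR, eR, PiLp.inner_apply, Fin.sum_univ_three]
  ring

lemma inner_eTheta (v : E3 → E3) (x : E3) :
    compTheta v x = (x 0 * v x 1 - x 1 * v x 0) / rad x := by
  simp [compTheta, eTheta, PiLp.inner_apply, Fin.sum_univ_three]
  ring

lemma compR_eq (h0 : ∀ x, v x 0 = x 0 * b x - x 1 * c x) (h1 : ∀ x, v x 1 = x 1 * b x + x 0 * c x)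
    (x : E3) : compR v x = rad x * b x := by
  rw [inner_eR, h0, h1]
  by_cases hx : rad x = 0
  · simp [hx]
  · field_simp
    rw [rad_sq]; ring

lemma compTheta_eq (h0 : ∀ x, v x 0 = x 0 * b x - x 1 * c x)
    (h1 : ∀ x, v x 1 = x 1 * b x + x 0 * c x) (x : E3) : compTheta v x = rad x * c x := by
  rw [inner_eTheta, h0, h1]
  by_cases hx : rad x = 0
  · simp [hx]
  · field_simp
    rw [rad_sq]; ring

/-- Differentiating the axisymmetric functions `r vʳ` and `r v^θ` along rotations gives a linear
system for the angular derivatives of `v₁` and `v₂` with determinant `r²`; the relation off the axis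
extends by density. -/
lemma AxisymmetricVector.rotPair (hax : AxisymmetricVector v)
    (hs : ∀ i, ContDiff ℝ ∞ fun x => v x i) : RotPair (fun x => v x 0) (fun x => v x 1) := by
  have hd := fun i => smooth_differentiable (hs i)
  have key : ∀ s : E3 → ℝ, ∀ k : E3 → ℝ, AxisymmetricScalar s → Differentiable ℝ k →
      (∀ x, s x = k x / rad x) → (∀ x : E3, x 0 = 0 → x 1 = 0 → k x = 0) → Axi k := by
    intro s k hs hk e k0
    refine AxisymmetricScalar.axi (fun x y hr h2 => ?_) hk
    by_cases hx : rad x = 0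
    · have := coord_eq_zero_of_rad_eq_zero hx
      have h' := coord_eq_zero_of_rad_eq_zero (hr ▸ hx)
      rw [k0 x this.1 this.2, k0 y h'.1 h'.2]
    · have h := hs x y hr h2
      rw [e, e, ← hr] at h
      exact (div_left_inj' hx).1 h
  have dm : ∀ i j : Fin 3, Differentiable ℝ fun x : E3 => x i * v x j := fun i j =>
    (smooth_diff_coord i).fun_mul (hd j)
  have r := key _ _ hax.1 ((dm 0 0).fun_add (dm 1 1)) (inner_eR v) (by intro x h0 h1; simp [h0, h1])
  have θ := key _ _ hax.2.1 ((dm 0 1).fun_sub (dm 1 0)) (inner_eTheta v)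
    (by intro x h0 h1; simp [h0, h1])
  set V := fun (i : Fin 3) (x : E3) => v x i with hV
  change RotPair (V 0) (V 1)
  have cpd : ∀ i j, Continuous (pd i (V j)) := fun i j => (contDiff_pd i (hs j)).continuous
  have cc : ∀ i : Fin 3, Continuous fun x : E3 => x i := fun i => (contDiff_coord i).continuous
  have cV : ∀ i, Continuous (V i) := fun i => (hs i).continuous
  have e1 : ∀ x : E3, x 0 * (x 0 * pd 1 (V 0) x - x 1 * pd 0 (V 0) x + V 1 x)
      + x 1 * (x 0 * pd 1 (V 1) x - x 1 * pd 0 (V 1) x - V 0 x) = 0 := fun x => by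
    have := r x
    rw [pd_add _ (dm 0 0) (dm 1 1), pd_add _ (dm 0 0) (dm 1 1), pd_coord_mul _ _ (hd 0),
      pd_coord_mul _ _ (hd 1), pd_coord_mul _ _ (hd 0), pd_coord_mul _ _ (hd 1)] at this
    simp at this
    linear_combination this
  have e2 : ∀ x : E3, x 0 * (x 0 * pd 1 (V 1) x - x 1 * pd 0 (V 1) x - V 0 x)
      - x 1 * (x 0 * pd 1 (V 0) x - x 1 * pd 0 (V 0) x + V 1 x) = 0 := fun x => by
    have := θ x
    rw [pd_sub _ (dm 0 1) (dm 1 0), pd_sub _ (dm 0 1) (dm 1 0), pd_coord_mul _ _ (hd 0),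
      pd_coord_mul _ _ (hd 1), pd_coord_mul _ _ (hd 0), pd_coord_mul _ _ (hd 1)] at this
    simp at this
    linear_combination this
  intro x
  constructor
  · refine eq_of_rad_sq_mul (f := fun x => x 0 * pd 1 (V 0) x - x 1 * pd 0 (V 0) x)
      (g := fun x => -V 1 x) (((cc 0).mul (cpd 1 0)).sub ((cc 1).mul (cpd 0 0))) (cV 1).neg
      (fun x => ?_) x
    linear_combination x 0 * e1 x - x 1 * e2 x
  · refine eq_of_rad_sq_mul (f := fun x => x 0 * pd 1 (V 1) x - x 1 * pd 0 (V 1) x)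
      (((cc 0).mul (cpd 1 1)).sub ((cc 1).mul (cpd 0 1))) (cV 0)
      (fun x => ?_) x
    linear_combination x 1 * e1 x + x 0 * e2 x

/-- The smooth extension of `vʳ / r` for an axisymmetric field `v`, the average of its horizontal
divergence. -/
def radialPart (v : E3 → E3) : E3 → ℝ :=
  avg 1 fun x => pd 0 (fun y => v y 0) x + pd 1 (fun y => v y 1) x

/-- The smooth extension of `v^θ / r` for an axisymmetric field `v`, the average of the vertical
component of its curl. -/
def angularPart (v : E3 → E3) : E3 → ℝ :=
  avg 1 fun x => pd 0 (fun y => v y 1) x - pd 1 (fun y => v y 0) x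

lemma AxisymmetricVector.cylField (hax : AxisymmetricVector v)
    (hs : ∀ i, SobInf fun x => v x i) :
    CylField (fun i x => v x i) (radialPart v) (angularPart v) where
  mem := hs
  mem_b := (((hs 0).pd 0).add ((hs 1).pd 1)).avg le_rfl
  mem_c := (((hs 1).pd 0).sub ((hs 0).pd 1)).avg le_rfl
  axi_b := ((hax.rotPair fun i => (hs i).1).axi_div (hs 0).1 (hs 1).1).avg
    (((hs 0).pd 0).add ((hs 1).pd 1)).1 1
  axi_c := by
    have h := (((hax.rotPair fun i => (hs i).1).rotate).axi_div (hs 1).1 (hs 0).1.neg)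
    have e : (fun x => pd 0 (fun y => v y 1) x + pd 1 (fun y => -v y 0) x)
        = fun x => pd 0 (fun y => v y 1) x - pd 1 (fun y => v y 0) x := by
      funext x; rw [pd_neg]; ring
    exact (e ▸ h).avg (((hs 1).pd 0).sub ((hs 0).pd 1)).1 1
  axi_two := hax.2.2.axi (hs 2).diff
  eq_zero x := ((hax.rotPair fun i => (hs i).1).decomp (hs 0).1 (hs 1).1 x).1
  eq_one x := ((hax.rotPair fun i => (hs i).1).decomp (hs 0).1 (hs 1).1 x).2

/-! ### Derivatives off the axis -/

lemma differentiableAt_rad {x : E3} (hx : rad x ≠ 0) : DifferentiableAt ℝ rad x := by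
  unfold rad
  refine DifferentiableAt.sqrt (smooth_differentiable smooth_radSq x) ?_
  rw [← rad_sq]; positivity

lemma pd_rad (i : Fin 3) {x : E3} (hx : rad x ≠ 0) :
    pd i rad x = if i = 2 then 0 else x i / rad x := by
  have hq : x 0 ^ 2 + x 1 ^ 2 ≠ 0 := by rw [← rad_sq]; positivity
  have e := ((smooth_differentiable smooth_radSq x).hasFDerivAt.sqrt hq).fderiv
  have e2 := pd_radSq i x
  unfold pd at e2 ⊢
  unfold rad at hx ⊢
  rw [e, smul_apply, e2]
  split_ifs <;> simp
  field_simp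

lemma pd_rad_mul (i : Fin 3) (hf : Differentiable ℝ f) {x : E3} (hx : rad x ≠ 0) :
    pd i (fun y => rad y * f y) x
      = (if i = 2 then 0 else x i / rad x) * f x + rad x * pd i f x := by
  rw [← pd_rad i hx]
  simp [pd, fderiv_fun_mul (differentiableAt_rad hx) (hf x)]; ring

lemma norm_gradient_rad_mul_sq (ha : Axi f) (hf : ContDiff ℝ ∞ f) {x : E3} (hx : rad x ≠ 0) :
    ‖∇ (fun y => rad y * f y) x‖ ^ 2
      = (f x + (x 0 ^ 2 + x 1 ^ 2) * kap f x) ^ 2 + (rad x * pd 2 f x) ^ 2 := by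
  have hd := smooth_differentiable hf
  rw [norm_gradient_sq, pd_rad_mul 0 hd hx, pd_rad_mul 1 hd hx, pd_rad_mul 2 hd hx,
    pd_zero_eq ha hf, pd_one_eq ha hf]
  simp
  rw [← rad_sq]
  field_simp
  linear_combination (- (f x + rad x ^ 2 * kap f x) ^ 2) * rad_sq x

lemma dR_eq (f : E3 → ℝ) (x : E3) : dR f x = (x 0 * pd 0 f x + x 1 * pd 1 f x) / rad x := by
  rw [dR, fderiv_eq_sum_pd, Fin.sum_univ_three]
  simp [eR]
  ring

lemma gradient_ae_eq_of_eq_offAxis (hfg : ∀ x, rad x ≠ 0 → f x = g x) : ∇ f =ᵐ[volume] ∇ g := by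
  filter_upwards [ae_rad_ne_zero] with x hx
  have h : f =ᶠ[𝓝 x] g := Filter.eventually_of_mem (isOpen_offAxis.mem_nhds hx) hfg
  exact h.gradient_eq

lemma measurable_gradient (f : E3 → ℝ) : Measurable (∇ f) :=
  (InnerProductSpace.toDual ℝ E3).symm.continuous.measurable.comp (measurable_fderiv ℝ f)

/-! ### Vorticity -/

section Vorticity

variable (hv : CylField (fun i x => v x i) b c)

include hv

lemma CylField.curl_zero (x : E3) :
    curl v x 0 = x 0 * (-pd 2 c x) - x 1 * CylField.gam (fun i x => v x i) b x := by
  have h1 := (hv.pd_horizontal 2 x).2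
  simp only [curl, CylField.gam]
  simp at h1 ⊢
  rw [h1, pd_one_eq hv.axi_two (hv.mem 2).1]
  ring

lemma CylField.curl_one (x : E3) :
    curl v x 1 = x 1 * (-pd 2 c x) + x 0 * CylField.gam (fun i x => v x i) b x := by
  have h1 := (hv.pd_horizontal 2 x).1
  simp only [curl, CylField.gam]
  simp at h1 ⊢
  rw [h1, pd_zero_eq hv.axi_two (hv.mem 2).1]
  ring

lemma CylField.curl_two (x : E3) :
    curl v x 2 = 2 * c x + (x 0 ^ 2 + x 1 ^ 2) * kap c x := by
  have h0 := (hv.pd_horizontal 1 x).1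
  have h1 := (hv.pd_horizontal 0 x).2
  simp only [curl]
  simp at h0 h1 ⊢
  rw [h0, h1, pd_zero_eq hv.axi_b hv.mem_b.1, pd_one_eq hv.axi_b hv.mem_b.1,
    pd_zero_eq hv.axi_c hv.mem_c.1, pd_one_eq hv.axi_c hv.mem_c.1]
  ring

lemma CylField.compTheta_eq : compTheta v = fun x => rad x * c x :=
  funext (AxiNS.compTheta_eq hv.eq_zero hv.eq_one)

lemma CylField.omegaR_eq : omegaR v = fun x => rad x * (-pd 2 c x) :=
  funext (compR_eq hv.curl_zero hv.curl_one)

lemma CylField.omegaTheta_eq :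
    omegaTheta v = fun x => rad x * CylField.gam (fun i x => v x i) b x :=
  funext (AxiNS.compTheta_eq hv.curl_zero hv.curl_one)

lemma CylField.phiOf_eq {x : E3} (hx : rad x ≠ 0) : PhiOf v x = -pd 2 c x := by
  rw [PhiOf, hv.omegaR_eq, mul_div_cancel_left₀ _ hx]

lemma CylField.gammaOf_eq {x : E3} (hx : rad x ≠ 0) :
    GammaOf v x = CylField.gam (fun i x => v x i) b x := by
  rw [GammaOf, hv.omegaTheta_eq, mul_div_cancel_left₀ _ hx]

lemma CylField.phiOf_ae_eq : PhiOf v =ᵐ[volume] fun x => -pd 2 c x := by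
  filter_upwards [ae_rad_ne_zero] with x hx using hv.phiOf_eq hx

lemma CylField.gammaOf_ae_eq : GammaOf v =ᵐ[volume] CylField.gam (fun i x => v x i) b := by
  filter_upwards [ae_rad_ne_zero] with x hx using hv.gammaOf_eq hx

lemma CylField.gradient_phiOf_ae_eq : ∇ (PhiOf v) =ᵐ[volume] ∇ (fun x => -pd 2 c x) :=
  gradient_ae_eq_of_eq_offAxis fun _ hx => hv.phiOf_eq hx

lemma CylField.gradient_gammaOf_ae_eq :
    ∇ (GammaOf v) =ᵐ[volume] ∇ (CylField.gam (fun i x => v x i) b) :=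
  gradient_ae_eq_of_eq_offAxis fun _ hx => hv.gammaOf_eq hx

/-- `∂_r ω³ - ∂₃ ω^r = r (Δ + (2/r) ∂_r) (v^θ/r)`. -/
lemma CylField.crossVort_eq {x : E3} (hx : rad x ≠ 0) :
    crossVort v x = rad x * lap5 c x := by
  have hc := hv.mem_c.1
  have hk := contDiff_kap hc
  have key : HasKap (fun y => 2 * c y + (y 0 ^ 2 + y 1 ^ 2) * kap c y) x
      (4 * kap c x + (x 0 ^ 2 + x 1 ^ 2) * kap (kap c) x) := by
    have := ((hasKap hc hv.axi_c x).const_mul 2).add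
      ((hasKap_radSq x).mul (hasKap hk (hv.axi_c.kap hc) x))
    exact ⟨this.1, this.2, this.3.trans (by ring)⟩
  have e3 : omega3 v = fun y => 2 * c y + (y 0 ^ 2 + y 1 ^ 2) * kap c y := funext hv.curl_two
  have hn : Differentiable ℝ fun x => -pd 2 c x := (hv.mem_c.pd 2).neg.diff
  rw [crossVort, d3, hv.omegaR_eq, pd_rad_mul 2 hn hx, dR_eq, e3, pd_zero_eq key.2 key.1,
    pd_one_eq key.2 key.1, key.3, lap5_eq hv.axi_c hc, pd_neg]
  have hr := rad_sq x
  simp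
  field_simp
  linear_combination (-(4 * kap c x + (x 0 ^ 2 + x 1 ^ 2) * kap (kap c) x)) * hr

lemma CylField.crossVort_ae_eq : crossVort v =ᵐ[volume] fun x => rad x * lap5 c x := by
  filter_upwards [ae_rad_ne_zero] with x hx using hv.crossVort_eq hx

end Vorticity

end

section

variable {f g h : E3 → ℝ} {v w : E3 → E3} {b c a P : E3 → ℝ} {B M : ℝ}

/-! ### Integrability and norms of the vorticity quantities -/

lemma pd_eq_iteratedFDeriv (i : Fin 3) (f : E3 → ℝ) (x : E3) :
    pd i f x = iteratedFDeriv ℝ 1 f x ![ee i] := by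
  simp [pd]

lemma pd_pd_eq_iteratedFDeriv (i j : Fin 3) (hf : ContDiff ℝ ∞ f) (x : E3) :
    pd i (pd j f) x = iteratedFDeriv ℝ 2 f x ![ee i, ee j] := by
  have hd : DifferentiableAt ℝ (fderiv ℝ f) x :=
    ((hf.fderiv_right (m := ∞) (by simp)).differentiable (by simp)) x
  have := fderiv_clm_apply hd (differentiableAt_const (x := x) (𝕜 := ℝ) (ee j))
  rw [iteratedFDeriv_two_apply]
  show fderiv ℝ (fun y => fderiv ℝ f y (ee j)) x (ee i) = _
  rw [this]; simp

lemma abs_pd_le_norm_iteratedFDeriv (i : Fin 3) (f : E3 → ℝ) (x : E3) :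
    |pd i f x| ≤ ‖iteratedFDeriv ℝ 1 f x‖ := by
  rw [pd_eq_iteratedFDeriv]
  simpa using (iteratedFDeriv ℝ 1 f x).le_opNorm ![ee i]

lemma abs_pd_pd_le_norm_iteratedFDeriv (i j : Fin 3) (hf : ContDiff ℝ ∞ f) (x : E3) :
    |pd i (pd j f) x| ≤ ‖iteratedFDeriv ℝ 2 f x‖ := by
  rw [pd_pd_eq_iteratedFDeriv i j hf]
  simpa [Fin.prod_univ_two] using (iteratedFDeriv ℝ 2 f x).le_opNorm ![ee i, ee j]

/-- A bounded axisymmetric function that vanishes on the axis is `O(r²)` there; the constant `M`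
is the essential supremum of `|a| / r`. -/
lemma axisCoeff_of_bounded (hs : ContDiff ℝ ∞ a) (ha : Axi a)
    (hb : ∀ k : ℕ, ∃ B, ∀ x, ‖iteratedFDeriv ℝ k a x‖ ≤ B) (h0 : ∀ x, rad x = 0 → a x = 0) :
    MemLp (fun x => a x / rad x) ⊤ volume ∧
      ∃ B, AxisCoeff a B (lpNorm (fun x => a x / rad x) ⊤ volume) := by
  obtain ⟨B0, hB0⟩ := hb 0
  obtain ⟨B1, hB1⟩ := hb 1
  obtain ⟨B2, hB2⟩ := hb 2
  have nB0 : 0 ≤ B0 := (norm_nonneg _).trans (hB0 0)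
  have nB1 : 0 ≤ B1 := (norm_nonneg _).trans (hB1 0)
  have nB2 : 0 ≤ B2 := (norm_nonneg _).trans (hB2 0)
  have bd0 : ∀ x, |a x| ≤ B0 := fun x => by simpa using hB0 x
  have bdk : ∀ x, |kap a x| ≤ 2 * B2 := fun x =>
    abs_avg_le 1 (fun y => (abs_add_le _ _).trans (by
      linarith [(abs_pd_pd_le_norm_iteratedFDeriv 0 0 hs y).trans (hB2 y),
        (abs_pd_pd_le_norm_iteratedFDeriv 1 1 hs y).trans (hB2 y)])) x
  have bdq : ∀ x : E3, |a x| ≤ 2 * B2 * (x 0 ^ 2 + x 1 ^ 2) := fun x => by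
    have e := eq_axis_add ha hs x
    rw [h0 (dil 0 x) (by simp [rad]), zero_add] at e
    rw [e, abs_mul, abs_of_nonneg (by positivity : (0:ℝ) ≤ x 0 ^ 2 + x 1 ^ 2), mul_comm]
    exact mul_le_mul_of_nonneg_right (abs_avg_le 1 bdk x) (by positivity)
  have hm : MemLp (fun x => a x / rad x) ⊤ volume := by
    refine memLp_top_of_bound
      (hs.continuous.measurable.div continuous_rad.measurable).aestronglyMeasurable (B0 + 2 * B2)
      (Eventually.of_forall fun x => ?_)
    rw [norm_div, Real.norm_eq_abs, Real.norm_eq_abs, abs_of_nonneg (rad_nonneg x)]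
    have hr := rad_nonneg x
    rcases le_total (rad x) 1 with h1 | h1
    · refine div_le_of_le_mul₀ hr (by positivity) ((bdq x).trans ?_)
      rw [← rad_sq]
      nlinarith [mul_nonneg nB2 hr, mul_nonneg nB0 hr]
    · refine (div_le_self (abs_nonneg _) h1).trans ((bd0 x).trans (by linarith))
  refine ⟨hm, B0 + B1 + 2 * B2, hs, ha, fun x => (bd0 x).trans (by linarith), fun i x =>
    ((abs_pd_le_norm_iteratedFDeriv i a x).trans (hB1 x)).trans (by linarith),
    fun x => (bdk x).trans (by linarith), fun x => (bdq x).trans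
      (mul_le_mul_of_nonneg_right (by linarith) (by positivity)), lpNorm_nonneg, ?_⟩
  set N := lpNorm (fun x => a x / rad x) ⊤ volume
  have hcl : IsClosed {x : E3 | |a x| ≤ N * rad x} :=
    isClosed_le hs.continuous.abs (continuous_const.mul continuous_rad)
  have hae : ∀ᵐ x, x ∈ {x : E3 | |a x| ≤ N * rad x} := by
    filter_upwards [ae_le_lpNorm_exponent_top hm, ae_rad_ne_zero] with x hx hr
    rw [norm_div, Real.norm_eq_abs, Real.norm_eq_abs, abs_of_nonneg (rad_nonneg x),
      div_le_iff₀ ((rad_nonneg x).lt_of_ne' hr)] at hx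
    exact hx
  intro x
  have hx := (Measure.dense_of_ae hae).closure_eq.ge (mem_univ x)
  exact hcl.closure_subset hx

/-- If `(l₀, l₁)` has radial and angular components `r B`, `r C`, these are bounded by it. -/
lemma abs_rad_mul_le {x : E3} {l₀ l₁ B C : ℝ} (h0 : l₀ = x 0 * B - x 1 * C)
    (h1 : l₁ = x 1 * B + x 0 * C) : |rad x * B| ≤ |l₀| + |l₁| ∧ |rad x * C| ≤ |l₀| + |l₁| := by
  have e : l₀ ^ 2 + l₁ ^ 2 = (rad x * B) ^ 2 + (rad x * C) ^ 2 := by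
    rw [mul_pow, mul_pow, rad_sq, h0, h1]; ring
  have := mul_nonneg (abs_nonneg l₀) (abs_nonneg l₁)
  constructor <;> refine abs_le_of_sq_le_sq ?_ (by positivity) <;>
    nlinarith [sq_abs l₀, sq_abs l₁, sq_nonneg (rad x * B), sq_nonneg (rad x * C)]

namespace CylField

variable {v : Fin 3 → E3 → ℝ}

lemma memLp_rad_mul_swirl (hv : CylField v b c) : MemLp (fun x => rad x * c x) 3 volume :=
  MemLp.of_le (((hv.mem 0).memLp_three.abs).add ((hv.mem 1).memLp_three.abs))
    (continuous_rad_mul hv.mem_c.cont).aestronglyMeasurable (Eventually.of_forall fun x =>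
      ((abs_rad_mul_le (hv.eq_zero x) (hv.eq_one x)).2).trans (le_abs_self _))

lemma memLp_rad_mul_lap5 (hv : CylField v b c) :
    MemLp (fun x => rad x * lap5 b x) 2 volume ∧ MemLp (fun x => rad x * lap5 c x) 2 volume := by
  have hm := ((hv.mem 0).lapl.memLp.abs).add ((hv.mem 1).lapl.memLp.abs)
  have h := fun x => abs_rad_mul_le (hv.lapl_horizontal x).1 (hv.lapl_horizontal x).2
  exact ⟨MemLp.of_le hm (continuous_rad_mul hv.mem_b.lap5.cont).aestronglyMeasurable
      (Eventually.of_forall fun x => ((h x).1).trans (le_abs_self _)),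
    MemLp.of_le hm (continuous_rad_mul hv.mem_c.lap5.cont).aestronglyMeasurable
      (Eventually.of_forall fun x => ((h x).2).trans (le_abs_self _))⟩

end CylField

lemma CylField.memLp_gradient_omegaTheta (hv : CylField (fun i x => v x i) b c)
    (hdiv : ∀ x, ∑ i, pd i (fun y => v y i) x = 0) : MemLp (∇ (omegaTheta v)) 2 volume := by
  have m1 := ((hv.mem 2).lapl.memLp.abs.add hv.mem_gam.memLp.abs).add
    hv.memLp_rad_mul_lap5.1.abs
  refine m1.of_le (measurable_gradient _).aestronglyMeasurable ?_
  filter_upwards [ae_rad_ne_zero] with x hx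
  refine (abs_le_of_sq_le_sq' ?_ (norm_nonneg _)).2
  have e := norm_gradient_rad_mul_sq hv.axi_gam hv.mem_gam.1 hx
  rw [← hv.lap5_eq_pd_gam hdiv] at e
  have e2 := hv.lapl_vertical hdiv x
  rw [hv.omegaTheta_eq, e]
  simp only [Pi.add_apply, Pi.abs_apply, Real.norm_eq_abs]
  set L := lapl (fun x => v x 2) x
  set G := gam (fun i x => v x i) b x
  have e3 : G + (x 0 ^ 2 + x 1 ^ 2) * kap (gam (fun i x => v x i) b) x = - (L + G) := by
    linear_combination e2
  rw [e3, sq_abs]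
  have h1 := abs_add_le L G
  have h2 := sq_abs (L + G)
  have h3 := sq_abs (rad x * lap5 b x)
  nlinarith [abs_nonneg (L + G), abs_nonneg L, abs_nonneg G, abs_nonneg (rad x * lap5 b x),
    mul_nonneg (add_nonneg (abs_nonneg L) (abs_nonneg G)) (abs_nonneg (rad x * lap5 b x))]

/-- The radial and vertical derivatives of `ω^θ` are bounded by its gradient. -/
lemma CylField.abs_le_norm_gradient_omegaTheta (hv : CylField (fun i x => v x i) b c)
    (hdiv : ∀ x, ∑ i, pd i (fun y => v y i) x = 0) {x : E3} (hx : rad x ≠ 0) :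
    |rad x * lap5 b x| ≤ ‖∇ (omegaTheta v) x‖ ∧
      |lapl (fun x => v x 2) x| ≤ ‖GammaOf v x‖ + ‖∇ (omegaTheta v) x‖ := by
  have e := norm_gradient_rad_mul_sq hv.axi_gam hv.mem_gam.1 hx
  rw [← hv.lap5_eq_pd_gam hdiv, ← hv.omegaTheta_eq] at e
  have e2 := hv.lapl_vertical hdiv x
  rw [hv.gammaOf_eq hx]
  set G := gam (fun i x => v x i) b x
  set K := (x 0 ^ 2 + x 1 ^ 2) * kap (gam (fun i x => v x i) b) x
  have h1 : |G + K| ≤ ‖∇ (omegaTheta v) x‖ := by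
    refine abs_le_of_sq_le_sq ?_ (norm_nonneg _)
    rw [e]; nlinarith [sq_nonneg (rad x * lap5 b x)]
  refine ⟨?_, ?_⟩
  · refine abs_le_of_sq_le_sq ?_ (norm_nonneg _)
    rw [e]; nlinarith [sq_nonneg (G + K)]
  · rw [e2, Real.norm_eq_abs, abs_neg, show 2 * G + K = G + (G + K) by ring]
    exact (abs_add_le _ _).trans (by linarith)

lemma norm2_add_le {F : Type*} [NormedAddCommGroup F] {f g : E3 → F} (hf : MemLp f 2 volume) :
    norm2 (fun x => f x + g x) ≤ norm2 f + norm2 g :=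
  lpNorm_add_le hf (by norm_num)

lemma norm2_norm {F : Type*} [NormedAddCommGroup F] {f : E3 → F}
    (hf : AEStronglyMeasurable f volume) : norm2 (fun x => ‖f x‖) = norm2 f :=
  lpNorm_norm hf 2

lemma norm2_congr {F : Type*} [NormedAddCommGroup F] {f g : E3 → F} (h : f =ᵐ[volume] g) :
    norm2 f = norm2 g := by
  by_cases hf : AEStronglyMeasurable f volume
  · rw [norm2, norm2, ← toReal_eLpNorm hf, ← toReal_eLpNorm (hf.congr h), eLpNorm_congr_ae h]
  · rw [norm2, norm2, lpNorm_of_not_aestronglyMeasurable hf,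
      lpNorm_of_not_aestronglyMeasurable fun hg => hf (hg.congr h.symm)]

/-- The `L²` bounds on the viscous and pressure terms of the horizontal and vertical momentum
equations. -/
lemma CylField.norm2_viscous_le (hv : CylField (fun i x => v x i) b c)
    (hdiv : ∀ x, ∑ i, pd i (fun y => v y i) x = 0) (hP : ContDiff ℝ ∞ P) (haP : Axi P)
    (hP2 : MemLp (∇ P) 2 volume) :
    MemLp (fun x => rad x * (lap5 b x - kap P x)) 2 volume ∧
    norm2 (fun x => rad x * (lap5 b x - kap P x)) ≤ norm2 (∇ (omegaTheta v)) + norm2 (∇ P) ∧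
    norm2 (fun x => lapl (fun x => v x 2) x - pd 2 P x)
      ≤ norm2 (GammaOf v) + norm2 (∇ (omegaTheta v)) + norm2 (∇ P) := by
  have hω := hv.memLp_gradient_omegaTheta hdiv
  have hΓ : MemLp (GammaOf v) 2 volume := hv.mem_gam.memLp.ae_eq hv.gammaOf_ae_eq.symm
  have m1 : MemLp (fun x => ‖∇ (omegaTheta v) x‖ + ‖∇ P x‖) 2 volume := hω.norm.add hP2.norm
  have m2 : MemLp (fun x => ‖GammaOf v x‖ + ‖∇ (omegaTheta v) x‖) 2 volume :=
    hΓ.norm.add hω.norm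
  have m3 : MemLp (fun x => ‖GammaOf v x‖ + ‖∇ (omegaTheta v) x‖ + ‖∇ P x‖) 2 volume :=
    m2.add hP2.norm
  have c1 : AEStronglyMeasurable (fun x => rad x * (lap5 b x - kap P x)) volume :=
    (continuous_rad_mul (hv.mem_b.lap5.cont.sub (contDiff_kap hP).continuous)).aestronglyMeasurable
  have c2 : AEStronglyMeasurable (fun x => lapl (fun x => v x 2) x - pd 2 P x) volume :=
    ((hv.mem 2).lapl.cont.sub (contDiff_pd 2 hP).continuous).aestronglyMeasurable
  have b1 : ∀ᵐ x, ‖rad x * (lap5 b x - kap P x)‖ ≤ ‖‖∇ (omegaTheta v) x‖ + ‖∇ P x‖‖ := by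
    filter_upwards [ae_rad_ne_zero] with x hx
    rw [mul_sub, Real.norm_of_nonneg (r := _ + _) (by positivity), Real.norm_eq_abs]
    exact (abs_sub _ _).trans (add_le_add (hv.abs_le_norm_gradient_omegaTheta hdiv hx).1
      (abs_rad_mul_kap_le haP hP x))
  have b2 : ∀ᵐ x, ‖lapl (fun x => v x 2) x - pd 2 P x‖
      ≤ ‖‖GammaOf v x‖ + ‖∇ (omegaTheta v) x‖ + ‖∇ P x‖‖ := by
    filter_upwards [ae_rad_ne_zero] with x hx
    rw [Real.norm_of_nonneg (r := _ + _) (by positivity), Real.norm_eq_abs]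
    exact (abs_sub _ _).trans (add_le_add (hv.abs_le_norm_gradient_omegaTheta hdiv hx).2
      (abs_pd_le_norm_gradient 2 P x))
  refine ⟨m1.of_le c1 b1, (norm2_le_of_ae_le c1 m1 b1).trans ?_,
    (norm2_le_of_ae_le c2 m3 b2).trans ?_⟩
  · rw [← norm2_norm hω.1, ← norm2_norm hP2.1]
    exact norm2_add_le hω.norm
  · rw [← norm2_norm hω.1, ← norm2_norm hP2.1, ← norm2_norm hΓ.1]
    exact (norm2_add_le m2).trans (by gcongr; exact norm2_add_le hΓ.norm)

/-! ### The energy inequality at a fixed time -/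

lemma continuous_adv {v : Fin 3 → E3 → ℝ} (hv : ∀ i, Continuous (v i)) (hf : ContDiff ℝ ∞ f) :
    Continuous (adv v f) := by
  unfold adv
  exact continuous_finsetSum _ fun i _ => (hv i).mul (contDiff_pd i hf).continuous

/-- The equations for the quotients by `r` of the radial and angular components, from the
momentum equation. -/
lemma CylField.quotient_equations {v w : Fin 3 → E3 → ℝ} {β γ : E3 → ℝ} (hv : CylField v b c)
    (hw : CylField w β γ) (hP : ContDiff ℝ ∞ P) (haP : Axi P) (ha : Continuous a)
    (mom : ∀ i x, w i x + adv v (v i) x = (1 + a x) * (lapl (v i) x - pd i P x)) (x : E3) :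
    γ x = lap5 c x - (adv v c x + 2 * b x * c x) + a x * lap5 c x ∧
    β x = lap5 b x - kap P x - (adv v b x + (b x * b x - c x * c x))
      + a x * (lap5 b x - kap P x) := by
  have m0 := mom 0
  have m1 := mom 1
  simp only [hw.eq_zero, hw.eq_one, (hv.adv_horizontal _).1, (hv.adv_horizontal _).2,
    (hv.lapl_horizontal _).1, (hv.lapl_horizontal _).2, pd_zero_eq haP hP, pd_one_eq haP hP]
    at m0 m1
  have cv : ∀ i, Continuous (v i) := fun i => (hv.mem i).cont
  have cb := hv.mem_b.cont
  have cc := hv.mem_c.cont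
  have c1 := hv.mem_c.lap5.cont
  have c2 := hv.mem_b.lap5.cont
  have c3 := (contDiff_kap hP).continuous
  have c4 := continuous_adv cv hv.mem_b.1
  have c5 := continuous_adv cv hv.mem_c.1
  constructor
  · refine eq_of_rad_sq_mul (g := fun x => lap5 c x - (adv v c x + 2 * b x * c x) + a x * lap5 c x)
      hw.mem_c.cont (by fun_prop) (fun y => ?_) x
    linear_combination y 0 * m1 y - y 1 * m0 y
  · refine eq_of_rad_sq_mul (g := fun x => lap5 b x - kap P x
        - (adv v b x + (b x * b x - c x * c x)) + a x * (lap5 b x - kap P x))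
      hw.mem_b.cont (by fun_prop) (fun y => ?_) x
    linear_combination y 0 * m0 y + y 1 * m1 y

/-- The energy inequality at a fixed time, where `w` stands for the time derivative of the
velocity `v`. -/
theorem energy_inequality {β γ : E3 → ℝ} (hv : CylField (fun i x => v x i) b c)
    (hdiv : ∀ x, ∑ i, pd i (fun y => v y i) x = 0) (hw : CylField (fun i x => w x i) β γ)
    (ha : AxisCoeff a B M) (hP : ContDiff ℝ ∞ P) (haP : Axi P) (hP2 : ∀ i, SobInf (pd i P))
    (hP2' : MemLp (∇ P) 2 volume)
    (mom : ∀ i x, w x i + adv (fun i x => v x i) (fun y => v y i) x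
      = (1 + a x) * (lapl (fun y => v y i) x - pd i P x)) :
    (∫ x, pd 2 c x * pd 2 γ x)
        + (∫ x, CylField.gam (fun i x => v x i) b x * CylField.gam (fun i x => w x i) β x)
        + norm2 (∇ (PhiOf v)) ^ 2 + norm2 (∇ (GammaOf v)) ^ 2
      ≤ 2 * M * (norm2 (∇ P) + norm2 (∇ (omegaTheta v)) + norm2 (GammaOf v)
          + norm2 (crossVort v)) * (norm2 (∇ (GammaOf v)) + norm2 (∇ (PhiOf v)))
        + (3 * sobC + 2 * hardyC ^ 2) * lpNorm (compTheta v) 3 volume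
          * norm2 (∇ (GammaOf v)) * norm2 (∇ (PhiOf v)) := by
  have hq := hv.quotient_equations hw hP haP ha.smooth.continuous mom
  obtain ⟨v1, v2, v3⟩ := hv.norm2_viscous_le hdiv hP haP hP2'
  have E1 := hv.energy_swirl hdiv ha hw.mem_c (fun x => (hq x).1) hv.memLp_rad_mul_swirl
    hv.memLp_rad_mul_lap5.2
  have E2 := hv.energy_gam hdiv ha (δ := fun y => w y 2) hP haP hP2 (fun x => (hq x).2)
    (fun x => by linear_combination mom 2 x) hv.memLp_rad_mul_swirl v1
  have eΦ : norm2 (∇ (PhiOf v)) = norm2 (∇ (pd 2 c)) := by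
    rw [norm2_congr hv.gradient_phiOf_ae_eq]
    have : ∇ (fun x => -pd 2 c x) = fun x => -∇ (pd 2 c) x := by
      funext x; ext i
      simp [gradient_apply, pd_neg]
    rw [this]
    exact lpNorm_fun_neg _ _ _
  rw [eΦ, norm2_congr hv.gradient_gammaOf_ae_eq, norm2_congr hv.crossVort_ae_eq, hv.compTheta_eq]
  set X := norm2 (∇ (pd 2 c))
  set Y := norm2 (∇ (CylField.gam (fun i x => v x i) b))
  have hX : 0 ≤ X := norm2_nonneg _
  have hY : 0 ≤ Y := norm2_nonneg _
  have hM := ha.nonneg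
  have n1 : 0 ≤ norm2 (∇ P) := norm2_nonneg _
  have n2 : 0 ≤ norm2 (∇ (omegaTheta v)) := norm2_nonneg _
  have n3 : 0 ≤ norm2 (GammaOf v) := norm2_nonneg _
  have n4 : 0 ≤ norm2 (fun x => rad x * lap5 c x) := norm2_nonneg _
  have k1 : M * (norm2 (fun x => rad x * (lap5 b x - kap P x))
      + norm2 (fun x => lapl (fun x => v x 2) x - pd 2 P x)) * Y
      ≤ M * (2 * (norm2 (∇ P) + norm2 (∇ (omegaTheta v)) + norm2 (GammaOf v)
          + norm2 (fun x => rad x * lap5 c x))) * Y := by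
    refine mul_le_mul_of_nonneg_right (mul_le_mul_of_nonneg_left ?_ hM) hY
    linarith
  have k2 : M * norm2 (fun x => rad x * lap5 c x) * X
      ≤ M * (2 * (norm2 (∇ P) + norm2 (∇ (omegaTheta v)) + norm2 (GammaOf v)
          + norm2 (fun x => rad x * lap5 c x))) * X := by
    refine mul_le_mul_of_nonneg_right (mul_le_mul_of_nonneg_left ?_ hM) hX
    linarith
  have e3 : ∫ x, CylField.gam (fun i x => v x i) b x * CylField.gam (fun i x => w x i) β x
    = ∫ x, CylField.gam (fun i x => v x i) b x * (pd 2 β x - kap (fun y => w y 2) x) := rfl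
  rw [e3]
  linarith

end

section

variable {F : Type*} [NormedAddCommGroup F] [NormedSpace ℝ F] {T t : ℝ}

/-! ### Smooth functions of time and space -/

lemma uniqueDiffOn_slab (hT : 0 < T) : UniqueDiffOn ℝ (Icc 0 T ×ˢ (univ : Set E3)) :=
  (uniqueDiffOn_Icc hT).prod uniqueDiffOn_univ

namespace SmoothOn

section Vector

variable {f : ℝ → E3 → F}

lemma slice (hf : SmoothOn T f) (ht : t ∈ Icc 0 T) : ContDiff ℝ ∞ (f t) :=
  contDiffOn_univ.1 (ContDiffOn.comp (g := fun p : ℝ × E3 => f p.1 p.2) (f := fun y => (t, y)) hf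
    (by fun_prop) fun x _ => ⟨ht, mem_univ x⟩)

/-- The space-time derivative of a function on the slab `[0, T] × ℝ³`. -/
abbrev slabDeriv (T : ℝ) (f : ℝ → E3 → F) : ℝ × E3 → ℝ × E3 →L[ℝ] F :=
  fderivWithin ℝ (fun p : ℝ × E3 => f p.1 p.2) (Icc 0 T ×ˢ univ)

lemma hasFDerivWithinAt_slab (hf : SmoothOn T f) (ht : t ∈ Icc 0 T) (x : E3) :
    HasFDerivWithinAt (fun p : ℝ × E3 => f p.1 p.2) (slabDeriv T f (t, x))
      (Icc 0 T ×ˢ univ) (t, x) :=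
  ((ContDiffOn.differentiableOn hf (by simp)) (t, x) ⟨ht, mem_univ x⟩).hasFDerivWithinAt

lemma contDiffOn_slabDeriv (hT : 0 < T) (hf : SmoothOn T f) :
    ContDiffOn ℝ ∞ (slabDeriv T f) (Icc 0 T ×ˢ univ) :=
  ContDiffOn.fderivWithin hf (uniqueDiffOn_slab hT) (by simp)

lemma hasDerivWithinAt_slab (hf : SmoothOn T f) (ht : t ∈ Icc 0 T) (x : E3) :
    HasDerivWithinAt (fun s => f s x) (slabDeriv T f (t, x) (1, 0)) (Icc 0 T) t := by
  have h : HasDerivWithinAt (fun s : ℝ => (s, x)) ((1 : ℝ), (0 : E3)) (Icc 0 T) t :=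
    (hasDerivWithinAt_id t _).prodMk (hasDerivWithinAt_const t _ x)
  have hm : MapsTo (fun s : ℝ => (s, x)) (Icc 0 T) (Icc 0 T ×ˢ univ) :=
    fun s hs => ⟨hs, mem_univ x⟩
  exact (hf.hasFDerivWithinAt_slab ht x).comp_hasDerivWithinAt t h hm

lemma dt_eq (hT : 0 < T) (hf : SmoothOn T f) (ht : t ∈ Icc 0 T) (x : E3) :
    dt T f t x = slabDeriv T f (t, x) (1, 0) :=
  (hf.hasDerivWithinAt_slab ht x).derivWithin (uniqueDiffOn_Icc hT t ht)

lemma hasDerivWithinAt (hT : 0 < T) (hf : SmoothOn T f) (ht : t ∈ Icc 0 T) (x : E3) :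
    HasDerivWithinAt (fun s => f s x) (dt T f t x) (Icc 0 T) t := by
  rw [hf.dt_eq hT ht]
  exact hf.hasDerivWithinAt_slab ht x

lemma dt_smooth (hT : 0 < T) (hf : SmoothOn T f) : SmoothOn T (dt T f) :=
  ((hf.contDiffOn_slabDeriv hT).clm_apply contDiffOn_const).congr
    fun p hp => hf.dt_eq hT hp.1 p.2

lemma clm {G : Type*} [NormedAddCommGroup G] [NormedSpace ℝ G] (hf : SmoothOn T f)
    (L : F →L[ℝ] G) : SmoothOn T fun s x => L (f s x) :=
  L.contDiff.comp_contDiffOn hf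

lemma dt_clm {G : Type*} [NormedAddCommGroup G] [NormedSpace ℝ G] (hT : 0 < T)
    (hf : SmoothOn T f) (L : F →L[ℝ] G) (ht : t ∈ Icc 0 T) (x : E3) :
    dt T (fun s x => L (f s x)) t x = L (dt T f t x) :=
  (L.hasFDerivAt.comp_hasDerivWithinAt t (hf.hasDerivWithinAt hT ht x)).derivWithin
    (uniqueDiffOn_Icc hT t ht)

end Vector

variable {f : ℝ → E3 → ℝ}

lemma pd_eq (hf : SmoothOn T f) (ht : t ∈ Icc 0 T) (i : Fin 3) (x : E3) :
    AxiNS.pd i (f t) x = slabDeriv T f (t, x) (0, ee i) := by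
  have h : HasFDerivWithinAt (fun y : E3 => (t, y)) (ContinuousLinearMap.inr ℝ ℝ E3) univ x :=
    (hasFDerivAt_prodMk_right t x).hasFDerivWithinAt
  have := ((hf.hasFDerivWithinAt_slab ht x).comp x h fun y _ => ⟨ht, mem_univ y⟩).hasFDerivAt
    univ_mem
  have e := this.fderiv
  rw [AxiNS.pd, show f t = (fun p : ℝ × E3 => f p.1 p.2) ∘ fun y => (t, y) from rfl, e]
  simp

lemma pd (hT : 0 < T) (hf : SmoothOn T f) (i : Fin 3) : SmoothOn T fun s => AxiNS.pd i (f s) :=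
  ((hf.contDiffOn_slabDeriv hT).clm_apply contDiffOn_const).congr fun p hp => hf.pd_eq hp.1 i p.2

/-- Time and space derivatives commute, up to the end points of the time interval. -/
lemma dt_pd (hT : 0 < T) (hf : SmoothOn T f) (i : Fin 3) (ht : t ∈ Icc 0 T) (x : E3) :
    dt T (fun s => AxiNS.pd i (f s)) t x = AxiNS.pd i (dt T f t) x := by
  have hu := uniqueDiffOn_slab hT
  have hp : (t, x) ∈ Icc 0 T ×ˢ (univ : Set E3) := ⟨ht, mem_univ x⟩
  have hcl : (t, x) ∈ closure (interior (Icc 0 T ×ˢ (univ : Set E3))) := by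
    rw [interior_prod_eq, interior_Icc, interior_univ, closure_prod_eq, closure_Ioo hT.ne,
      closure_univ]
    exact hp
  have hsym := (ContDiffOn.contDiffWithinAt hf hp).isSymmSndFDerivWithinAt (n := ∞)
    (by simp; exact WithTop.coe_le_coe.2 le_top)
    hu hcl hp
  have hd : DifferentiableWithinAt ℝ (slabDeriv T f) (Icc 0 T ×ˢ univ) (t, x) :=
    (hf.contDiffOn_slabDeriv hT).differentiableOn (by simp) _ hp
  have key : ∀ w : ℝ × E3, ∀ g : ℝ → E3 → ℝ,
      (∀ p ∈ Icc 0 T ×ˢ (univ : Set E3), g p.1 p.2 = slabDeriv T f p w) →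
      slabDeriv T g (t, x) = (fderivWithin ℝ (slabDeriv T f) (Icc 0 T ×ˢ univ) (t, x)).flip w := by
    intro w g hg
    have h1 : slabDeriv T g (t, x)
        = fderivWithin ℝ (fun p => slabDeriv T f p w) (Icc 0 T ×ˢ univ) (t, x) :=
      fderivWithin_congr hg (hg _ hp)
    rw [h1, fderivWithin_clm_apply (hu _ hp) hd (differentiableWithinAt_const w)]
    ext v <;> simp
  rw [(hf.pd hT i).dt_eq hT ht, (hf.dt_smooth hT).pd_eq ht,
    key (0, ee i) (fun s => AxiNS.pd i (f s)) fun p hp => hf.pd_eq hp.1 i p.2,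
    key (1, 0) (dt T f) fun p hp => hf.dt_eq hT hp.1 p.2]
  exact hsym _ _

end SmoothOn

/-! ### Differentiation in time with values in `L²` -/

/-- The function `s ↦ f s` on `[0, T]` is differentiable at `t` with derivative `g` for the norm
of `L²(ℝ³)`. -/
def HasL2Deriv (T t : ℝ) (f : ℝ → E3 → ℝ) (g : E3 → ℝ) : Prop :=
  ∀ ε > 0, ∀ᶠ s in 𝓝[Icc 0 T] t,
    eLpNorm (fun x => f s x - f t x - (s - t) * g x) 2 volume ≤ ENNReal.ofReal (ε * |s - t|)

variable {f : ℝ → E3 → ℝ} {g : E3 → ℝ}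

lemma HasL2Deriv.congr {f' : ℝ → E3 → ℝ} {g' : E3 → ℝ} (h : HasL2Deriv T t f g)
    (ht : t ∈ Icc 0 T) (hf : ∀ s ∈ Icc 0 T, ∀ x, f' s x = f s x) (hg : ∀ x, g' x = g x) :
    HasL2Deriv T t f' g' := by
  intro ε hε
  filter_upwards [h ε hε, self_mem_nhdsWithin] with s hs hsI
  simpa only [hf s hsI, hf t ht, hg] using hs

lemma HasL2Deriv.add {f' : ℝ → E3 → ℝ} {g' : E3 → ℝ} (h : HasL2Deriv T t f g)
    (h' : HasL2Deriv T t f' g') (ht : t ∈ Icc 0 T) (hf : ∀ s ∈ Icc 0 T, Continuous (f s))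
    (hf' : ∀ s ∈ Icc 0 T, Continuous (f' s)) (hg : Continuous g) (hg' : Continuous g') :
    HasL2Deriv T t (fun s x => f s x + f' s x) fun x => g x + g' x := by
  intro ε hε
  filter_upwards [h (ε / 2) (by positivity), h' (ε / 2) (by positivity), self_mem_nhdsWithin]
    with s h1 h2 hs
  have e : (fun x => f s x + f' s x - (f t x + f' t x) - (s - t) * (g x + g' x))
      = (fun x => f s x - f t x - (s - t) * g x)
        + fun x => f' s x - f' t x - (s - t) * g' x := by
    funext x; simp only [Pi.add_apply]; ring
  have c1 := hf s hs
  have c2 := hf t ht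
  have c3 := hf' s hs
  have c4 := hf' t ht
  rw [e]
  refine (eLpNorm_add_le (by fun_prop) (by fun_prop) (by norm_num)).trans
    ((add_le_add h1 h2).trans ?_)
  rw [← ENNReal.ofReal_add (by positivity) (by positivity)]
  exact ENNReal.ofReal_le_ofReal (by linarith)

lemma HasL2Deriv.neg (h : HasL2Deriv T t f g) :
    HasL2Deriv T t (fun s x => -f s x) fun x => -g x := by
  intro ε hε
  filter_upwards [h ε hε] with s hs
  have e : (fun x => -f s x - -f t x - (s - t) * -g x)
      = -fun x => f s x - f t x - (s - t) * g x := by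
    funext x; simp only [Pi.neg_apply]; ring
  rwa [e, eLpNorm_neg]

lemma HasL2Deriv.sub {f' : ℝ → E3 → ℝ} {g' : E3 → ℝ} (h : HasL2Deriv T t f g)
    (h' : HasL2Deriv T t f' g') (ht : t ∈ Icc 0 T) (hf : ∀ s ∈ Icc 0 T, Continuous (f s))
    (hf' : ∀ s ∈ Icc 0 T, Continuous (f' s)) (hg : Continuous g) (hg' : Continuous g') :
    HasL2Deriv T t (fun s x => f s x - f' s x) fun x => g x - g' x := by
  simpa only [sub_eq_add_neg] using h.add h'.neg ht hf (fun s hs => (hf' s hs).neg) hg hg'.neg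

/-- The averages are contractions of `L²`, hence preserve differentiability. -/
lemma HasL2Deriv.avg (h : HasL2Deriv T t f g) (ht : t ∈ Icc 0 T) {m : ℕ} (hm : 1 ≤ m)
    (hf : ∀ s ∈ Icc 0 T, Continuous (f s)) (hg : Continuous g) :
    HasL2Deriv T t (fun s => avg m (f s)) (avg m g) := by
  intro ε hε
  filter_upwards [h ε hε, self_mem_nhdsWithin] with s hs hsI
  have c1 := hf s hsI
  have c2 := hf t ht
  have e : (fun x => AxiNS.avg m (f s) x - AxiNS.avg m (f t) x - (s - t) * AxiNS.avg m g x)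
      = AxiNS.avg m fun x => f s x - f t x - (s - t) * g x := by
    funext x
    rw [avg_sub m (by fun_prop) (by fun_prop), avg_sub m c1 c2, avg_const_mul]
  rw [e]
  exact (eLpNorm_avg_le hm (by fun_prop)).trans hs

/-- The squared norm of a function that is differentiable in time with values in `L²`. -/
lemma HasL2Deriv.hasDerivWithinAt_norm2_sq (h : HasL2Deriv T t f g) (ht : t ∈ Icc 0 T)
    (hf : ∀ s ∈ Icc 0 T, MemLp (f s) 2 volume) (hg : MemLp g 2 volume) :
    HasDerivWithinAt (fun s => norm2 (f s) ^ 2) (2 * ∫ x, f t x * g x) (Icc 0 T) t := by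
  classical
  set Φ : ℝ → Lp ℝ 2 (volume : Measure E3) := fun s =>
    if hs : MemLp (f s) 2 volume then hs.toLp (f s) else 0 with hΦ
  have hΦs : ∀ s (hs : s ∈ Icc 0 T), Φ s = (hf s hs).toLp (f s) := fun s hs => by
    simp only [hΦ, dif_pos (hf s hs)]
  have hd : HasDerivWithinAt Φ (hg.toLp g) (Icc 0 T) t := by
    rw [hasDerivWithinAt_iff_isLittleO, Asymptotics.isLittleO_iff]
    intro ε hε
    filter_upwards [h ε hε, self_mem_nhdsWithin] with s hs hsI
    rw [hΦs s hsI, hΦs t ht, ← MemLp.toLp_const_smul, ← MemLp.toLp_sub, ← MemLp.toLp_sub,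
      Lp.norm_toLp]
    exact ENNReal.toReal_le_of_le_ofReal (by positivity) hs
  have hn := hd.norm_sq
  have e : inner ℝ (Φ t) (hg.toLp g) = ∫ x, f t x * g x := by
    rw [hΦs t ht, L2.inner_def]
    refine integral_congr_ae ?_
    filter_upwards [(hf t ht).coeFn_toLp, hg.coeFn_toLp] with x h1 h2
    rw [h1, h2]
    simp [mul_comm]
  rw [e] at hn
  have e2 : ∀ s ∈ Icc 0 T, norm2 (f s) ^ 2 = ‖Φ s‖ ^ 2 := fun s hs => by
    rw [hΦs s hs, Lp.norm_toLp, norm2, toReal_eLpNorm (hf s hs).1]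
  exact hn.congr e2 (e2 t ht)

/-- A smooth function whose time derivative is continuous with values in `L²` is differentiable
with values in `L²`. -/
lemma SmoothOn.hasL2Deriv (hT : 0 < T) (hf : SmoothOn T f) (ht : t ∈ Icc 0 T)
    (hc : Tendsto (fun s => eLpNorm (dt T f s - dt T f t) 2 volume) (𝓝[Icc 0 T] t) (𝓝 0)) :
    HasL2Deriv T t f (dt T f t) := by
  intro ε hε
  have h1 : ∀ᶠ s in 𝓝[Icc 0 T] t,
      eLpNorm (dt T f s - dt T f t) 2 volume ≤ ENNReal.ofReal ε :=
    hc.eventually_le_const (ENNReal.ofReal_pos.2 hε)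
  obtain ⟨δ, hδ, hball⟩ := Metric.mem_nhdsWithin_iff.1 h1
  filter_upwards [self_mem_nhdsWithin, mem_nhdsWithin_of_mem_nhds (Metric.ball_mem_nhds t hδ)]
    with s hs hsδ
  have hsub : uIcc t s ⊆ Icc 0 T := ordConnected_Icc.uIcc_subset ht hs
  have hclose : ∀ τ ∈ uIoc t s, eLpNorm (dt T f τ - dt T f t) 2 volume ≤ ENNReal.ofReal ε := by
    intro τ hτ
    have hτ' := uIoc_subset_uIcc hτ
    refine hball ⟨?_, hsub hτ'⟩
    rw [Metric.mem_ball, Real.dist_eq] at hsδ ⊢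
    exact (abs_sub_left_of_mem_uIcc hτ').trans_lt hsδ
  have hcont : ContinuousOn (fun p : ℝ × E3 => dt T f p.1 p.2) (Icc 0 T ×ˢ univ) :=
    ContDiffOn.continuousOn (hf.dt_smooth hT)
  have hcs := ((hf.dt_smooth hT).slice ht).continuous
  have hG : ∀ x, ContinuousOn (fun τ => dt T f τ x) (uIcc t s) := fun x =>
    hcont.comp (f := fun τ => (τ, x)) (by fun_prop) fun τ hτ => ⟨hsub hτ, mem_univ x⟩
  have ftc : ∀ x, f s x - f t x - (s - t) * dt T f t x
      = ∫ τ in t..s, (dt T f τ x - dt T f t x) := by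
    intro x
    rw [intervalIntegral.integral_sub (hG x).intervalIntegrable (by simp),
      intervalIntegral.integral_const, smul_eq_mul]
    congr 1
    symm
    refine intervalIntegral.integral_eq_sub_of_hasDeriv_right
      (fun τ hτ => (((hf.hasDerivWithinAt hT (hsub hτ) x).continuousWithinAt).mono hsub))
      (fun τ hτ => ?_) (hG x).intervalIntegrable
    have hτ' : τ ∈ Ioo 0 T := ⟨(le_min ht.1 hs.1).trans_lt hτ.1, hτ.2.trans_le (max_le ht.2 hs.2)⟩
    exact ((hf.hasDerivWithinAt hT (Ioo_subset_Icc_self hτ') x).hasDerivAt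
      (Icc_mem_nhds hτ'.1 hτ'.2)).hasDerivWithinAt
  set ν := (volume : Measure ℝ).restrict (uIoc t s) with hν
  have hνu : ν univ = ENNReal.ofReal |s - t| := by
    rw [hν, Measure.restrict_apply_univ, uIoc, Real.volume_Ioc, max_sub_min_eq_abs]
  have hsub' : uIoc t s ×ˢ (univ : Set E3) ⊆ Icc 0 T ×ˢ univ :=
    prod_mono (uIoc_subset_uIcc.trans hsub) le_rfl
  have hmeas : AEMeasurable (Function.uncurry fun τ x => dt T f τ x - dt T f t x)
      (ν.prod volume) := by
    rw [hν, ← Measure.restrict_univ (μ := (volume : Measure E3)), Measure.prod_restrict]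
    refine ContinuousOn.aemeasurable ?_ (measurableSet_uIoc.prod MeasurableSet.univ)
    exact (hcont.mono hsub').sub (hcs.comp continuous_snd).continuousOn
  have hmx : ∀ x, AEMeasurable (fun τ => dt T f τ x - dt T f t x) ν := fun x =>
    ContinuousOn.aemeasurable (((hG x).mono uIoc_subset_uIcc).sub continuousOn_const)
      measurableSet_uIoc
  have e : eLpNorm (fun x => f s x - f t x - (s - t) * dt T f t x) 2 volume
      = eLpNorm (fun x => ∫ τ, (dt T f τ x - dt T f t x) ∂ν) 2 volume :=
    eLpNorm_congr_norm_ae (Eventually.of_forall fun x => by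
      rw [ftc x, intervalIntegral.norm_intervalIntegral_eq])
  rw [e, ← ENNReal.pow_le_pow_left_iff two_ne_zero, eLpNorm_two_sq]
  calc ∫⁻ x, ‖∫ τ, (dt T f τ x - dt T f t x) ∂ν‖ₑ ^ 2
      ≤ ν univ * ∫⁻ τ, ∫⁻ x, ‖dt T f τ x - dt T f t x‖ₑ ^ 2 ∂volume ∂ν :=
        lintegral_sq_integral_le ν volume hmeas hmx
    _ ≤ ν univ * ∫⁻ _, ENNReal.ofReal ε ^ 2 ∂ν := by
        refine mul_le_mul_right (setLIntegral_mono' measurableSet_uIoc fun τ hτ => ?_) _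
        rw [← eLpNorm_two_sq]
        exact pow_le_pow_left₀ (by simp) (hclose τ hτ) 2
    _ = ENNReal.ofReal (ε * |s - t|) ^ 2 := by
        rw [lintegral_const, hνu, ENNReal.ofReal_mul hε.le]
        ring

end

section

variable {T t : ℝ} {ρ : ℝ → E3 → ℝ} {u : ℝ → E3 → E3} {P : ℝ → E3 → ℝ}

/-! ### The time derivatives of `Φ` and `Γ` -/

/-- The coordinate `y ↦ y k` as a continuous linear map. -/
abbrev coordL (k : Fin 3) : E3 →L[ℝ] ℝ := EuclideanSpace.proj k

lemma pd_pd_component {w : E3 → E3} (hw : ContDiff ℝ ∞ w) (i j k : Fin 3) (x : E3) :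
    pd i (pd j fun y => w y k) x = coordL k (iteratedFDeriv ℝ 2 w x ![ee i, ee j]) := by
  have hc : ContDiff ℝ ∞ fun y => w y k := (coordL k).contDiff.comp hw
  rw [pd_pd_eq_iteratedFDeriv i j hc]
  have := (coordL k).iteratedFDeriv_comp_left (hw.contDiffAt (x := x)) (i := 2)
    (WithTop.coe_le_coe.2 le_top)
  rw [show (fun y => w y k) = coordL k ∘ w from rfl, this]
  rfl

lemma hasL2Deriv_pd_pd (hT : 0 < T) (hu : SmoothOn T u) (hc : ContinuousHInf T (dt T u))
    (ht : t ∈ Icc 0 T) (i j k : Fin 3) :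
    HasL2Deriv T t (fun s => pd i (pd j fun y => u s y k))
      (pd i (pd j fun y => dt T u t y k)) := by
  have hf : SmoothOn T fun s y => u s y k := hu.clm (coordL k)
  have e : ∀ s ∈ Icc 0 T, dt T (fun s => pd i (pd j fun y => u s y k)) s
      = pd i (pd j fun y => dt T u s y k) := fun s hs => by
    have e1 : dt T (fun s y => u s y k) s = fun y => dt T u s y k :=
      funext fun y => hu.dt_clm hT (coordL k) hs y
    have e2 : dt T (fun s => pd j fun y => u s y k) s = pd j fun y => dt T u s y k := by
      rw [← e1]; exact funext fun y => hf.dt_pd hT j hs y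
    rw [← e2]
    exact funext fun y => (hf.pd hT j).dt_pd hT i hs y
  rw [← e t ht]
  refine ((hf.pd hT j).pd hT i).hasL2Deriv hT ht ?_
  refine tendsto_of_tendsto_of_tendsto_of_le_of_le' tendsto_const_nhds ((hc 2 t ht).2)
    (Eventually.of_forall fun _ => zero_le) ?_
  filter_upwards [self_mem_nhdsWithin] with s hs
  refine eLpNorm_mono fun x => ?_
  have c1 := (hu.dt_smooth hT).slice hs
  have c2 := (hu.dt_smooth hT).slice ht
  rw [e s hs, e t ht, Pi.sub_apply, Pi.sub_apply, pd_pd_component c1, pd_pd_component c2,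
    ← map_sub, ← sub_apply]
  have hk : ∀ y : E3, ‖coordL k y‖ ≤ ‖y‖ := fun y => PiLp.norm_apply_le y k
  refine (hk _).trans ?_
  simpa [Fin.prod_univ_two] using
    (iteratedFDeriv ℝ 2 (dt T u s) x - iteratedFDeriv ℝ 2 (dt T u t) x).le_opNorm ![ee i, ee j]

variable {v : E3 → E3}

lemma pd_two_angularPart (hv : ∀ k, ContDiff ℝ ∞ fun x => v x k) :
    pd 2 (angularPart v) = avg 1 fun x =>
      pd 2 (pd 0 fun y => v y 1) x - pd 2 (pd 1 fun y => v y 0) x := by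
  have h1 := contDiff_pd 0 (hv 1)
  have h2 := contDiff_pd 1 (hv 0)
  funext x
  rw [angularPart, pd_two_avg 1 (h1.sub h2)]
  congr 1
  exact funext fun y => pd_sub 2 (smooth_differentiable h1) (smooth_differentiable h2) y

lemma gam_radialPart (hv : ∀ k, ContDiff ℝ ∞ fun x => v x k) :
    CylField.gam (fun i x => v x i) (radialPart v) = avg 1 fun x =>
      pd 2 (pd 0 fun y => v y 0) x + pd 2 (pd 1 fun y => v y 1) x
        - (pd 0 (pd 0 fun y => v y 2) x + pd 1 (pd 1 fun y => v y 2) x) := by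
  have h1 := contDiff_pd 0 (hv 0)
  have h2 := contDiff_pd 1 (hv 1)
  have c := fun i j k => (contDiff_pd i (contDiff_pd j (hv k))).continuous
  funext x
  rw [CylField.gam, radialPart, pd_two_avg 1 (h1.add h2), kap,
    avg_sub 1 (f := fun x => pd 2 (pd 0 fun y => v y 0) x + pd 2 (pd 1 fun y => v y 1) x)
      (g := fun x => pd 0 (pd 0 fun y => v y 2) x + pd 1 (pd 1 fun y => v y 2) x)
      ((c 2 0 0).add (c 2 1 1)) ((c 0 0 2).add (c 1 1 2))]
  congr 2
  exact funext fun y => pd_add 2 (smooth_differentiable h1) (smooth_differentiable h2) y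

/-- `Φ` and `Γ` are differentiable in time with values in `L²`, being averages of second
derivatives of the velocity. -/
lemma hasL2Deriv_vorticity (hT : 0 < T) (hu : SmoothOn T u) (hc : ContinuousHInf T (dt T u))
    (ht : t ∈ Icc 0 T) :
    HasL2Deriv T t (fun s => pd 2 (angularPart (u s))) (pd 2 (angularPart (dt T u t))) ∧
    HasL2Deriv T t (fun s => CylField.gam (fun i x => u s x i) (radialPart (u s)))
      (CylField.gam (fun i x => dt T u t x i) (radialPart (dt T u t))) := by
  have hs : ∀ s ∈ Icc 0 T, ∀ k, ContDiff ℝ ∞ fun x => u s x k := fun s hs k =>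
    (hu.clm (coordL k)).slice hs
  have hw : ∀ k, ContDiff ℝ ∞ fun x => dt T u t x k := fun k =>
    ((hu.dt_smooth hT).clm (coordL k)).slice ht
  have h := hasL2Deriv_pd_pd hT hu hc ht
  have cu : ∀ i j k, ∀ s ∈ Icc 0 T, Continuous (pd i (pd j fun y => u s y k)) :=
    fun i j k s hst => (contDiff_pd i (contDiff_pd j (hs s hst k))).continuous
  have cw : ∀ i j k, Continuous (pd i (pd j fun y => dt T u t y k)) :=
    fun i j k => (contDiff_pd i (contDiff_pd j (hw k))).continuous
  constructor
  · refine (((h 2 0 1).sub (h 2 1 0) ht (cu 2 0 1) (cu 2 1 0) (cw 2 0 1) (cw 2 1 0)).avg ht le_rfl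
      (fun s hst => (cu 2 0 1 s hst).sub (cu 2 1 0 s hst)) ((cw 2 0 1).sub (cw 2 1 0))).congr ht
      (fun s hst x => congrFun (pd_two_angularPart (hs s hst)) x)
      (congrFun (pd_two_angularPart hw))
  · have h1 := (h 2 0 0).add (h 2 1 1) ht (cu 2 0 0) (cu 2 1 1) (cw 2 0 0) (cw 2 1 1)
    have h2 := (h 0 0 2).add (h 1 1 2) ht (cu 0 0 2) (cu 1 1 2) (cw 0 0 2) (cw 1 1 2)
    have c1 := fun s hst => (cu 2 0 0 s hst).add (cu 2 1 1 s hst)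
    have c2 := fun s hst => (cu 0 0 2 s hst).add (cu 1 1 2 s hst)
    have d1 := (cw 2 0 0).add (cw 2 1 1)
    have d2 := (cw 0 0 2).add (cw 1 1 2)
    exact ((h1.sub h2 ht c1 c2 d1 d2).avg ht le_rfl (fun s hst => (c1 s hst).sub (c2 s hst))
      (d1.sub d2)).congr ht (fun s hst x => congrFun (gam_radialPart (hs s hst)) x)
      (congrFun (gam_radialPart hw))

/-! ### Smooth axisymmetric solutions -/

/-- The time derivative of an axisymmetric field is axisymmetric. -/
lemma axisymmetricVector_dt (hT : 0 < T) (hu : SmoothOn T u)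
    (hax : ∀ s ∈ Icc 0 T, AxisymmetricVector (u s)) (ht : t ∈ Icc 0 T) :
    AxisymmetricVector (dt T u t) := by
  have key : ∀ e : E3 → E3, (∀ s ∈ Icc 0 T, AxisymmetricScalar fun x => inner ℝ (u s x) (e x)) →
      AxisymmetricScalar fun x => inner ℝ (dt T u t x) (e x) := by
    intro e he x y hr h2
    have hd : ∀ z, HasDerivWithinAt (fun s => inner ℝ (u s z) (e z))
        (inner ℝ (dt T u t z) (e z)) (Icc 0 T) t := fun z => by
      simpa using (hu.hasDerivWithinAt hT ht z).inner ℝ (hasDerivWithinAt_const t (Icc 0 T) (e z))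
    refine (uniqueDiffOn_Icc hT t ht).eq_deriv _ (hd x) ?_
    exact (hd y).congr (fun s hs => he s hs x y hr h2) (he t ht x y hr h2)
  refine ⟨key eR fun s hs => (hax s hs).1, key eTheta fun s hs => (hax s hs).2.1, ?_⟩
  have h3 := key (fun _ => ee 2) fun s hs => by
    simpa [EuclideanSpace.inner_single_right, comp3, Function.comp_def] using! (hax s hs).2.2
  simpa [EuclideanSpace.inner_single_right] using! h3

/-- The momentum equation in the form `∂ₜ u + u · ∇u = (1 + a) (Δu - ∇P)`. -/
lemma SolvesINS.momentum_nonconservative (hT : 0 < T) (h : SolvesINS T ρ u P)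
    (pos : ∀ t ∈ Icc 0 T, ∀ x, 0 < ρ t x) (hρ : SmoothOn T ρ) (hu : SmoothOn T u)
    (ht : t ∈ Icc 0 T) (i : Fin 3) (x : E3) :
    dt T u t x i + adv (fun i x => u t x i) (fun y => u t y i) x
      = (1 + aOf ρ t x) * (lapl (fun y => u t y i) x - pd i (P t) x) := by
  have hs : ∀ k, ContDiff ℝ ∞ fun x => u t x k := fun k => (hu.clm (coordL k)).slice ht
  have hr := hρ.slice ht
  have dr := smooth_differentiable hr
  have ds := fun k => smooth_differentiable (hs k)
  have m1 := h.mass t ht x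
  have m2 := h.momentum t ht x i
  have e1 : dt T (fun s y => ρ s y * u s y i) t x
      = dt T ρ t x * u t x i + ρ t x * dt T u t x i := by
    have h1 := hρ.hasDerivWithinAt hT ht x
    have h2 := (coordL i).hasFDerivAt.comp_hasDerivWithinAt t (hu.hasDerivWithinAt hT ht x)
    exact (h1.mul h2).derivWithin (uniqueDiffOn_Icc hT t ht)
  have e2 : ∀ j, pd j (fun y => ρ t y * u t y i * u t y j) x
      = u t x i * pd j (fun y => ρ t y * u t y j) x
        + ρ t x * (u t x j * pd j (fun y => u t y i) x) := fun j => by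
    have : (fun y => ρ t y * u t y i * u t y j) = fun y => u t y i * (ρ t y * u t y j) := by
      funext y; ring
    rw [this, pd_mul j (ds i) (dr.fun_mul (ds j))]
    ring
  have e3 : div (fun y => ρ t y • u t y) x = ∑ j, pd j (fun y => ρ t y * u t y j) x := rfl
  rw [e1, laplacian_eq_sum_pd (hs i)] at m2
  simp only [e2, Finset.sum_add_distrib, ← Finset.mul_sum] at m2
  rw [← e3] at m2
  have hp := (pos t ht x).ne'
  have e4 : 1 + aOf ρ t x = (ρ t x)⁻¹ := by rw [aOf]; ring
  rw [e4, eq_inv_mul_iff_mul_eq₀ hp, lapl, adv]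
  linear_combination m2 - u t x i * m1

namespace SmoothAxisymmetricSolution

variable (h : SmoothAxisymmetricSolution T ρ u P)

include h

lemma cylField (ht : t ∈ Icc 0 T) :
    CylField (fun i x => u t x i) (radialPart (u t)) (angularPart (u t)) :=
  (h.axi_u t ht).cylField fun i =>
    sobInf_of_iteratedFDeriv (h.smooth_u.slice ht) (fun k => (h.sobolev_u k t ht).1) (coordL i)

lemma cylField_dt (hT : 0 < T) (ht : t ∈ Icc 0 T) :
    CylField (fun i x => dt T u t x i) (radialPart (dt T u t)) (angularPart (dt T u t)) :=
  (axisymmetricVector_dt hT h.smooth_u h.axi_u ht).cylField fun i =>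
    sobInf_of_iteratedFDeriv ((h.smooth_u.dt_smooth hT).slice ht)
      (fun k => (h.sobolev_dt_u k t ht).1) (coordL i)

lemma memLp_gradient_pressure (ht : t ∈ Icc 0 T) : MemLp (∇ (P t)) 2 volume :=
  (memLp_congr_norm (h.sobolev_grad_P 0 t ht).1.1
    (continuous_gradient (h.smooth_P.slice ht)).aestronglyMeasurable
    (Eventually.of_forall fun x => by simp)).1 (h.sobolev_grad_P 0 t ht).1

lemma sobInf_pd_pressure (ht : t ∈ Icc 0 T) (i : Fin 3) : SobInf (pd i (P t)) := by
  have hs : ContDiff ℝ ∞ (∇ (P t)) :=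
    (InnerProductSpace.toDual ℝ E3).symm.toContinuousLinearEquiv.contDiff.comp
      ((h.smooth_P.slice ht).fderiv_right (m := ∞) (by simp))
  have := sobInf_of_iteratedFDeriv hs (fun k => (h.sobolev_grad_P k t ht).1) (coordL i)
  rwa [show (fun x => coordL i (∇ (P t) x)) = pd i (P t) from
    funext fun x => gradient_apply (P t) x i] at this

lemma axisCoeff (ht : t ∈ Icc 0 T) (h0 : ∀ x, rad x = 0 → aOf ρ t x = 0) :
    MemLp (fun x => aOf ρ t x / rad x) ⊤ volume ∧
      ∃ B, AxisCoeff (aOf ρ t) B (lpNorm (fun x => aOf ρ t x / rad x) ⊤ volume) := by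
  have hs : ContDiff ℝ ∞ (aOf ρ t) :=
    (contDiff_const.div (h.smooth_rho.slice ht) fun x => (h.pos t ht x).ne').sub contDiff_const
  have hax : AxisymmetricScalar (aOf ρ t) := fun x y hr h2 => by
    rw [aOf, aOf, h.axi_rho t ht x y hr h2]
  refine axisCoeff_of_bounded hs (hax.axi (smooth_differentiable hs)) (fun k => ?_) h0
  obtain ⟨B, hB⟩ := h.bounded_a k
  exact ⟨B, hB t ht⟩

lemma hasDerivWithinAt_energy (hT : 0 < T) (ht : t ∈ Icc 0 T) :
    HasDerivWithinAt (fun s => norm2 (PhiOf (u s)) ^ 2 + norm2 (GammaOf (u s)) ^ 2)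
      (2 * (∫ x, pd 2 (angularPart (u t)) x * pd 2 (angularPart (dt T u t)) x)
        + 2 * ∫ x, CylField.gam (fun i x => u t x i) (radialPart (u t)) x
          * CylField.gam (fun i x => dt T u t x i) (radialPart (dt T u t)) x) (Icc 0 T) t := by
  obtain ⟨h1, h2⟩ := hasL2Deriv_vorticity hT h.smooth_u h.sobolev_dt_u ht
  have d1 := h1.hasDerivWithinAt_norm2_sq ht (fun s hs => ((h.cylField hs).mem_c.pd 2).memLp)
    ((h.cylField_dt hT ht).mem_c.pd 2).memLp
  have d2 := h2.hasDerivWithinAt_norm2_sq ht (fun s hs => (h.cylField hs).mem_gam.memLp)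
    (h.cylField_dt hT ht).mem_gam.memLp
  have e : ∀ s ∈ Icc 0 T, norm2 (PhiOf (u s)) ^ 2 + norm2 (GammaOf (u s)) ^ 2
      = norm2 (pd 2 (angularPart (u s))) ^ 2
        + norm2 (CylField.gam (fun i x => u s x i) (radialPart (u s))) ^ 2 := fun s hs => by
    have hv := h.cylField hs
    rw [norm2_congr hv.phiOf_ae_eq, norm2_congr hv.gammaOf_ae_eq]
    congr 2
    exact lpNorm_fun_neg _ _ _
  exact (d1.add d2).congr e (e t ht)

end SmoothAxisymmetricSolution

end

end AxiNS

end

theorem lemma2p6 :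
    ∃ C C₀ : ℝ, 0 < C ∧ 0 < C₀ ∧
      ∀ (T : ℝ) (ρ : ℝ → AxiNS.E3 → ℝ) (u : ℝ → AxiNS.E3 → AxiNS.E3) (P : ℝ → AxiNS.E3 → ℝ),
        0 < T →
        AxiNS.SmoothAxisymmetricSolution T ρ u P →
        (∀ t ∈ Icc 0 T, ∀ x, AxiNS.rad x = 0 → AxiNS.aOf ρ t x = 0) →
        ∀ t ∈ Icc 0 T,
          -- all the norms in the inequality are finite
          (MemLp (AxiNS.PhiOf (u t)) 2 volume ∧ MemLp (AxiNS.GammaOf (u t)) 2 volume ∧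
            MemLp (∇ (AxiNS.PhiOf (u t))) 2 volume ∧ MemLp (∇ (AxiNS.GammaOf (u t))) 2 volume ∧
            MemLp (∇ (P t)) 2 volume ∧ MemLp (∇ (AxiNS.omegaTheta (u t))) 2 volume ∧
            MemLp (AxiNS.crossVort (u t)) 2 volume ∧
            MemLp (AxiNS.compTheta (u t)) 3 volume ∧
            MemLp (fun x => AxiNS.aOf ρ t x / AxiNS.rad x) ⊤ volume) ∧
          -- the energy inequality
          ∃ D : ℝ,
            HasDerivWithinAt
              (fun s => AxiNS.norm2 (AxiNS.PhiOf (u s)) ^ 2 + AxiNS.norm2 (AxiNS.GammaOf (u s)) ^ 2)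
              D (Icc 0 T) t ∧
            1 / 2 * D + AxiNS.norm2 (∇ (AxiNS.PhiOf (u t))) ^ 2
                + AxiNS.norm2 (∇ (AxiNS.GammaOf (u t))) ^ 2
              ≤ C * lpNorm (fun x => AxiNS.aOf ρ t x / AxiNS.rad x) ⊤ volume
                  * (AxiNS.norm2 (∇ (P t)) + AxiNS.norm2 (∇ (AxiNS.omegaTheta (u t)))
                    + AxiNS.norm2 (AxiNS.GammaOf (u t)) + AxiNS.norm2 (AxiNS.crossVort (u t)))
                  * (AxiNS.norm2 (∇ (AxiNS.GammaOf (u t))) + AxiNS.norm2 (∇ (AxiNS.PhiOf (u t))))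
                + C₀ * lpNorm (AxiNS.compTheta (u t)) 3 volume
                  * AxiNS.norm2 (∇ (AxiNS.GammaOf (u t))) * AxiNS.norm2 (∇ (AxiNS.PhiOf (u t))) := by
  -- each of the four norms occurs at most twice among the density terms; stretching costs `3 sobC`,
  -- and the swirl term in the equation of `Γ` costs `2 hardyC²`
  refine ⟨2, 3 * AxiNS.sobC + 2 * AxiNS.hardyC ^ 2, by norm_num, ?_, ?_⟩
  · have := AxiNS.sobC_pos
    positivity
  intro T ρ u P hT h h0 t ht
  have hv := h.cylField ht
  have hdiv : ∀ x, ∑ i, AxiNS.pd i (fun y => u t y i) x = 0 := h.solves.incompressible t ht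
  obtain ⟨ha, B, hB⟩ := h.axisCoeff ht (h0 t ht)
  have hP := h.memLp_gradient_pressure ht
  refine ⟨⟨(hv.mem_c.pd 2).neg.memLp.ae_eq hv.phiOf_ae_eq.symm,
    hv.mem_gam.memLp.ae_eq hv.gammaOf_ae_eq.symm,
    (hv.mem_c.pd 2).neg.memLp_gradient.ae_eq hv.gradient_phiOf_ae_eq.symm,
    hv.mem_gam.memLp_gradient.ae_eq hv.gradient_gammaOf_ae_eq.symm, hP,
    hv.memLp_gradient_omegaTheta hdiv, hv.memLp_rad_mul_lap5.2.ae_eq hv.crossVort_ae_eq.symm,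
    hv.compTheta_eq ▸ hv.memLp_rad_mul_swirl, ha⟩, _, h.hasDerivWithinAt_energy hT ht, ?_⟩
  have hPs := h.smooth_P.slice ht
  have E := AxiNS.energy_inequality hv hdiv (h.cylField_dt hT ht) hB hPs
    ((h.axi_P t ht).axi (AxiNS.smooth_differentiable hPs)) (h.sobInf_pd_pressure ht) hP
    (h.solves.momentum_nonconservative hT h.pos h.smooth_rho h.smooth_u ht)
  linarith
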